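/- Let $p\ge 5$ be a prime and let $F/\mathbb{Q}_p$ be a non-trivial totally ramified finite extension, with valuation ring $\mathcal{O}$, maximal ideal $\mathfrak{m}$, uniformizer $\varpi$, residue field $k=\mathbb{F}_p$ and ramification index $e\ge 2$. Let $E$ be a field extension of $k$, put $G=\mathrm{GL}_2(\mathcal{O}/\mathfrak{m}^2)$ and let $B\le G$ be the subgroup of upper triangular matrices. For $x\in k$ let $[x]\in\mathcal{O}$ be its Teichmüller lift. For $r\in\mathbb{Z}/(p-1)\mathbb{Z}$ let $V_{2,r}=\mathrm{Ind}_B^G\chi_r$ over $E$, where $\chi_r\begin{pmatrix}a&b\\0&d\end{pmatrix}=d_0^r$ and $d_0\in k^\times$ is the reduction of $d$; it consists of the functions $\varphi:G\to E$ with $\varphi(bx)=\chi_r(b)\varphi(x)$, with $G$ acting by right translation. *Exponents.* Let $\widetilde{\mathbb{N}}=\{0,1,\dots,p-1\}$, with its usual order. Identify $\widetilde{\mathbb{N}}\setminus\{0\}$ with $\mathbb{Z}/(p-1)\mathbb{Z}$; in particular $r$ is regarded as an element of $\{1,\dots,p-1\}$. All differences such as $r-2\gamma$ and $r-i$ below are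 computed modulo $p-1$ and regarded as elements of $\{1,\dots,p-1\}$. *Basis.* For $g\in G$ and $v\in E$ let $g\otimes v\in V_{2,r}$ be the function supported on $Bg^{-1}$ with $bg^{-1}\mapsto\chi_r(b)v$. For $j_0,j_1\in\widetilde{\mathbb{N}}$ let $f_{(j_0,j_1)}=\sum_{\lambda}\begin{pmatrix}\lambda&1\\1&0\end{pmatrix}\otimes\lambda_0^{j_0}\lambda_1^{j_1}$, the sum being over all $\lambda=[\lambda_0]+[\lambda_1]\varpi\in\mathcal{O}/\mathfrak{m}^2$ with $\lambda_0,\lambda_1\in k$ (and $0^0=1$), and let $f_{(\infty,j_1)}=\begin{pmatrix}0&1\\1&0\end{pmatrix}f_{(0,j_1)}$. *Types.* Let $\le_r$ be the preorder on $\Theta=(\widetilde{\mathbb{N}}\cup\{\infty\})\times\widetilde{\mathbb{N}}$ generated by the following relations, where $j_0,j_1\in\widetilde{\mathbb{N}}$: $(j_0-1,j_1)\le_r(j_0,j_1)$ if $j_0\ge1$; $(j_0,j_1-1)\le_r(j_0,j_1)$ and $(j_0+1,j_1-1)\le_r(j_0,j_1)$ if $j_1\ge 1$, where $j_0+1$ means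 $1$ if $j_0=p-1$; $(r-2j_1-j_0,j_1)\le_r(j_0,j_1)$ if $j_0\neq0$; $(r-2j_1,j_1-1)\le_r(\infty,j_1)$ if $j_1\ge1$; $((r-2j_1)-1,j_1)\le_r(\infty,j_1)$, where $1$ is subtracted as an integer from $r-2j_1\in\{1,\dots,p-1\}$; $(0,j_1)\le_r(\infty,j_1)$ and $(\infty,j_1)\le_r(0,j_1)$. Attach to $(j_0,j_1)$ with $j_0\neq\infty$ the pair $(I,\gamma)$ with $\gamma=j_1$ and $I=\{0\}$ if $j_0+(r-2j_1-j_0)\ge p$ as integers (with $r-2j_1-j_0\in\{1,\dots,p-1\}$), $I=\varnothing$ otherwise; attach $(\varnothing,j_1)$ to $(\infty,j_1)$. This identifies the set of equivalence classes of $\le_r$ (the types) with the set of all $2p$ pairs $(I,\gamma)$, $I\subseteq\{0\}$, $\gamma\in\widetilde{\mathbb{N}}$. Let $V_{(I,\gamma)}$ be the span of the $f_{(j_0,j_1)}$ whose type is $\le_r(I,\gamma)$, and let $L(I,\gamma)=V_{(I,\gamma)}/\sum_{(I',\gamma')<_r(I,\gamma)}V_{(I',\gamma')}$. *Serre weights.*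 Let $\det^i\otimes\mathrm{Sym}^m$ be the representation of $G$, through $\mathrm{GL}_2(k)$, on homogeneous polynomials of degree $m$ in $X,Y$ over $E$ with $g=\begin{pmatrix}a&b\\c&d\end{pmatrix}$ sending $P(X,Y)$ to $\det(g)^iP(aX+cY,bX+dY)$. Below, "$\sigma$ appears with multiplicity $m$, as $L(t_1),\dots,L(t_m)$" means that exactly $m$ factors of any composition series of $V_{2,r}$ are isomorphic to $\sigma$, and that $L(t)\simeq\sigma$ exactly for $t\in\{t_1,\dots,t_m\}$. **Statement.** For every $r$, the subspaces $V_{(I,\gamma)}$ are $G$-stable, the $L(I,\gamma)$ are irreducible, and $V_{2,r}$ has exactly $2p$ Jordan–Hölder constituents, namely the $L(I,\gamma)$ with $I\subseteq\{0\}$ and $\gamma\in\widetilde{\mathbb{N}}$, each occurring once in a composition series. Moreover: 1. Suppose that $r$ is odd. Then (a) $\mathrm{Sym}^r$ appears with multiplicity three, as $L(\varnothing,0)$, $L(\{0\},r)$ and $L(\varnothing,p-1)$; (b) $\det^r\otimes\mathrm{Sym}^{p-1-r}$ appears with multiplicity three, as $L(\{0\},0)$, $L(\varnothing,r)$ and $L(\{0\},p-1)$;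 (c) for each of the $p-3$ elements $i\in\widetilde{\mathbb{N}}\setminus\{0,r,p-1\}$, the weight $\det^i\otimes\mathrm{Sym}^{r-2i}$ appears with multiplicity two, as $L(\varnothing,i)$ and $L(\{0\},r-i)$. 2. Suppose that $r$ is even and $r\neq p-1$. Then (a) $\mathrm{Sym}^r$ appears with multiplicity three, as $L(\varnothing,0)$, $L(\{0\},r)$ and $L(\varnothing,p-1)$; (b) $\det^r\otimes\mathrm{Sym}^{p-1-r}$ appears with multiplicity three, as $L(\{0\},0)$, $L(\varnothing,r)$ and $L(\{0\},p-1)$; (c) there are exactly two $\gamma\in\widetilde{\mathbb{N}}$ with $r-2\gamma=p-1$; for each of them $\det^\gamma\otimes\mathrm{Sym}^{p-1}$ appears with multiplicity one, as $L(\varnothing,\gamma)$, and $\det^\gamma=\det^{r-\gamma}$ appears with multiplicity one, as $L(\{0\},\gamma)$; (d) for each of the $p-5$ elements $i\in\widetilde{\mathbb{N}}\setminus\{0,r,p-1\}$ with $r-2i\neq p-1$, the weight $\det^i\otimes\mathrm{Sym}^{r-2i}$ appears with multiplicity two, as $L(\varnothing,i)$ and $L(\{0\},r-i)$. 3. Suppose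 that $r=p-1$. Then (a) $\mathrm{Sym}^{p-1}$ appears with multiplicity two, as $L(\varnothing,0)$ and $L(\varnothing,p-1)$; (b) the trivial representation appears with multiplicity two, as $L(\{0\},0)$ and $L(\{0\},p-1)$; (c) $\det^{(p-1)/2}\otimes\mathrm{Sym}^{p-1}$ and $\det^{(p-1)/2}$ each appear with multiplicity one, as $L(\varnothing,\frac{p-1}{2})$ and $L(\{0\},\frac{p-1}{2})$, respectively; (d) for each of the $p-3$ elements $i\in\widetilde{\mathbb{N}}\setminus\{0,\frac{p-1}{2},p-1\}$, the weight $\det^i\otimes\mathrm{Sym}^{r-2i}$ appears with multiplicity two, as $L(\varnothing,i)$ and $L(\{0\},r-i)$. -/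

import Mathlib

noncomputable section

namespace PrincipalSeries

open IsLocalRing

/-! ### Multiplicities of Jordan-Hölder constituents -/

section JordanHolder

variable (R : Type*) [Ring R] (M : Type*) [AddCommGroup M] [Module R M]

/-- The subquotient `N' / N` attached to two submodules `N ≤ N'` of a module. -/
abbrev Subquotient {R : Type*} [Ring R] {M : Type*} [AddCommGroup M] [Module R M]
    (N N' : Submodule R M) : Type _ :=
  N' ⧸ N.submoduleOf N'

/-- A composition series of the module `M`, from `0` to `M`. -/
def IsFullSeries {R : Type*} [Ring R] {M : Type*} [AddCommGroup M] [Module R M]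
    (s : CompositionSeries (Submodule R M)) : Prop :=
  s.head = ⊥ ∧ s.last = ⊤

/-- `M` has a composition series, and in each of them exactly `m` factors are isomorphic
to `S`. -/
def HasMultiplicity (S : Type*) [AddCommGroup S] [Module R S] (m : ℕ) : Prop :=
  (∃ s : CompositionSeries (Submodule R M), IsFullSeries s) ∧
  ∀ s : CompositionSeries (Submodule R M), IsFullSeries s →
    Nat.card {i : Fin s.length //
      Nonempty (Subquotient (s i.castSucc) (s i.succ) ≃ₗ[R] S)} = m

end JordanHolder

/-! ### The field, its valuation ring, and the group `GL₂(𝒪 / 𝔪²)` -/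

section Group

variable (p : ℕ) [Fact p.Prime] (F : Type*) [Field F] [Algebra ℚ_[p] F]
  [FiniteDimensional ℚ_[p] F]

/-- The valuation ring of a finite extension `F` of `ℚ_p`: the closed unit ball for the unique
extension to `F` of the `p`-adic absolute value (Mathlib's `spectralNorm`). -/
def integers : ValuationSubring F where
  carrier := {x | spectralNorm ℚ_[p] F x ≤ 1}
  zero_mem' := by simp [spectralNorm_zero]
  one_mem' := by simp [spectralNorm_one]
  add_mem' := fun {a b} ha hb =>
    (isNonarchimedean_spectralNorm (K := ℚ_[p]) (L := F) a b).trans (max_le ha hb)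
  mul_mem' := fun {a b} ha hb => by
    have h : spectralNorm ℚ_[p] F (a * b) = spectralNorm ℚ_[p] F a * spectralNorm ℚ_[p] F b :=
      spectralAlgNorm_mul (K := ℚ_[p]) (L := F) a b
    simp only [Set.mem_ofPred_eq] at *
    rw [h]
    exact mul_le_one₀ ha (spectralNorm_nonneg b) hb
  neg_mem' := fun {a} ha => by
    simp only [Set.mem_ofPred_eq] at *
    rwa [spectralNorm_neg (Algebra.IsAlgebraic.isAlgebraic a)]
  mem_or_inv_mem' := fun a => by
    by_cases ha : spectralNorm ℚ_[p] F a ≤ 1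
    · exact Or.inl ha
    · right
      have h0 : a ≠ 0 := by
        rintro rfl
        exact ha (by simp [spectralNorm_zero])
      have h : spectralNorm ℚ_[p] F (a * a⁻¹) =
          spectralNorm ℚ_[p] F a * spectralNorm ℚ_[p] F a⁻¹ :=
        spectralAlgNorm_mul (K := ℚ_[p]) (L := F) a a⁻¹
      rw [mul_inv_cancel₀ h0, spectralNorm_one] at h
      change spectralNorm ℚ_[p] F a⁻¹ ≤ 1
      push Not at ha
      nlinarith [spectralNorm_nonneg (K := ℚ_[p]) a⁻¹]

/-- The residue field `k` of `F`. -/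
abbrev resField : Type _ := ResidueField (integers p F)

/-- The ring `𝒪₂ = 𝒪 / 𝔪²`. -/
abbrev O₂ : Type _ := integers p F ⧸ (maximalIdeal (integers p F)) ^ 2

/-- The group `G₂ = GL₂(𝒪 / 𝔪²)`. -/
abbrev G₂ : Type _ := GL (Fin 2) (O₂ p F)

/-- The reduction map `𝒪 / 𝔪² → k`, `lam ↦ lam₀`. -/
def reduction : O₂ p F →+* resField p F :=
  Ideal.Quotient.lift _ (residue (integers p F)) fun a ha =>
    (residue_eq_zero_iff a).2 (Ideal.pow_le_self two_ne_zero ha)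

/-- The subgroup `B₂` of upper triangular matrices of `G₂`. -/
def B₂ : Subgroup (G₂ p F) where
  carrier := {g | g.1 1 0 = 0}
  one_mem' := by simp
  mul_mem' := fun {a b} ha hb => by
    simp only [Set.mem_ofPred_eq] at *
    simp [Matrix.mul_apply, Fin.sum_univ_two, ha, hb]
  inv_mem' := fun {a} ha => by
    simp only [Set.mem_ofPred_eq] at *
    change (a⁻¹ : G₂ p F).val 1 0 = 0
    rw [Matrix.coe_units_inv, Matrix.inv_def, Matrix.adjugate_fin_two]
    simp [ha]

/-- The Teichmüller lift of `x ∈ k`: the lift `y ∈ 𝒪` of `x` with `y ^ #k = y`. -/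
def teich (x : resField p F) : integers p F :=
  Classical.epsilon fun y : integers p F =>
    residue (integers p F) y = x ∧ y ^ Nat.card (resField p F) = y

/-- The matrix `(lam 1; 1 0)` in `G₂`. -/
def xi (lam : O₂ p F) : G₂ p F :=
  Matrix.GeneralLinearGroup.mk'' !![lam, 1; 1, 0] (by simp [Matrix.det_fin_two])

end Group

/-! ### Representations of `G₂` over an extension `E` of `k` -/

section Reps

variable (p : ℕ) [Fact p.Prime] (F : Type*) [Field F] [Algebra ℚ_[p] F]
  [FiniteDimensional ℚ_[p] F] (E : Type*) [Field E] [Algebra (resField p F) E]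

/-- Reduction modulo `𝔪` followed by the inclusion `k ⊆ E`. -/
def toE : O₂ p F →+* E := (algebraMap (resField p F) E).comp (reduction p F)

/-- The reduction of an element of `G₂`, as a matrix over `E`. -/
def redMat (g : G₂ p F) : Matrix (Fin 2) (Fin 2) E := g.1.map (toE p F E)

/-- The character `χ_r : (a b; 0 d) ↦ d₀ ^ r` of `B₂`. As `d₀ ∈ kˣ`, the power depends only on the
class of `r` modulo `#k - 1`. -/
def chi (r : ZMod (p - 1)) : B₂ p F →* E where
  toFun b := toE p F E (b.1.1 1 1) ^ r.val
  map_one' := by simp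
  map_mul' a b := by
    have ha : a.1.1 1 0 = 0 := a.2
    simp [Matrix.mul_apply, Fin.sum_univ_two, ha, mul_pow]

/-- `χ_r` as a one-dimensional representation. -/
def chiRep (r : ZMod (p - 1)) : Representation E (B₂ p F) E :=
  ((algebraMap E (Module.End E E) : E →+* Module.End E E) : E →* Module.End E E).comp
    (chi p F E r)

/-- The space of the principal series: the functions `φ : G₂ → E` with `φ (b x) = χ_r(b) φ(x)`. -/
def PS (r : ZMod (p - 1)) : Type _ :=
  Representation.coindV (B₂ p F).subtype (chiRep p F E r)

instance (r : ZMod (p - 1)) : AddCommGroup (PS p F E r) :=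
  inferInstanceAs (AddCommGroup (Representation.coindV (B₂ p F).subtype (chiRep p F E r)))

instance (r : ZMod (p - 1)) : Module E (PS p F E r) :=
  inferInstanceAs (Module E (Representation.coindV (B₂ p F).subtype (chiRep p F E r)))

/-- The principal series `V_{2,r} = Ind_{B₂}^{G₂} χ_r`: `G₂` acts on the functions `φ : G₂ → E` with
`φ (b x) = χ_r(b) φ(x)` by right translation, `(g φ)(x) = φ (x g)`. -/
def V₂ (r : ZMod (p - 1)) : Representation E (G₂ p F) (PS p F E r) :=
  Representation.coind (B₂ p F).subtype (chiRep p F E r)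

/-- The `E[G₂]`-module `V_{2,r}`. -/
abbrev V₂Mod (r : ZMod (p - 1)) : Type _ := (V₂ p F E r).asModule

/-- The algebra map `X_j ↦ ∑ i, g i j X_i` of polynomials in two variables. -/
def substMat (A : Matrix (Fin 2) (Fin 2) E) : MvPolynomial (Fin 2) E →ₐ[E] MvPolynomial (Fin 2) E :=
  MvPolynomial.aeval fun j => ∑ i, MvPolynomial.C (A i j) * MvPolynomial.X i

theorem substMat_homogeneous (A : Matrix (Fin 2) (Fin 2) E) {m : ℕ}
    {P : MvPolynomial (Fin 2) E} (hP : P ∈ MvPolynomial.homogeneousSubmodule (Fin 2) E m) :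
    (substMat E A).toLinearMap P ∈ MvPolynomial.homogeneousSubmodule (Fin 2) E m := by
  rw [MvPolynomial.mem_homogeneousSubmodule] at *
  have h := hP.aeval (fun j => ∑ i, MvPolynomial.C (A i j) * MvPolynomial.X (R := E) i) (n := 1)
    (fun j => MvPolynomial.IsHomogeneous.sum _ _ _ fun i _ =>
      (MvPolynomial.isHomogeneous_X E i).C_mul (A i j))
  rw [one_mul] at h
  exact h

theorem substMat_one : substMat E 1 = AlgHom.id E _ := by
  apply MvPolynomial.algHom_ext
  intro j
  fin_cases j <;> simp [substMat, Matrix.one_apply]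

theorem substMat_mul (A B : Matrix (Fin 2) (Fin 2) E) :
    substMat E (A * B) = (substMat E A).comp (substMat E B) := by
  apply MvPolynomial.algHom_ext
  intro j
  simp [substMat, Fin.sum_univ_two, Matrix.mul_apply]
  ring

/-- The space `Sym^m E²` of homogeneous polynomials of degree `m` in two variables `X, Y`. -/
def SymPow (m : ℕ) : Type _ := MvPolynomial.homogeneousSubmodule (Fin 2) E m

instance (m : ℕ) : AddCommGroup (SymPow E m) :=
  inferInstanceAs (AddCommGroup (MvPolynomial.homogeneousSubmodule (Fin 2) E m))

instance (m : ℕ) : Module E (SymPow E m) :=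
  inferInstanceAs (Module E (MvPolynomial.homogeneousSubmodule (Fin 2) E m))

/-- The action of a matrix on `Sym^m E²`. -/
def symAct (m : ℕ) (A : Matrix (Fin 2) (Fin 2) E) : SymPow E m →ₗ[E] SymPow E m :=
  (substMat E A).toLinearMap.restrict
    (p := MvPolynomial.homogeneousSubmodule (Fin 2) E m)
    (q := MvPolynomial.homogeneousSubmodule (Fin 2) E m)
    fun _ hP => substMat_homogeneous E A hP

theorem symAct_one (m : ℕ) : symAct E m 1 = 1 := by
  refine LinearMap.ext fun P => Subtype.ext ?_
  change substMat E 1 P.1 = P.1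
  rw [substMat_one]
  rfl

theorem symAct_mul (m : ℕ) (A B : Matrix (Fin 2) (Fin 2) E) :
    symAct E m (A * B) = symAct E m A * symAct E m B := by
  refine LinearMap.ext fun P => Subtype.ext ?_
  change substMat E (A * B) P.1 = substMat E A (substMat E B P.1)
  rw [substMat_mul]
  rfl

/-- The Serre weight `det^i ⊗ Sym^m E²`, where `(g P)(X, Y) = P(a X + c Y, b X + d Y)` for
`g = (a b; c d)` and `P ∈ Sym^m E²`; the group `G₂` acts through `GL₂(k)`. -/
def serreWeight (i m : ℕ) : Representation E (G₂ p F) (SymPow E m) where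
  toFun g := (redMat p F E g).det ^ i • symAct E m (redMat p F E g)
  map_one' := by
    simp [redMat, symAct_one]
  map_mul' g h := by
    have : redMat p F E (g * h) = redMat p F E g * redMat p F E h := by
      simp [redMat, Matrix.map_mul]
    rw [this, symAct_mul, Matrix.det_mul, mul_pow, smul_mul_smul_comm]

/-- The element `g ⊗ v` of `V_{2,r}`: the function supported on `B₂ g⁻¹` with
`b g⁻¹ ↦ χ_r(b) v`. -/
def tens (r : ZMod (p - 1)) (g : G₂ p F) (v : E) : PS p F E r := by
  classical
  exact ⟨fun x => if h : x * g ∈ B₂ p F then chi p F E r ⟨x * g, h⟩ * v else 0, by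
    rw [Representation.mem_coindV]
    intro b x
    by_cases hx : x * g ∈ B₂ p F
    · have hbx : b.1 * x * g ∈ B₂ p F := by
        rw [mul_assoc]
        exact (B₂ p F).mul_mem b.2 hx
      have he : (⟨b.1 * x * g, hbx⟩ : B₂ p F) = b * ⟨x * g, hx⟩ := by
        ext1
        simp [mul_assoc]
      simp only [Subgroup.coe_subtype, hx, hbx, dite_true, he, map_mul]
      simp [chiRep, mul_assoc]
    · have hbx : b.1 * x * g ∉ B₂ p F := by
        rw [mul_assoc]
        exact fun h => hx (((B₂ p F).mul_mem_cancel_left b.2).1 h)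
      rw [dif_neg hx, map_zero]
      exact dif_neg hbx⟩

end Reps

/-! ### Exponents and types, for residue field `𝔽_p`

The monoid `Ñ = ℕ / ~`, with `a ~ b` if `x ^ a = x ^ b` for all `x ∈ 𝔽_p`, is represented by the
exponents `0, 1, …, p - 1`, that is by `Fin p`, with the total order of integers.  Its non-zero
elements `1, …, p - 1` form the group `ℤ / (p - 1)`. -/

section Types

variable (p : ℕ) [Fact p.Prime]

/-- The representative in `{1, …, p - 1}` of a class modulo `p - 1`. -/
def rep (x : ZMod (p - 1)) : Fin p :=
  ⟨if x = 0 then p - 1 else x.val, by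
    have hp := (Fact.out : p.Prime).two_le
    have : NeZero (p - 1) := ⟨by omega⟩
    have := ZMod.val_lt x
    split_ifs <;> omega⟩

/-- The class modulo `p - 1` of an exponent. -/
def cl (j : Fin p) : ZMod (p - 1) := (j.val : ZMod (p - 1))

/-- The exponent `p - 1`. -/
def top : Fin p := ⟨p - 1, by have := (Fact.out : p.Prime).two_le; omega⟩

/-- The exponent `(p - 1) / 2`. -/
def half : Fin p := ⟨(p - 1) / 2, by have := (Fact.out : p.Prime).two_le; omega⟩

/-- The index set `(Ñ ∪ {∞}) × Ñ`, with `none` for `∞`. -/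
abbrev Theta : Type := Option (Fin p) × Fin p

/-- The generating relations `x ≤_r y` of the preorder on `Theta`.  A difference `a - b` in `Ñ`
is taken in the group `Ñ ∖ {0} = ℤ / (p - 1)`. -/
inductive Gen (r : ZMod (p - 1)) : Theta p → Theta p → Prop
  | lower₀ (i₀ j₀ j₁ : Fin p) : i₀.val + 1 = j₀.val → Gen r (some i₀, j₁) (some j₀, j₁)
  | lower₁ (j₀ i₁ j₁ : Fin p) : i₁.val + 1 = j₁.val → Gen r (some j₀, i₁) (some j₀, j₁)
  | shift (j₀ i₁ j₁ : Fin p) : i₁.val + 1 = j₁.val →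
      Gen r (some (rep p (cl p j₀ + 1)), i₁) (some j₀, j₁)
  | flip (j₀ j₁ : Fin p) : j₀.val ≠ 0 →
      Gen r (some (rep p (r - 2 * cl p j₁ - cl p j₀)), j₁) (some j₀, j₁)
  | infty_lower₁ (i₁ j₁ : Fin p) : i₁.val + 1 = j₁.val →
      Gen r (some (rep p (r - 2 * cl p j₁)), i₁) (none, j₁)
  | infty_lower₀ (i₀ j₁ : Fin p) : i₀.val + 1 = (rep p (r - 2 * cl p j₁)).val →
      Gen r (some i₀, j₁) (none, j₁)
  | zero_infty (j₀ j₁ : Fin p) : j₀.val = 0 → Gen r (some j₀, j₁) (none, j₁)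
  | infty_zero (j₀ j₁ : Fin p) : j₀.val = 0 → Gen r (none, j₁) (some j₀, j₁)

/-- The preorder `≤_r` on `Theta`. -/
def TypeLE (r : ZMod (p - 1)) (x y : Theta p) : Prop := Relation.ReflTransGen (Gen p r) x y

/-- Pairs `(I, γ)` with `I ⊆ {0}` and `γ ∈ Ñ`. -/
abbrev Pair : Type := Finset (Fin 1) × Fin p

/-- The set of columns with a carry in the sum of the one-digit numbers `a` and `b`. -/
def carry (a b : Fin p) : Finset (Fin 1) := if p ≤ a.val + b.val then {0} else ∅

/-- The pair `(I(j₀, r - 2 j₁ - j₀), j₁)` attached to `(j₀, j₁)`; as `(∞, j₁)` and `(0, j₁)` are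
equivalent for `≤_r`, the pair attached to `(∞, j₁)` is that of `(0, j₁)`, namely `(∅, j₁)`.
Two elements of `Theta` have the same pair exactly when they are equivalent. -/
def pairOf (r : ZMod (p - 1)) : Theta p → Pair p
  | (some j₀, j₁) => (carry p j₀ (rep p (r - 2 * cl p j₁ - cl p j₀)), j₁)
  | (none, j₁) => (∅, j₁)

/-- The strict order `t' <_r t` on pairs. -/
def PairLT (r : ZMod (p - 1)) (t' t : Pair p) : Prop :=
  ∃ x' x : Theta p, pairOf p r x' = t' ∧ pairOf p r x = t ∧ TypeLE p r x' x ∧ ¬ TypeLE p r x x'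

/-- The elements of `Theta` whose type is at most the type `t`. -/
def below (r : ZMod (p - 1)) (t : Pair p) : Set (Theta p) :=
  {y | ∃ x : Theta p, pairOf p r x = t ∧ TypeLE p r y x}

end Types

/-! ### The basis `f_{(j₀, j₁)}`, the submodules `V_{(I, γ)}` and the constituents `L(I, γ)` -/

section Constituents

variable (p : ℕ) [Fact p.Prime] (F : Type*) [Field F] [Algebra ℚ_[p] F]
  [FiniteDimensional ℚ_[p] F] (ϖ : integers p F) (E : Type*) [Field E]
  [Algebra (resField p F) E] (r : ZMod (p - 1))

/-- `f_{(j₀, j₁)} = ∑_lam (lam 1; 1 0) ⊗ lam₀ ^ j₀ lam₁ ^ j₁`, the sum running over the elements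
`lam = [lam₀] + [lam₁] ϖ` of `𝒪 / 𝔪²`, with `lam₀, lam₁ ∈ k`. -/
def basisFin (j₀ j₁ : Fin p) : PS p F E r :=
  ∑ᶠ x : resField p F × resField p F,
    tens p F E r (xi p F (Ideal.Quotient.mk _ (teich p F x.1 + teich p F x.2 * ϖ)))
      (algebraMap (resField p F) E (x.1 ^ j₀.val * x.2 ^ j₁.val))

/-- The basis element `f_{(j₀, j₁)}`, where `f_{(∞, j₁)} = w f_{(0, j₁)}` for `w = (0 1; 1 0)`. -/
def basisElt : Theta p → PS p F E r
  | (some j₀, j₁) => basisFin p F ϖ E r j₀ j₁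
  | (none, j₁) => V₂ p F E r (xi p F 0) (basisFin p F ϖ E r 0 j₁)

/-- The subspace `V_{(I, γ)}` of `V_{2,r}`: the span of the basis elements whose type is at most
`(I, γ)`. -/
def VSpan (t : Pair p) : Submodule E (PS p F E r) :=
  Submodule.span E (basisElt p F ϖ E r '' below p r t)

/-- The `G₂`-submodule generated by the subspace `V_{(I, γ)}`. -/
def VSub (t : Pair p) : Submodule (MonoidAlgebra E (G₂ p F)) (V₂Mod p F E r) :=
  Submodule.span (MonoidAlgebra E (G₂ p F)) {v | (V₂ p F E r).asModuleEquiv v ∈ VSpan p F ϖ E r t}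

/-- `L(I, γ)`, the quotient of `V_{(I, γ)}` by the sum of the `V_{(I', γ')}` with
`(I', γ') <_r (I, γ)`. -/
abbrev L (t : Pair p) : Type _ :=
  Subquotient (⨆ (t' : Pair p) (_ : PairLT p r t' t), VSub p F ϖ E r t') (VSub p F ϖ E r t)

/-- The representation `σ` appears in `V_{2,r}` with multiplicity `m`, and the pairs `(I, γ)` with
`L(I, γ)` isomorphic to `σ` are exactly the elements of `S`. -/
def AppearsAs {W : Type*} [AddCommGroup W] [Module E W] (σ : Representation E (G₂ p F) W)
    (m : ℕ) (S : Set (Pair p)) : Prop :=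
  HasMultiplicity (MonoidAlgebra E (G₂ p F)) (V₂Mod p F E r) σ.asModule m ∧
  {t : Pair p | Nonempty (L p F ϖ E r t ≃ₗ[MonoidAlgebra E (G₂ p F)] σ.asModule)} = S

/-- `V_{2,r}` has exactly `2p` Jordan-Hölder constituents, namely the `L(I, γ)`: the subspaces
`V_{(I, γ)}` are stable under `G₂`, each `L(I, γ)` is irreducible, and `V_{2,r}` has a composition
series of length `2p` whose factors are the `L(I, γ)`, each occurring once. -/
def ConstituentsAre : Prop :=
  (∀ (t : Pair p) (v : V₂Mod p F E r),
    v ∈ VSub p F ϖ E r t ↔ (V₂ p F E r).asModuleEquiv v ∈ VSpan p F ϖ E r t) ∧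
  (∀ t : Pair p, IsSimpleModule (MonoidAlgebra E (G₂ p F)) (L p F ϖ E r t)) ∧
  ∃ s : CompositionSeries (Submodule (MonoidAlgebra E (G₂ p F)) (V₂Mod p F E r)),
    IsFullSeries s ∧ s.length = 2 * p ∧
    ∃ b : Fin s.length ≃ Pair p, ∀ i : Fin s.length,
      Nonempty (Subquotient (s i.castSucc) (s i.succ) ≃ₗ[MonoidAlgebra E (G₂ p F)]
        L p F ϖ E r (b i))

end Constituents

end PrincipalSeries

end

open PrincipalSeries

/-! Since the residue field is `𝔽_p` and `p ∈ 𝔪²`, the Teichmüller section `k → 𝒪/𝔪²` is a ring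
homomorphism, and `𝒪/𝔪²` is the ring `k[ε]` with `ε² = 0`. The group is the disjoint union of a big
cell, made of the cosets `ξ_λ B`, and a small cell, made of the cosets `w ξ_{[y]ϖ} B`. Hence
`V_{2,r}` is the sum of the functions on `k × k` and the functions on `k`. In these coordinates a
few generators of the group act by substitutions: translations of `x₀` and of `x₁`, homotheties, the
shear `x₁ ↦ x₁ - a x₀`, and `λ ↦ λ⁻¹`. Expanding monomials shows that each generator sends a basis
element to a combination of elements lying below it for the relations `Gen`. Therefore every subset
of `Θ` closed downwards spans a stable subspace (`V₂_mem_spanOf`).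

Filter by the level `j₁ = c`. On the graded piece of level `c`, of dimension `p + 1`, the kernel of
reduction acts trivially, and the piece is `det^c ⊗ Ind χ_{r-2c}` for `GL₂(k)`. Put `s = r - 2c` in
`{1, …, p - 1}`. The indices `j₀ < s` together with `∞` span a copy of `det^c ⊗ Sym^s`; the indices
`j₀ ≥ s` give the quotient `det^{r-c} ⊗ Sym^{p-1-s}`. The condition `j₀ ≥ s` is the carry that
defines `I` (`pairOf_some`). Both identifications are explicit linear maps, called symbols
(`isSymbol_bot`, `isSymbol_top`); their equivariance is verified on generators and extended to the
group by `IntertwinesOn.good`.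

The number `2γ + |I|` gives a linear order refining `<_r`. The corresponding chain of stable
subspaces has `2p` steps, and the symbols identify both its factors and the `L(I, γ)` with Serre
weights. These are irreducible because `m < p` (`eq_top_of_stable`), and are distinguished by `m`
and by `i` modulo `p - 1` (`eq_of_serreWeight_equiv`). By Jordan–Hölder, the multiplicity of a
weight is the number of pairs carrying it.

What remains is arithmetic in `ℤ/(p-1)`. If `r ≠ 2i`, the weight `det^i ⊗ Sym^{r-2i}` comes from
`(∅, c)` with `c ≡ i` and from `({0}, c)` with `c ≡ r - i`. If `r = 2i`, the weights `Sym^{p-1}` and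
`Sym^0` twisted by `det^i` come from `(∅, c)` and `({0}, c)` respectively, with `c ≡ i`. The zero
class has the two representatives `0` and `p - 1` in `Ñ`, every other class has one; this produces
the multiplicities one, two and three. -/

noncomputable section

namespace PrincipalSeries

open IsLocalRing

/-! ### The ring `𝒪/𝔪²` as dual numbers over `𝔽_p` -/

section Ring

variable (p : ℕ) [Fact p.Prime] (F : Type*) [Field F] [Algebra ℚ_[p] F]
  [FiniteDimensional ℚ_[p] F]

/-- `ϖ` is a uniformizer of `F`, whose residue field has `p` elements and in which `p` is divisible
by `ϖ ^ 2`. -/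
class IsRamified (ϖ : integers p F) : Prop where
  card_resField : Nat.card (resField p F) = p
  natCast_mem : (p : integers p F) ∈ maximalIdeal (integers p F) ^ 2
  max_eq : maximalIdeal (integers p F) = Ideal.span {ϖ}

/-- The inclusion of `ℤ_p` in the valuation ring of `F`. -/
def ofPadicInt : ℤ_[p] →+* integers p F :=
  ((algebraMap ℚ_[p] F).comp (PadicInt.Coe.ringHom (p := p))).codRestrict (integers p F).toSubring
    fun x => by
      change spectralNorm ℚ_[p] F (algebraMap ℚ_[p] F x) ≤ 1
      rw [spectralNorm_extends]
      exact x.norm_le_one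

/-- Hensel's lemma for `X^p - X` at `n`: Fermat gives `p ∣ n^p - n`, and the derivative `p n^(p-1) -
1` is a unit. -/
theorem exists_teichmuller_padicInt (n : ℤ) : ∃ z : ℤ_[p], z ^ p = z ∧ (p : ℤ_[p]) ∣ z - n := by
  have hp := (Fact.out : p.Prime)
  have hd : (Polynomial.X ^ p - Polynomial.X : Polynomial ℤ_[p]).derivative =
      Polynomial.C (p : ℤ_[p]) * Polynomial.X ^ (p - 1) - 1 := by
    simp [Polynomial.derivative_X_pow]
  have hdn : ‖(Polynomial.X ^ p - Polynomial.X : Polynomial ℤ_[p]).derivative.aeval (n : ℤ_[p])‖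
      = 1 := by
    rw [hd, ← PadicInt.isUnit_iff]
    by_contra h
    have h2 := (IsLocalRing.mem_maximalIdeal _).2 h
    rw [PadicInt.maximalIdeal_eq_span_p, Ideal.mem_span_singleton] at h2
    simp only [map_sub, map_mul, Polynomial.aeval_C, map_pow, Polynomial.aeval_X, map_one] at h2
    have h3 := (dvd_sub_right (Dvd.intro _ rfl)).1 h2
    exact PadicInt.prime_p.not_isUnit (isUnit_of_dvd_one h3)
  obtain ⟨z, hz, hzn, -⟩ := hensels_lemma (F := (Polynomial.X ^ p - Polynomial.X : Polynomial ℤ_[p]))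
    (a := (n : ℤ_[p])) (by
      rw [hdn, one_pow]
      have h : (p : ℤ) ∣ n ^ p - n := by
        rw [← ZMod.intCast_zmod_eq_zero_iff_dvd]
        simp
      have := (PadicInt.norm_int_lt_one_iff_dvd (p := p) _).2 h
      simpa using this)
  refine ⟨z, ?_, ?_⟩
  · simpa [sub_eq_zero] using hz
  · rw [hdn] at hzn
    exact (PadicInt.norm_lt_one_iff_dvd _).1 hzn

variable (ϖ : integers p F) [hR : IsRamified p F ϖ]
include hR

theorem finite_resField : Finite (resField p F) := by
  refine Nat.finite_of_card_ne_zero ?_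
  rw [hR.card_resField]
  exact (Fact.out : p.Prime).ne_zero

theorem charP_resField : CharP (resField p F) p := by
  have := finite_resField p F ϖ
  have := Fintype.ofFinite (resField p F)
  refine charP_of_card_eq_prime ?_
  rw [Fintype.card_eq_nat_card, hR.card_resField]

theorem intCast_resField_surjective (x : resField p F) : ∃ n : ℤ, (n : resField p F) = x := by
  have := finite_resField p F ϖ
  have := Fintype.ofFinite (resField p F)
  have hc := charP_resField p F ϖ
  have h := (ZMod.castHom_bijective (resField p F) (n := p)
    (by rw [Fintype.card_eq_nat_card, hR.card_resField])).2 x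
  obtain ⟨y, rfl⟩ := h
  obtain ⟨n, rfl⟩ := ZMod.intCast_surjective y
  exact ⟨n, by simp⟩

theorem natCast_mem_maximalIdeal : (p : integers p F) ∈ maximalIdeal (integers p F) :=
  Ideal.pow_le_self two_ne_zero hR.natCast_mem

/-- `teich` is a choice, so a suitable lift must be exhibited. As `k` is the prime field, `x` is the
class of an integer, and the image of a `(p-1)`-torsion or zero element of `ℤ_p` serves. -/
theorem teich_spec (x : resField p F) :
    residue (integers p F) (teich p F x) = x ∧ teich p F x ^ p = teich p F x := by
  have h : ∃ y : integers p F,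
      residue (integers p F) y = x ∧ y ^ Nat.card (resField p F) = y := by
    obtain ⟨n, rfl⟩ := intCast_resField_surjective p F ϖ x
    obtain ⟨z, hz, c, hc⟩ := exists_teichmuller_padicInt p n
    refine ⟨ofPadicInt p F z, ?_, ?_⟩
    · have : ofPadicInt p F z = n + p * ofPadicInt p F c := by
        rw [← map_natCast (ofPadicInt p F), ← map_intCast (ofPadicInt p F), ← map_mul, ← hc,
          ← map_add]
        ring_nf
      rw [this, map_add, map_mul,
        (residue_eq_zero_iff (p : integers p F)).2 (natCast_mem_maximalIdeal p F ϖ)]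
      simp
    · rw [hR.card_resField, ← map_pow, hz]
  have h2 := Classical.epsilon_spec h
  have h3 : teich p F x ^ Nat.card (resField p F) = teich p F x := h2.2
  rw [hR.card_resField] at h3
  exact ⟨h2.1, h3⟩

theorem natCast_O₂ : (p : O₂ p F) = 0 := by
  rw [← map_natCast (Ideal.Quotient.mk _), Ideal.Quotient.eq_zero_iff_mem]
  exact hR.natCast_mem

omit hR in
@[simp]
theorem reduction_mk (x : integers p F) :
    reduction p F (Ideal.Quotient.mk _ x) = residue (integers p F) x := rfl

omit hR in
theorem sq_eq_zero_of_reduction {z : O₂ p F} (h : reduction p F z = 0) : z ^ 2 = 0 := by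
  obtain ⟨x, rfl⟩ := Ideal.Quotient.mk_surjective z
  rw [reduction_mk, residue_eq_zero_iff] at h
  rw [← map_pow, Ideal.Quotient.eq_zero_iff_mem]
  exact Ideal.pow_mem_pow h 2

theorem charP_O₂ : CharP (O₂ p F) p := by
  have : Nontrivial (O₂ p F) := (reduction p F).domain_nontrivial
  exact (CharP.charP_iff_prime_eq_zero (Fact.out : p.Prime)).2 (natCast_O₂ p F ϖ)

/-- Frobenius is additive on `𝒪/𝔪²` and kills the square-zero ideal, so a difference of two
Frobenius-fixed elements that lies in this ideal equals its own `p`-th power, which is zero. This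
uniqueness makes the Teichmüller section additive. -/
theorem eq_of_pow_eq {z z' : O₂ p F} (h : z ^ p = z) (h' : z' ^ p = z')
    (hr : reduction p F z = reduction p F z') : z = z' := by
  have := charP_O₂ p F ϖ
  have h2 : (z - z') ^ 2 = 0 := sq_eq_zero_of_reduction p F (by rw [map_sub, hr, sub_self])
  have h3 : (z - z') ^ p = 0 := pow_eq_zero_of_le (Fact.out : p.Prime).two_le h2
  rw [sub_pow_char, h, h'] at h3
  exact sub_eq_zero.1 h3

/-- The Teichmüller section `k → 𝒪 / 𝔪²`, which is a ring homomorphism because `p ∈ 𝔪²`. -/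
def tau : resField p F →+* O₂ p F :=
  have := charP_O₂ p F ϖ
  have hs := fun x => (teich_spec p F ϖ x).1
  have hpow : ∀ x, (Ideal.Quotient.mk (maximalIdeal (integers p F) ^ 2) (teich p F x)) ^ p =
      Ideal.Quotient.mk _ (teich p F x) := fun x => by rw [← map_pow, (teich_spec p F ϖ x).2]
  { toFun := fun x => Ideal.Quotient.mk _ (teich p F x)
    map_one' := eq_of_pow_eq p F ϖ (hpow 1) (one_pow p) (by simp [hs])
    map_zero' := eq_of_pow_eq p F ϖ (hpow 0) (zero_pow (Fact.out : p.Prime).ne_zero)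
      (by simp [hs])
    map_mul' := fun x y => eq_of_pow_eq p F ϖ (hpow _) (by rw [mul_pow, hpow, hpow])
      (by simp [hs])
    map_add' := fun x y => eq_of_pow_eq p F ϖ (hpow _) (by rw [add_pow_char, hpow, hpow])
      (by simp [hs]) }

@[simp]
theorem reduction_tau (x : resField p F) : reduction p F (tau p F ϖ x) = x :=
  (teich_spec p F ϖ x).1

omit hR in
/-- The class of the uniformizer in `𝒪 / 𝔪²`. -/
def eps : O₂ p F := Ideal.Quotient.mk _ ϖ

@[simp]
theorem reduction_eps : reduction p F (eps p F ϖ) = 0 := by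
  rw [eps, reduction_mk, residue_eq_zero_iff, hR.max_eq]
  exact Ideal.mem_span_singleton_self _

theorem eps_mul_eps : eps p F ϖ * eps p F ϖ = 0 := by
  rw [← sq]
  exact sq_eq_zero_of_reduction p F (reduction_eps p F ϖ)

/-- If `ϖ` were zero then `𝔪` would vanish, hence also `p ∈ 𝔪`, although `F` has characteristic
zero. -/
theorem uniformizer_ne_zero : ϖ ≠ 0 := by
  rintro rfl
  have h := natCast_mem_maximalIdeal p F (0 : integers p F)
  rw [hR.max_eq, Ideal.mem_span_singleton, zero_dvd_iff] at h
  have h2 : (p : F) = 0 := by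
    simpa using congrArg (Subtype.val : integers p F → F) h
  have : CharZero F := charZero_of_injective_algebraMap (algebraMap ℚ_[p] F).injective
  exact (Fact.out : p.Prime).ne_zero (by exact_mod_cast h2)

theorem mul_eps_eq_zero_iff (z : O₂ p F) : z * eps p F ϖ = 0 ↔ reduction p F z = 0 := by
  obtain ⟨x, rfl⟩ := Ideal.Quotient.mk_surjective z
  rw [eps, ← map_mul, Ideal.Quotient.eq_zero_iff_mem, reduction_mk, residue_eq_zero_iff, hR.max_eq,
    Ideal.span_singleton_pow, Ideal.mem_span_singleton, Ideal.mem_span_singleton, sq]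
  exact mul_dvd_mul_iff_right (uniformizer_ne_zero p F ϖ)

theorem exists_eq_mul_eps {z : O₂ p F} (h : reduction p F z = 0) :
    ∃ x : resField p F, z = tau p F ϖ x * eps p F ϖ := by
  obtain ⟨x, rfl⟩ := Ideal.Quotient.mk_surjective z
  rw [reduction_mk, residue_eq_zero_iff, hR.max_eq, Ideal.mem_span_singleton] at h
  obtain ⟨c, rfl⟩ := h
  refine ⟨residue _ c, ?_⟩
  change _ = _ * Ideal.Quotient.mk _ ϖ
  rw [mul_comm, map_mul, ← sub_eq_zero, ← sub_mul]
  exact (mul_eps_eq_zero_iff p F ϖ _).2 (by simp)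

/-- The element `[x₀] + [x₁] ϖ` of `𝒪 / 𝔪²`. -/
def lam (x : resField p F × resField p F) : O₂ p F := tau p F ϖ x.1 + tau p F ϖ x.2 * eps p F ϖ

@[simp]
theorem reduction_lam (x : resField p F × resField p F) :
    reduction p F (lam p F ϖ x) = x.1 := by
  simp [lam]

theorem lam_injective : Function.Injective (lam p F ϖ) := by
  rintro ⟨x, y⟩ ⟨x', y'⟩ h
  have h1 := congrArg (reduction p F) h
  simp only [reduction_lam] at h1
  subst h1
  have h2 : tau p F ϖ (y - y') * eps p F ϖ = 0 := by
    rw [map_sub, sub_mul, sub_eq_zero]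
    exact add_left_cancel h
  rw [mul_eps_eq_zero_iff, reduction_tau, sub_eq_zero] at h2
  rw [h2]

theorem lam_surjective : Function.Surjective (lam p F ϖ) := fun z => by
  obtain ⟨y, hy⟩ := exists_eq_mul_eps p F ϖ (z := z - tau p F ϖ (reduction p F z)) (by simp)
  exact ⟨(reduction p F z, y), by rw [lam, ← hy]; simp⟩

theorem isUnit_iff_reduction (z : O₂ p F) : IsUnit z ↔ reduction p F z ≠ 0 := by
  refine ⟨fun h => (h.map (reduction p F)).ne_zero, fun h => ?_⟩
  have h1 : IsUnit (tau p F ϖ (reduction p F z)) := (Ne.isUnit h).map _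
  have h2 : IsNilpotent (z - tau p F ϖ (reduction p F z)) :=
    ⟨2, sq_eq_zero_of_reduction p F (by simp)⟩
  have := h2.isUnit_add_left_of_commute h1 (Commute.all _ _)
  simpa using this

end Ring

/-! ### Vandermonde extraction of coefficients; the monomial basis of `Sym^m` -/

section Algebra

/-- Inverting a Vandermonde matrix at `n` distinct points of `k` expresses each coefficient as a
combination of values. It serves to pass from stability under a unipotent group to stability under
divided powers, and to prove independence of monomials. -/
theorem mem_of_sum_pow_smul_mem {k E V : Type*} [Field k] [Field E] [Algebra k E]
    [AddCommGroup V] [Module E V] (N : Submodule E V) {n : ℕ} (hn : n ≤ Nat.card k) [Finite k]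
    (v : ℕ → V)
    (h : ∀ x : k, ∑ l ∈ Finset.range n, algebraMap k E x ^ l • v l ∈ N) :
    ∀ l < n, v l ∈ N := by
  have : Fintype k := Fintype.ofFinite k
  obtain ⟨e⟩ : Nonempty (Fin n ↪ k) := by
    rw [Function.Embedding.nonempty_iff_card_le, Fintype.card_fin, Fintype.card_eq_nat_card]
    exact hn
  set A := Matrix.vandermonde fun i => algebraMap k E (e i) with hA
  have hdet : A.det ≠ 0 := Matrix.det_vandermonde_ne_zero_iff.2
    ((algebraMap k E).injective.comp e.injective)
  intro l hl
  have h1 : v l = ∑ i, A⁻¹ ⟨l, hl⟩ i • ∑ j : Fin n, A i j • v j := by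
    have h2 : ∀ j, ∑ i, A⁻¹ ⟨l, hl⟩ i * A i j = (1 : Matrix (Fin n) (Fin n) E) ⟨l, hl⟩ j := by
      intro j
      rw [← Matrix.nonsing_inv_mul A (Ne.isUnit hdet), Matrix.mul_apply]
    simp_rw [Finset.smul_sum, smul_smul]
    rw [Finset.sum_comm]
    simp_rw [← Finset.sum_smul, h2, Matrix.one_apply]
    simp
  rw [h1]
  refine N.sum_mem fun i _ => N.smul_mem _ ?_
  have h3 := h (e i)
  rw [Finset.sum_range] at h3
  simpa [hA, Matrix.vandermonde_apply] using h3

variable (E : Type*) [Field E]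

variable {E} in
/-- A homogeneous polynomial of degree `m` as an element of `SymPow E m`. -/
def SymPow.mk {m : ℕ} (P : MvPolynomial (Fin 2) E)
    (hP : P ∈ MvPolynomial.homogeneousSubmodule (Fin 2) E m) : SymPow E m := ⟨P, hP⟩

/-- The monomial `X ^ (m - j) Y ^ j`, or `0` if `m < j`. -/
def symMono (m j : ℕ) : SymPow E m :=
  if h : j ≤ m then SymPow.mk (MvPolynomial.X 0 ^ (m - j) * MvPolynomial.X 1 ^ j) <| by
    rw [MvPolynomial.mem_homogeneousSubmodule]
    have := (MvPolynomial.isHomogeneous_X_pow (R := E) (0 : Fin 2) (m - j)).mul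
      (MvPolynomial.isHomogeneous_X_pow (1 : Fin 2) j)
    rwa [Nat.sub_add_cancel h] at this
  else 0

variable {E}

theorem symMono_val {m j : ℕ} (h : j ≤ m) : (symMono E m j).1 =
    (MvPolynomial.X 0 ^ (m - j) * MvPolynomial.X 1 ^ j : MvPolynomial (Fin 2) E) := by
  rw [symMono, dif_pos h]
  rfl

theorem symMono_of_lt {m j : ℕ} (h : m < j) : symMono E m j = 0 := dif_neg (by omega)

theorem symMono_val_eq_monomial {m j : ℕ} (h : j ≤ m) : (symMono E m j).1 =
    MvPolynomial.monomial (Finsupp.single 0 (m - j) + Finsupp.single 1 j) 1 := by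
  rw [symMono_val h, MvPolynomial.X_pow_eq_monomial, MvPolynomial.X_pow_eq_monomial,
    MvPolynomial.monomial_mul, mul_one]

variable (E)

/-- The embedding of `SymPow E m` in the polynomial ring. -/
def SymPow.val (m : ℕ) : SymPow E m →ₗ[E] MvPolynomial (Fin 2) E :=
  (MvPolynomial.homogeneousSubmodule (Fin 2) E m).subtype

theorem linearIndependent_symMono (m : ℕ) :
    LinearIndependent E fun j : Fin (m + 1) => symMono E m j := by
  refine LinearIndependent.of_comp (SymPow.val E m) ?_
  have h := (MvPolynomial.basisMonomials (Fin 2) E).linearIndependent.comp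
    (fun j : Fin (m + 1) => Finsupp.single 0 (m - j.1) + Finsupp.single 1 j.1) (by
      intro i j hij
      have := DFunLike.congr_fun hij 1
      simpa [Fin.ext_iff] using this)
  have h2 : (⇑(SymPow.val E m) ∘ fun j : Fin (m + 1) => symMono E m j) =
      ⇑(MvPolynomial.basisMonomials (Fin 2) E) ∘ fun j : Fin (m + 1) =>
        Finsupp.single 0 (m - j.1) + Finsupp.single 1 j.1 := by
    funext j
    exact (symMono_val_eq_monomial (by omega)).trans (by simp)
  rwa [h2]

theorem span_symMono (m : ℕ) :
    Submodule.span E (Set.range fun j : Fin (m + 1) => symMono E m j) = ⊤ := by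
  rw [eq_top_iff]
  rintro P -
  have hP : MvPolynomial.IsHomogeneous P.1 m := P.2
  have h : P = ∑ d ∈ P.1.support, MvPolynomial.coeff d P.1 • symMono E m (d 1) := by
    apply Subtype.ext
    change P.1 = SymPow.val E m _
    rw [map_sum]
    conv_lhs => rw [P.1.as_sum]
    refine Finset.sum_congr rfl fun d hd => ?_
    have hd' : d 0 + d 1 = m := by
      have h := hP (MvPolynomial.mem_support_iff.1 hd)
      rw [Finsupp.weight_apply, Finsupp.sum_fintype _ _ (by simp)] at h
      simpa [Fin.sum_univ_two] using h
    rw [map_smul]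
    change _ = _ • (symMono E m (d 1)).1
    have hd2 : Finsupp.single 0 (m - d 1) + Finsupp.single 1 (d 1) = d := by
      ext i
      fin_cases i
      · simp
        omega
      · simp
    rw [symMono_val_eq_monomial (by omega : d 1 ≤ m), MvPolynomial.smul_monomial, smul_eq_mul,
      mul_one, hd2]
  rw [h]
  refine Submodule.sum_mem _ fun d _ => Submodule.smul_mem _ _ ?_
  by_cases hd : d 1 ≤ m
  · exact Submodule.subset_span ⟨⟨d 1, by omega⟩, rfl⟩
  · rw [symMono_of_lt (by omega)]
    exact Submodule.zero_mem _

/-- The monomial basis of `SymPow E m`. -/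
def symBasis (m : ℕ) : Module.Basis (Fin (m + 1)) E (SymPow E m) :=
  Module.Basis.mk (linearIndependent_symMono E m) (span_symMono E m).ge

theorem symBasis_apply (m : ℕ) (j : Fin (m + 1)) : symBasis E m j = symMono E m j := by
  simp [symBasis]

theorem finrank_symPow (m : ℕ) : Module.finrank E (SymPow E m) = m + 1 := by
  rw [Module.finrank_eq_card_basis (symBasis E m), Fintype.card_fin]

theorem symPow_eq_sum (m : ℕ) (v : SymPow E m) :
    ∃ a : ℕ → E, v = ∑ j ∈ Finset.range (m + 1), a j • symMono E m j := by
  refine ⟨fun j => if h : j < m + 1 then (symBasis E m).repr v ⟨j, h⟩ else 0, ?_⟩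
  rw [Finset.sum_range]
  conv_lhs => rw [← (symBasis E m).sum_repr v]
  simp [symBasis_apply, Fin.is_le]

theorem symMono_ne_zero {m j : ℕ} (h : j ≤ m) : symMono E m j ≠ 0 := by
  have := (symBasis E m).ne_zero ⟨j, by omega⟩
  rwa [symBasis_apply] at this

variable {E}

theorem symAct_val (m : ℕ) (A : Matrix (Fin 2) (Fin 2) E) (P : SymPow E m) :
    (symAct E m A P).1 = substMat E A P.1 := rfl

theorem substMat_X (A : Matrix (Fin 2) (Fin 2) E) (j : Fin 2) :
    substMat E A (MvPolynomial.X j) =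
      MvPolynomial.C (A 0 j) * MvPolynomial.X 0 + MvPolynomial.C (A 1 j) * MvPolynomial.X 1 := by
  simp [substMat]

theorem symAct_upper (m : ℕ) {j : ℕ} (hj : j ≤ m) (x : E) :
    symAct E m !![1, x; 0, 1] (symMono E m j) =
      ∑ i ∈ Finset.range (j + 1), (x ^ (j - i) * (j.choose i : E)) • symMono E m i := by
  apply Subtype.ext
  change _ = SymPow.val E m _
  rw [symAct_val, symMono_val hj, map_sum, map_mul, map_pow, map_pow, substMat_X, substMat_X]
  simp only [Matrix.of_apply, Matrix.cons_val', Matrix.cons_val_zero, Matrix.cons_val_one,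
    Matrix.cons_val_fin_one, map_one, map_zero, one_mul, zero_mul, add_zero]
  rw [add_comm, add_pow, Finset.mul_sum]
  refine Finset.sum_congr rfl fun i hi => ?_
  have hi' : i ≤ j := by simpa [Nat.lt_succ_iff] using hi
  rw [map_smul]
  change _ = _ • (symMono E m i).1
  rw [symMono_val (hi'.trans hj), MvPolynomial.smul_eq_C_mul, map_mul, map_pow, map_natCast,
    show m - i = (m - j) + (j - i) by omega, pow_add, mul_pow]
  ring

theorem symAct_diag (m : ℕ) {j : ℕ} (hj : j ≤ m) (x y : E) :
    symAct E m !![x, 0; 0, y] (symMono E m j) = (x ^ (m - j) * y ^ j) • symMono E m j := by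
  apply Subtype.ext
  change _ = SymPow.val E m ((x ^ (m - j) * y ^ j) • symMono E m j)
  rw [symAct_val, symMono_val hj, map_smul, map_mul, map_pow, map_pow, substMat_X, substMat_X]
  change _ = _ • (symMono E m j).1
  rw [symMono_val hj]
  simp [MvPolynomial.smul_eq_C_mul, mul_pow]
  ring

theorem symAct_swap (m : ℕ) {j : ℕ} (hj : j ≤ m) :
    symAct E m !![0, 1; 1, 0] (symMono E m j) = symMono E m (m - j) := by
  apply Subtype.ext
  rw [symAct_val, symMono_val hj, symMono_val (Nat.sub_le _ _), map_mul, map_pow, map_pow,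
    substMat_X, substMat_X]
  simp [Nat.sub_sub_self hj, mul_comm]

end Algebra

/-! ### Action of unipotent, diagonal and Weyl elements on Serre weights -/

section Group

variable (p : ℕ) [Fact p.Prime] (F : Type*) [Field F] [Algebra ℚ_[p] F]
  [FiniteDimensional ℚ_[p] F]

/-- The unipotent matrix `(1 a; 0 1)`. -/
def unip (a : O₂ p F) : G₂ p F :=
  Matrix.GeneralLinearGroup.mk'' !![1, a; 0, 1] (by simp [Matrix.det_fin_two])

/-- The diagonal matrix `(a 0; 0 d)`. -/
def dia (a d : (O₂ p F)ˣ) : G₂ p F :=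
  Matrix.GeneralLinearGroup.mk'' !![(a : O₂ p F), 0; 0, (d : O₂ p F)]
    (by simp only [Matrix.det_fin_two_of, mul_zero, sub_zero]; exact a.isUnit.mul d.isUnit)

@[simp]
theorem unip_val (a : O₂ p F) : (unip p F a).1 = !![1, a; 0, 1] := rfl

@[simp]
theorem dia_val (a d : (O₂ p F)ˣ) : (dia p F a d).1 = !![(a : O₂ p F), 0; 0, (d : O₂ p F)] := rfl

@[simp]
theorem xi_val (a : O₂ p F) : (xi p F a).1 = !![a, 1; 1, 0] := rfl

variable (E : Type*) [Field E] [Algebra (resField p F) E]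

theorem redMat_unip (a : O₂ p F) : redMat p F E (unip p F a) = !![1, toE p F E a; 0, 1] := by
  ext i j; fin_cases i <;> fin_cases j <;> simp [redMat]

theorem redMat_dia (a d : (O₂ p F)ˣ) :
    redMat p F E (dia p F a d) = !![toE p F E a, 0; 0, toE p F E d] := by
  ext i j; fin_cases i <;> fin_cases j <;> simp [redMat]

theorem redMat_xi_zero : redMat p F E (xi p F 0) = !![0, 1; 1, 0] := by
  ext i j; fin_cases i <;> fin_cases j <;> simp [redMat]

variable {m j : ℕ} (i : ℕ)

theorem serreWeight_apply (g : G₂ p F) (v : SymPow E m) : serreWeight p F E i m g v =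
    (redMat p F E g).det ^ i • symAct E m (redMat p F E g) v := rfl

theorem serreWeight_unip (hj : j ≤ m) (a : O₂ p F) :
    serreWeight p F E i m (unip p F a) (symMono E m j) =
      ∑ l ∈ Finset.range (j + 1), (toE p F E a ^ (j - l) * (j.choose l : E)) • symMono E m l := by
  rw [serreWeight_apply, redMat_unip, symAct_upper m hj]
  simp [Matrix.det_fin_two]

theorem serreWeight_dia (hj : j ≤ m) (a d : (O₂ p F)ˣ) :
    serreWeight p F E i m (dia p F a d) (symMono E m j) =
      ((toE p F E a * toE p F E d) ^ i * (toE p F E a ^ (m - j) * toE p F E d ^ j)) •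
        symMono E m j := by
  rw [serreWeight_apply, redMat_dia, symAct_diag m hj, smul_smul]
  simp [Matrix.det_fin_two]

theorem serreWeight_xi_zero (hj : j ≤ m) :
    serreWeight p F E i m (xi p F 0) (symMono E m j) = (-1 : E) ^ i • symMono E m (m - j) := by
  rw [serreWeight_apply, redMat_xi_zero, symAct_swap m hj]
  simp [Matrix.det_fin_two]

variable (ϖ : integers p F) [hR : IsRamified p F ϖ]
include hR

omit hR in
theorem toE_apply (z : O₂ p F) : toE p F E z = algebraMap (resField p F) E (reduction p F z) := rfl

@[simp]
theorem toE_tau (x : resField p F) : toE p F E (tau p F ϖ x) = algebraMap _ E x := by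
  rw [toE_apply, reduction_tau]

theorem charP_E : CharP E p := by
  have := charP_resField p F ϖ
  exact charP_of_injective_algebraMap (algebraMap (resField p F) E).injective p

theorem natCast_E_ne_zero {n : ℕ} (h : ¬ p ∣ n) : (n : E) ≠ 0 := by
  have := charP_E p F E ϖ
  rwa [Ne, CharP.cast_eq_zero_iff E p]

theorem choose_ne_zero {n l : ℕ} (hn : n < p) (hl : l ≤ n) : (n.choose l : E) ≠ 0 := by
  have hp := (Fact.out : p.Prime)
  refine natCast_E_ne_zero p F E ϖ fun h => ?_
  have h2 : p ∣ n.factorial := by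
    rw [← Nat.choose_mul_factorial_mul_factorial hl, mul_assoc]
    exact h.mul_right _
  rw [hp.dvd_factorial] at h2
  omega

/-- The divided power `D_l : X ^ (m - j) Y ^ j ↦ (j choose l) X ^ (m - j + l) Y ^ (j - l)`. -/
theorem unip_apply_eq_sum (v : SymPow E m) (a : ℕ → E)
    (hv : v = ∑ j ∈ Finset.range (m + 1), a j • symMono E m j) (x : resField p F) :
    serreWeight p F E i m (unip p F (tau p F ϖ x)) v = ∑ l ∈ Finset.range (m + 1),
      algebraMap _ E x ^ l • ∑ j ∈ Finset.range (m + 1),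
        (if l ≤ j then a j * (j.choose l : E) else 0) • symMono E m (j - l) := by
  rw [hv, map_sum]
  simp_rw [Finset.smul_sum]
  rw [Finset.sum_comm]
  refine Finset.sum_congr rfl fun j hj => ?_
  have hj' : j ≤ m := by simpa [Nat.lt_succ_iff] using hj
  rw [map_smul, serreWeight_unip p F E i hj', toE_tau, ← Finset.sum_range_reflect]
  simp only [ite_smul, zero_smul, smul_ite, smul_zero]
  rw [← Finset.sum_filter, Finset.smul_sum]
  have hs : (Finset.range (m + 1)).filter (fun l => l ≤ j) = Finset.range (j + 1) := by
    ext l; simp; omega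
  rw [hs]
  refine Finset.sum_congr rfl fun l hl => ?_
  have hl' : l ≤ j := by simpa [Nat.lt_succ_iff] using hl
  rw [show j + 1 - 1 - l = j - l by omega, Nat.choose_symm hl', Nat.sub_sub_self hl', smul_smul,
    smul_smul]
  congr 1
  ring

/-- The translate of `v` by `(1 [x]; 0 1)` is `∑ x^l D_l v`, a polynomial in `x` of degree at most
`m < p`, so `p` points suffice to isolate each `D_l v`. -/
theorem dividedPower_mem {m : ℕ} (hm : m < p)
    (N : Submodule E (SymPow E m)) {i : ℕ} (hN : ∀ g, ∀ v ∈ N, serreWeight p F E i m g v ∈ N)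
    (a : ℕ → E) (ha : ∑ j ∈ Finset.range (m + 1), a j • symMono E m j ∈ N) (l : ℕ) (hl : l ≤ m) :
    ∑ j ∈ Finset.range (m + 1),
        (if l ≤ j then a j * (j.choose l : E) else 0) • symMono E m (j - l) ∈ N := by
  have := finite_resField p F ϖ
  refine mem_of_sum_pow_smul_mem (k := resField p F) N (n := m + 1)
    (by rw [hR.card_resField]; omega) (fun l => ∑ j ∈ Finset.range (m + 1),
        (if l ≤ j then a j * (j.choose l : E) else 0) • symMono E m (j - l)) (fun x => ?_) l
        (by omega)
  rw [← unip_apply_eq_sum p F E i ϖ _ a rfl x]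
  exact hN _ _ ha

end Group

/-! ### Irreducibility and classification of Serre weights -/

section Weights

variable (p : ℕ) [Fact p.Prime] (F : Type*) [Field F] [Algebra ℚ_[p] F]
  [FiniteDimensional ℚ_[p] F] (E : Type*) [Field E] [Algebra (resField p F) E]
  (ϖ : integers p F) [hR : IsRamified p F ϖ]

omit [Algebra (resField p F) E] in
-- With `J` the largest index in the support, the divided power `D_J` annihilates all lower terms
-- and sends the leading one to a nonzero multiple of `X^m`.
theorem exists_top_coeff {m : ℕ} (a : ℕ → E) (h : ∃ j ≤ m, a j ≠ 0) :
    ∃ J ≤ m, a J ≠ 0 ∧ (∀ j ≤ m, J < j → a j = 0) ∧ ∑ j ∈ Finset.range (m + 1),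
      (if J ≤ j then a j * (j.choose J : E) else 0) • symMono E m (j - J) =
        a J • symMono E m 0 := by
  classical
  obtain ⟨j₀, hj₀, ha₀⟩ := h
  have hs : ((Finset.range (m + 1)).filter fun j => a j ≠ 0).Nonempty :=
    ⟨j₀, by simp [ha₀]; omega⟩
  obtain ⟨J, hJ, hmax⟩ := Finset.exists_maximal hs
  simp only [Finset.mem_filter, Finset.mem_range, Nat.lt_succ_iff] at hJ hmax
  have hz : ∀ j ≤ m, J < j → a j = 0 := fun j hj hJj => by
    by_contra hne
    exact absurd (hmax ⟨hj, hne⟩ hJj.le) (by omega)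
  refine ⟨J, hJ.1, hJ.2, hz, ?_⟩
  rw [Finset.sum_eq_single J]
  · simp
  · intro j hj hne
    simp only [Finset.mem_range, Nat.lt_succ_iff] at hj
    split_ifs with hle
    · rw [hz j hj (by omega)]; simp
    · simp
  · intro h
    simp only [Finset.mem_range, Nat.lt_succ_iff] at h
    exact absurd hJ.1 h

include hR

/-- A nonzero stable subspace contains `X^m` by the top divided power, then `Y^m` by the Weyl
element, then every monomial, since `D_{m-j} Y^m` is a binomial coefficient times `X^(m-j) Y^j` and
that coefficient is invertible for `m < p`. -/
theorem eq_top_of_stable {m : ℕ} (hm : m < p) {i : ℕ} (N : Submodule E (SymPow E m))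
    (hN : ∀ g, ∀ v ∈ N, serreWeight p F E i m g v ∈ N) (hbot : N ≠ ⊥) : N = ⊤ := by
  obtain ⟨v, hvN, hv0⟩ := Submodule.exists_mem_ne_zero_of_ne_bot hbot
  obtain ⟨a, rfl⟩ := symPow_eq_sum E m v
  obtain ⟨J, hJ, haJ, -, hsum⟩ := exists_top_coeff E (m := m) a (by
    by_contra! h
    refine hv0 (Finset.sum_eq_zero fun j hj => ?_)
    rw [h j (by simpa [Nat.lt_succ_iff] using hj), zero_smul])
  have h0 : symMono E m 0 ∈ N := by
    have := dividedPower_mem p F E ϖ hm N hN a hvN J hJ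
    rw [hsum] at this
    exact (N.smul_mem_iff haJ).1 this
  have hm' : symMono E m m ∈ N := by
    have := hN (xi p F 0) _ h0
    rw [serreWeight_xi_zero p F E i (Nat.zero_le _)] at this
    exact (N.smul_mem_iff (pow_ne_zero _ (by simp))).1 this
  rw [eq_top_iff, ← span_symMono, Submodule.span_le]
  rintro _ ⟨j, rfl⟩
  have hj : j.1 ≤ m := j.is_le
  have := dividedPower_mem p F E ϖ hm N hN (fun j => if j = m then 1 else 0)
    (by simpa using hm') (m - j) (Nat.sub_le _ _)
  rw [Finset.sum_eq_single m (fun b _ hb => by simp [hb]) (by simp), if_pos (Nat.sub_le _ _),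
    if_pos rfl, one_mul, Nat.sub_sub_self hj] at this
  exact (N.smul_mem_iff (choose_ne_zero p F E ϖ hm (Nat.sub_le _ _))).1 this

theorem isSimpleModule_serreWeight {m : ℕ} (hm : m < p) (i : ℕ) :
    IsSimpleModule (MonoidAlgebra E (G₂ p F)) (serreWeight p F E i m).asModule := by
  rw [← Representation.irreducible_iff_isSimpleModule_asModule]
  have : Nontrivial (SymPow E m) := ⟨symMono E m 0, 0, symMono_ne_zero E (Nat.zero_le _)⟩
  exact
    { exists_pair_ne := ⟨⊥, ⊤, fun h => bot_ne_top (α := Submodule E (SymPow E m))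
        (congrArg Subrepresentation.toSubmodule h)⟩
      eq_bot_or_eq_top := fun N => by
        by_cases h : N.toSubmodule = ⊥
        · exact Or.inl (Subrepresentation.toSubmodule_injective h)
        · exact Or.inr (Subrepresentation.toSubmodule_injective
            (eq_top_of_stable p F E ϖ hm N.toSubmodule
              (fun g v hv => N.apply_mem_toSubmodule g hv) h)) }

/-- Invariance forces `D_l v = 0` for all `l > 0`, whereas `D_J v ≠ 0` for the top index `J`; hence
`J = 0`. -/
theorem eq_smul_symMono_zero_of_fixed {m : ℕ} (hm : m < p) {i : ℕ} (v : SymPow E m)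
    (hv : ∀ x, serreWeight p F E i m (unip p F (tau p F ϖ x)) v = v) :
    ∃ c : E, v = c • symMono E m 0 := by
  have := finite_resField p F ϖ
  obtain ⟨a, hva⟩ := symPow_eq_sum E m v
  set D : ℕ → SymPow E m := fun l => ∑ j ∈ Finset.range (m + 1),
        (if l ≤ j then a j * (j.choose l : E) else 0) • symMono E m (j - l) with hD
  have hD0 : D 0 = v := by
    rw [hva, hD]
    simp
  -- The constant term `D_0 v = v` cancels against the left side of the invariance equation, so it
  -- is replaced by `0` before coefficients are extracted.
  have hDl : ∀ l < m + 1, (if l = 0 then 0 else D l) ∈ (⊥ : Submodule E (SymPow E m)) := by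
    refine mem_of_sum_pow_smul_mem (k := resField p F) ⊥ (n := m + 1)
      (by rw [hR.card_resField]; omega) (fun l => if l = 0 then 0 else D l) (fun x => ?_)
    have h := unip_apply_eq_sum p F E i ϖ v a hva x
    rw [hv x] at h
    have h2 : v = ∑ l ∈ Finset.range (m + 1), algebraMap (resField p F) E x ^ l • D l := h
    rw [Finset.sum_range_succ', hD0] at h2
    rw [Finset.sum_range_succ', Submodule.mem_bot]
    simpa using h2
  by_cases hne : ∃ j ≤ m, a j ≠ 0
  · obtain ⟨J, hJ, haJ, hz, hsum⟩ := exists_top_coeff E (m := m) a hne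
    have hJ0 : J = 0 := by
      by_contra hJ0
      have h := hDl J (by omega)
      rw [if_neg hJ0, Submodule.mem_bot] at h
      rw [hD] at h
      exact (smul_ne_zero haJ (symMono_ne_zero E (Nat.zero_le _))) (hsum.symm.trans h)
    subst hJ0
    exact ⟨a 0, by rw [← hD0]; exact hsum⟩
  · push Not at hne
    refine ⟨0, ?_⟩
    rw [hva, zero_smul]
    refine Finset.sum_eq_zero fun j hj => ?_
    rw [hne j (by simpa [Nat.lt_succ_iff] using hj), zero_smul]

theorem card_units_resField : Nat.card (resField p F)ˣ = p - 1 := by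
  have := finite_resField p F ϖ
  rw [Nat.card_units, hR.card_resField]

theorem pow_resField_eq_of_cast_eq {x : resField p F} (hx : x ≠ 0) {a b : ℕ}
    (h : (a : ZMod (p - 1)) = b) : x ^ a = x ^ b := by
  have := finite_resField p F ϖ
  have h1 : Units.mk0 x hx ^ (p - 1) = 1 := by
    rw [← card_units_resField p F ϖ, pow_card_eq_one']
  have h2 : x ^ (p - 1) = 1 := by simpa using congrArg Units.val h1
  exact pow_eq_pow_of_modEq ((ZMod.natCast_eq_natCast_iff _ _ _).1 h) h2

theorem cast_eq_of_pow_resField_eq {a b : ℕ} (h : ∀ x : (resField p F)ˣ, x ^ a = x ^ b) :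
    (a : ZMod (p - 1)) = b := by
  have := finite_resField p F ϖ
  obtain ⟨x, hx⟩ := IsCyclic.exists_generator (α := (resField p F)ˣ)
  have ho : orderOf x = p - 1 := by
    rw [orderOf_eq_card_of_forall_mem_zpowers hx, card_units_resField p F ϖ]
  rw [ZMod.natCast_eq_natCast_iff, ← ho, ← pow_eq_pow_iff_modEq]
  exact h x

theorem pow_toE_eq_of_cast_eq {z : O₂ p F} (hz : IsUnit z) {a b : ℕ}
    (h : (a : ZMod (p - 1)) = b) : toE p F E z ^ a = toE p F E z ^ b := by
  rw [toE_apply, ← map_pow (algebraMap _ E), ← map_pow (algebraMap _ E),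
    pow_resField_eq_of_cast_eq p F ϖ (hz.map (reduction p F)).ne_zero h]

theorem serreWeight_congr {i i' : ℕ} (h : (i : ZMod (p - 1)) = i') (m : ℕ) :
    serreWeight p F E i m = serreWeight p F E i' m := by
  refine MonoidHom.ext fun g => LinearMap.ext fun v => ?_
  have hd : (redMat p F E g).det = toE p F E g.1.det := by
    rw [redMat, RingHom.map_det]
    rfl
  rw [serreWeight_apply, serreWeight_apply, hd, pow_toE_eq_of_cast_eq p F E ϖ
    ((Matrix.isUnit_iff_isUnit_det _).1 g.isUnit) h]

/-- The unit `[x]` of `𝒪 / 𝔪²`. -/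
def tauUnit (x : (resField p F)ˣ) : (O₂ p F)ˣ := Units.map (tau p F ϖ).toMonoidHom x

@[simp]
theorem tauUnit_val (x : (resField p F)ˣ) : (tauUnit p F ϖ x : O₂ p F) = tau p F ϖ x := rfl

/-- The dimension recovers `m`. The line fixed by unipotents is spanned by `X^m`, on which `diag(1,
[x])` acts by `x^i`; as `kˣ` is cyclic of order `p - 1`, this recovers `i` modulo `p - 1`. -/
theorem eq_of_serreWeight_equiv {i m i' m' : ℕ} (hm' : m' < p)
    (e : (serreWeight p F E i m).asModule ≃ₗ[MonoidAlgebra E (G₂ p F)]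
      (serreWeight p F E i' m').asModule) :
    m = m' ∧ (i : ZMod (p - 1)) = i' := by
  let f : SymPow E m ≃ₗ[E] SymPow E m' := e.restrictScalars E
  have hf : ∀ g v, f (serreWeight p F E i m g v) = serreWeight p F E i' m' g (f v) := by
    intro g v
    have h := e.map_smul (MonoidAlgebra.single g 1)
      ((serreWeight p F E i m).asModuleEquiv.symm v)
    rw [Representation.single_smul, Representation.single_smul, one_smul, one_smul] at h
    exact h
  have hmm : m = m' := by
    have h := f.finrank_eq
    rw [finrank_symPow, finrank_symPow] at h
    omega
  refine ⟨hmm, ?_⟩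
  have h0 := symMono_ne_zero E (Nat.zero_le m)
  obtain ⟨c, hc⟩ := eq_smul_symMono_zero_of_fixed p F E ϖ hm' (i := i') (f (symMono E m 0))
    (fun x => by
      rw [← hf, serreWeight_unip p F E i (Nat.zero_le m)]
      simp)
  have hc0 : f (symMono E m 0) ≠ 0 := by simpa using h0
  refine cast_eq_of_pow_resField_eq p F ϖ fun x => ?_
  have h := hf (dia p F 1 (tauUnit p F ϖ x)) (symMono E m 0)
  rw [serreWeight_dia p F E i (Nat.zero_le m), map_smul, hc, map_smul,
    serreWeight_dia p F E i' (Nat.zero_le m'), smul_comm c, ← hc] at h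
  have h2 := smul_left_injective E hc0 h
  simp only [tauUnit_val, toE_tau, Units.val_one, map_one, one_mul, pow_zero, one_pow,
    mul_one, ← map_pow] at h2
  exact Units.ext (by simpa using (algebraMap (resField p F) E).injective h2)

end Weights

/-! ### Cell decomposition and generators of `GL₂(𝒪/𝔪²)` -/

section GroupStructure

variable (p : ℕ) [Fact p.Prime] (F : Type*) [Field F] [Algebra ℚ_[p] F]
  [FiniteDimensional ℚ_[p] F]

theorem unip_mul_unip (a b : O₂ p F) : unip p F a * unip p F b = unip p F (a + b) := by
  refine Units.ext ?_
  ext i j; fin_cases i <;> fin_cases j <;> simp [Matrix.mul_apply, add_comm]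

theorem xi_zero_mul_self : xi p F 0 * xi p F 0 = 1 := by
  refine Units.ext ?_
  ext i j; fin_cases i <;> fin_cases j <;> simp [Matrix.mul_apply]

theorem dia_mul_dia (a b c d : (O₂ p F)ˣ) :
    dia p F a b * dia p F c d = dia p F (a * c) (b * d) := by
  refine Units.ext ?_
  ext i j; fin_cases i <;> fin_cases j <;> simp [Matrix.mul_apply]

theorem dia_mul_xi_zero (a d : (O₂ p F)ˣ) :
    dia p F a d * xi p F 0 = xi p F 0 * dia p F d a := by
  refine Units.ext ?_
  ext i j; fin_cases i <;> fin_cases j <;> simp [Matrix.mul_apply]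

theorem mem_B₂ {g : G₂ p F} : g ∈ B₂ p F ↔ g.1 1 0 = 0 := Iff.rfl

theorem isUnit_det (g : G₂ p F) : IsUnit (g.1 0 0 * g.1 1 1 - g.1 0 1 * g.1 1 0) := by
  rw [← Matrix.det_fin_two]
  exact (Matrix.isUnit_iff_isUnit_det _).1 g.isUnit

theorem upper_eq {g : G₂ p F} (h : g ∈ B₂ p F) : ∃ a d : (O₂ p F)ˣ, ∃ b : O₂ p F,
    g = unip p F b * dia p F a d := by
  rw [mem_B₂] at h
  have hu := isUnit_det p F g
  rw [h, mul_zero, sub_zero, IsUnit.mul_iff] at hu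
  obtain ⟨⟨a, ha⟩, d, hd⟩ := hu
  refine ⟨a, d, g.1 0 1 * (d⁻¹ : (O₂ p F)ˣ), Units.ext ?_⟩
  ext i j; fin_cases i <;> fin_cases j <;> simp [Matrix.mul_apply, ← ha, ← hd, h]

/-- An element whose lower left entry is a unit lies in the big cell. -/
theorem exists_eq_xi_mul {g : G₂ p F} (h : IsUnit (g.1 1 0)) :
    ∃ z : O₂ p F, ∃ b ∈ B₂ p F, g = xi p F z * b ∧ z * g.1 1 0 = g.1 0 0 := by
  obtain ⟨c, hc⟩ := h
  refine ⟨g.1 0 0 * (c⁻¹ : (O₂ p F)ˣ), (xi p F (g.1 0 0 * (c⁻¹ : (O₂ p F)ˣ)))⁻¹ * g, ?_, by simp,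
    by rw [← hc]; simp⟩
  have hx : (xi p F (g.1 0 0 * (c⁻¹ : (O₂ p F)ˣ)))⁻¹ * g =
      xi p F 0 * unip p F (-(g.1 0 0 * (c⁻¹ : (O₂ p F)ˣ))) * g := by
    congr 1
    rw [inv_eq_iff_mul_eq_one]
    refine Units.ext ?_
    ext i j; fin_cases i <;> fin_cases j <;> simp [Matrix.mul_apply, Fin.sum_univ_two]
  rw [hx, mem_B₂]
  simp [Matrix.vecMul, dotProduct, Fin.sum_univ_two, ← hc, mul_assoc]

variable (ϖ : integers p F) [hR : IsRamified p F ϖ]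
include hR

theorem isUnit_upper_left {g : G₂ p F} (h : ¬ IsUnit (g.1 1 0)) : IsUnit (g.1 0 0) := by
  have hu := isUnit_det p F g
  rw [isUnit_iff_reduction p F ϖ] at *
  rw [not_not] at h
  simp only [map_sub, map_mul, h, mul_zero, sub_zero] at hu
  exact left_ne_zero_of_mul hu

/-- If the lower left entry is not a unit, the upper left one is, and `w g` lies in the big cell.
Its parameter then reduces to `0`, hence has the form `[y]ϖ`. -/
theorem cell_decomposition (g : G₂ p F) : (∃ x, ∃ b ∈ B₂ p F, g = xi p F (lam p F ϖ x) * b) ∨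
    ∃ y, ∃ b ∈ B₂ p F, g = xi p F 0 * xi p F (lam p F ϖ (0, y)) * b := by
  by_cases h : IsUnit (g.1 1 0)
  · left
    obtain ⟨z, b, hb, hg, -⟩ := exists_eq_xi_mul p F h
    obtain ⟨x, rfl⟩ := lam_surjective p F ϖ z
    exact ⟨x, b, hb, hg⟩
  · right
    have h0 := isUnit_upper_left p F ϖ h
    have e1 : (xi p F 0 * g).1 1 0 = g.1 0 0 := by simp [Matrix.mul_apply]
    have e2 : (xi p F 0 * g).1 0 0 = g.1 1 0 := by simp [Matrix.mul_apply]
    obtain ⟨z, b, hb, hg, hz⟩ := exists_eq_xi_mul p F (g := xi p F 0 * g) (by rwa [e1])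
    rw [e1, e2] at hz
    obtain ⟨x, rfl⟩ := lam_surjective p F ϖ z
    rw [isUnit_iff_reduction p F ϖ] at h h0
    rw [not_not, ← hz, map_mul, reduction_lam] at h
    have hx : x.1 = 0 := (mul_eq_zero.1 h).resolve_right h0
    refine ⟨x.2, b, hb, ?_⟩
    rw [← hx, mul_assoc, ← hg, ← mul_assoc, xi_zero_mul_self, one_mul]

/-- The two cells reduce everything to `w` and `B`, and `B` is generated by unipotents, elements
`diag(u, 1)` and scalars. A submonoid is enough because the property propagated later is closed
under products. -/
theorem submonoid_eq_top (M : Submonoid (G₂ p F))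
    (hU₀ : ∀ x, unip p F (tau p F ϖ x) ∈ M)
    (hU₁ : ∀ x, unip p F (tau p F ϖ x * eps p F ϖ) ∈ M)
    (hT₀ : ∀ x, dia p F (tauUnit p F ϖ x) 1 ∈ M)
    (hT₁ : ∀ x, ∀ u : (O₂ p F)ˣ, (u : O₂ p F) = 1 + tau p F ϖ x * eps p F ϖ → dia p F u 1 ∈ M)
    (hZ : ∀ z, dia p F z z ∈ M) (hw : xi p F 0 ∈ M) : M = ⊤ := by
  have hU : ∀ a, unip p F a ∈ M := fun a => by
    obtain ⟨x, rfl⟩ := lam_surjective p F ϖ a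
    rw [lam, ← unip_mul_unip]
    exact M.mul_mem (hU₀ _) (hU₁ _)
  have hT : ∀ u, dia p F u 1 ∈ M := fun u => by
    obtain ⟨x, hx⟩ := lam_surjective p F ϖ u
    have h0 : x.1 ≠ 0 := by
      have := (isUnit_iff_reduction p F ϖ _).1 u.isUnit
      rwa [← hx, reduction_lam] at this
    set t := tauUnit p F ϖ (Units.mk0 x.1 h0) with ht
    have hu : u = t * (t⁻¹ * u) := by simp
    rw [hu, ← one_mul (1 : (O₂ p F)ˣ), ← dia_mul_dia]
    -- A unit factors as `[x₀] + [x₁]ϖ = [x₀] (1 + [x₀⁻¹ x₁]ϖ)`.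
    refine M.mul_mem (hT₀ _) (hT₁ (x.1⁻¹ * x.2) _ ?_)
    rw [Units.val_mul, ← hx, Units.inv_mul_eq_iff_eq_mul, ht]
    simp only [tauUnit_val, Units.val_mk0, lam, map_mul]
    have : tau p F ϖ x.1 * tau p F ϖ x.1⁻¹ = 1 := by
      rw [← map_mul, mul_inv_cancel₀ h0, map_one]
    linear_combination (-(tau p F ϖ x.2 * eps p F ϖ)) * this
  have hD : ∀ a d, dia p F a d ∈ M := fun a d => by
    have : dia p F a d = dia p F (a * d⁻¹) 1 * dia p F d d := by
      rw [dia_mul_dia]; simp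
    rw [this]
    exact M.mul_mem (hT _) (hZ _)
  have hB : ∀ g ∈ B₂ p F, g ∈ M := fun g hg => by
    obtain ⟨a, d, b, rfl⟩ := upper_eq p F hg
    exact M.mul_mem (hU _) (hD _ _)
  have hxi : ∀ z, xi p F z ∈ M := fun z => by
    have : xi p F z = unip p F z * xi p F 0 := by
      refine Units.ext ?_
      ext i j; fin_cases i <;> fin_cases j <;> simp [Matrix.mul_apply]
    rw [this]
    exact M.mul_mem (hU _) hw
  rw [eq_top_iff]
  rintro g -
  rcases cell_decomposition p F ϖ g with ⟨x, b, hb, rfl⟩ | ⟨y, b, hb, rfl⟩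
  · exact M.mul_mem (hxi _) (hB _ hb)
  · exact M.mul_mem (M.mul_mem hw (hxi _)) (hB _ hb)

end GroupStructure

/-! ### The vectors `g ⊗ v` and their translates -/

section Tens

variable (p : ℕ) [Fact p.Prime] (F : Type*) [Field F] [Algebra ℚ_[p] F]
  [FiniteDimensional ℚ_[p] F] (E : Type*) [Field E] [Algebra (resField p F) E]
  (r : ZMod (p - 1))

variable {p F E r} in
/-- The value at `x` of an element of the principal series. -/
def PS.eval (φ : PS p F E r) (x : G₂ p F) : E := φ.1 x

theorem PS.eval_mul (φ : PS p F E r) (b : B₂ p F) (x : G₂ p F) :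
    φ.eval (b.1 * x) = chi p F E r b * φ.eval x := by
  have h := (Representation.mem_coindV (B₂ p F).subtype (chiRep p F E r) _).1 φ.2 b x
  simpa [chiRep, PS.eval] using h

theorem PS.ext {φ ψ : PS p F E r} (h : ∀ x, φ.eval x = ψ.eval x) : φ = ψ :=
  Subtype.ext (funext h)

/-- Evaluation as a linear map. -/
def evalL (x : G₂ p F) : PS p F E r →ₗ[E] E where
  toFun φ := φ.eval x
  map_add' _ _ := rfl
  map_smul' _ _ := rfl

theorem eval_V₂ (g x : G₂ p F) (φ : PS p F E r) : (V₂ p F E r g φ).eval x = φ.eval (x * g) := rfl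

theorem eval_tens_of_mem (g : G₂ p F) (v : E) {x : G₂ p F} (h : x * g ∈ B₂ p F) :
    (tens p F E r g v).eval x = chi p F E r ⟨x * g, h⟩ * v := by
  exact dif_pos h

theorem eval_tens_of_notMem (g : G₂ p F) (v : E) {x : G₂ p F} (h : x * g ∉ B₂ p F) :
    (tens p F E r g v).eval x = 0 := by
  exact dif_neg h

/-- `g ⊗ v` as a linear map in `v`. -/
def tensL (g : G₂ p F) : E →ₗ[E] PS p F E r where
  toFun v := tens p F E r g v
  map_add' v w := PS.ext p F E r fun x => by
    change _ = (tens p F E r g v).eval x + (tens p F E r g w).eval x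
    by_cases h : x * g ∈ B₂ p F
    · simp only [eval_tens_of_mem p F E r _ _ h, mul_add]
    · simp only [eval_tens_of_notMem p F E r _ _ h, add_zero]
  map_smul' c v := PS.ext p F E r fun x => by
    change _ = c * (tens p F E r g v).eval x
    by_cases h : x * g ∈ B₂ p F
    · simp only [eval_tens_of_mem p F E r _ _ h, smul_eq_mul]
      ring
    · simp only [eval_tens_of_notMem p F E r _ _ h, mul_zero]

theorem tensL_apply (g : G₂ p F) (v : E) : tensL p F E r g v = tens p F E r g v := rfl

theorem V₂_tens (g h : G₂ p F) (v : E) :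
    V₂ p F E r g (tensL p F E r h v) = tensL p F E r (g * h) v := by
  refine PS.ext p F E r fun x => ?_
  rw [eval_V₂, tensL_apply, tensL_apply]
  by_cases hx : x * (g * h) ∈ B₂ p F
  · have hx' : x * g * h ∈ B₂ p F := by rwa [mul_assoc]
    rw [eval_tens_of_mem p F E r _ _ hx, eval_tens_of_mem p F E r _ _ hx']
    congr 2
    exact Subtype.ext (mul_assoc _ _ _)
  · have hx' : x * g * h ∉ B₂ p F := by rwa [mul_assoc]
    rw [eval_tens_of_notMem p F E r _ _ hx, eval_tens_of_notMem p F E r _ _ hx']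

theorem tens_mul (g : G₂ p F) (b : G₂ p F) (hb : b ∈ B₂ p F) (v : E) :
    tensL p F E r (g * b) v = tensL p F E r g (toE p F E (b.1 1 1) ^ r.val * v) := by
  refine PS.ext p F E r fun x => ?_
  rw [tensL_apply, tensL_apply]
  by_cases hx : x * g ∈ B₂ p F
  · have hx' : x * (g * b) ∈ B₂ p F := by
      rw [← mul_assoc]
      exact (B₂ p F).mul_mem hx hb
    rw [eval_tens_of_mem p F E r _ _ hx, eval_tens_of_mem p F E r _ _ hx']
    have : (⟨x * (g * b), hx'⟩ : B₂ p F) = ⟨x * g, hx⟩ * ⟨b, hb⟩ :=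
      Subtype.ext (mul_assoc _ _ _).symm
    rw [this, map_mul, mul_assoc]
    rfl
  · have hx' : x * (g * b) ∉ B₂ p F := by
      rw [← mul_assoc]
      exact fun h => hx (((B₂ p F).mul_mem_cancel_right hb).1 h)
    rw [eval_tens_of_notMem p F E r _ _ hx, eval_tens_of_notMem p F E r _ _ hx']

theorem V₂_unip_tens (a z : O₂ p F) (v : E) : V₂ p F E r (unip p F a) (tensL p F E r (xi p F z) v) =
    tensL p F E r (xi p F (z + a)) v := by
  have : unip p F a * xi p F z = xi p F (z + a) := by
    refine Units.ext ?_
    ext i j; fin_cases i <;> fin_cases j <;> simp [Matrix.mul_apply]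
  rw [V₂_tens, this]

theorem V₂_dia_tens (a d : (O₂ p F)ˣ) (z : O₂ p F) (v : E) :
    V₂ p F E r (dia p F a d) (tensL p F E r (xi p F z) v) =
      tensL p F E r (xi p F (a * z * (d⁻¹ : (O₂ p F)ˣ))) (toE p F E a ^ r.val * v) := by
  have : dia p F a d * xi p F z = xi p F (a * z * (d⁻¹ : (O₂ p F)ˣ)) * dia p F d a := by
    refine Units.ext ?_
    ext i j; fin_cases i <;> fin_cases j <;> simp [Matrix.mul_apply]
  rw [V₂_tens, this, tens_mul _ _ _ _ _ _ (by simp [mem_B₂])]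
  simp

/-- One has `w ξ_u = ξ_{u⁻¹} b` with `b` upper triangular of lower right entry `-u⁻¹`, which is
where the factor comes from. -/
theorem V₂_xi_zero_tens (u : (O₂ p F)ˣ) (v : E) :
    V₂ p F E r (xi p F 0) (tensL p F E r (xi p F u) v) =
      tensL p F E r (xi p F (u⁻¹ : (O₂ p F)ˣ))
        ((-toE p F E (u⁻¹ : (O₂ p F)ˣ)) ^ r.val * v) := by
  have : xi p F 0 * xi p F u = xi p F (u⁻¹ : (O₂ p F)ˣ) *
      (unip p F (-(u : O₂ p F)) * dia p F u (-u⁻¹)) := by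
    refine Units.ext ?_
    ext i j; fin_cases i <;> fin_cases j <;> simp [Matrix.mul_apply]
  rw [V₂_tens, this, tens_mul _ _ _ _ _ _ (by simp [mem_B₂, Matrix.mul_apply])]
  simp [Matrix.mul_apply]

/-- The element `(1 a; 0 1)` maps the coset of `w ξ_z` to itself, and the upper triangular factor
has lower right entry `1 - a z`, of residue `1`, so `χ_r` does not see it. -/
theorem V₂_unip_tens_of_sq_eq_zero (a z : O₂ p F) (hz : z * z = 0) (h0 : reduction p F z = 0)
    (v : E) :
    V₂ p F E r (unip p F a) (tensL p F E r (xi p F 0 * xi p F z) v) =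
      tensL p F E r (xi p F 0 * xi p F z) v := by
  have hu : (1 + a * z) * (1 - a * z) = 1 := by linear_combination (-a ^ 2) * hz
  set s : (O₂ p F)ˣ := ⟨1 + a * z, 1 - a * z, hu, by rw [mul_comm, hu]⟩ with hs
  have hs1 : (s : O₂ p F) = 1 + a * z := rfl
  have hs2 : ((s⁻¹ : (O₂ p F)ˣ) : O₂ p F) = 1 - a * z := rfl
  have : unip p F a * (xi p F 0 * xi p F z) = xi p F 0 * xi p F z *
      (unip p F (a * s) * dia p F s s⁻¹) := by
    refine Units.ext ?_
    ext i j; fin_cases i <;> fin_cases j <;>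
      simp [Matrix.mul_apply, Fin.sum_univ_two, hs1, hs2]
    · linear_combination (a ^ 2 * a) * hz
    · linear_combination (-a) * hz
    · linear_combination (a ^ 3 * z) * hz
  rw [V₂_tens, this, tens_mul _ _ _ _ _ _ (by simp [mem_B₂, Matrix.mul_apply])]
  simp [Matrix.mul_apply, hs2, toE_apply, h0]

end Tens

/-! ### Representatives of exponents modulo `p - 1` -/

section Exponents

variable (p : ℕ) [Fact p.Prime]

theorem rep_pos (x : ZMod (p - 1)) : 1 ≤ (rep p x).val := by
  have hp := (Fact.out : p.Prime).two_le
  simp only [rep]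
  split_ifs with h
  · omega
  · exact Nat.one_le_iff_ne_zero.2 ((ZMod.val_ne_zero x).2 h)

@[simp]
theorem cl_rep (x : ZMod (p - 1)) : cl p (rep p x) = x := by
  have hp := (Fact.out : p.Prime).two_le
  have : NeZero (p - 1) := ⟨by omega⟩
  simp only [cl, rep]
  split_ifs with h
  · simp [h]
  · simp

@[simp]
theorem natCast_rep (x : ZMod (p - 1)) : ((rep p x).val : ZMod (p - 1)) = x := cl_rep p x

omit [Fact p.Prime] in
theorem eq_of_cl_eq {i j : Fin p} (hi : i.val ≠ 0) (hj : j.val ≠ 0) (h : cl p i = cl p j) :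
    i = j := by
  have h2 := (ZMod.natCast_eq_natCast_iff _ _ _).1 h
  have h3 : (i.val - 1) + 1 ≡ (j.val - 1) + 1 [MOD p - 1] := by
    rwa [Nat.sub_add_cancel (by omega), Nat.sub_add_cancel (by omega)]
  have h4 := Nat.ModEq.add_right_cancel' 1 h3
  have h5 := Nat.ModEq.eq_of_lt_of_lt h4 (by omega) (by omega)
  exact Fin.ext (by omega)

theorem rep_cl {j : Fin p} (hj : j.val ≠ 0) : rep p (cl p j) = j :=
  eq_of_cl_eq p (by have := rep_pos p (cl p j); omega) hj (cl_rep p _)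

end Exponents

/-! ### `V_{2,r}` as functions on the two cells -/

section Cells

variable (p : ℕ) [Fact p.Prime] (F : Type*) [Field F] [Algebra ℚ_[p] F]
  [FiniteDimensional ℚ_[p] F] (ϖ : integers p F) [hR : IsRamified p F ϖ]
  (E : Type*) [Field E] [Algebra (resField p F) E]
  (r : ZMod (p - 1))

theorem V₂_scalar (z : (O₂ p F)ˣ) (v : PS p F E r) :
    V₂ p F E r (dia p F z z) v = toE p F E z ^ r.val • v := by
  refine PS.ext p F E r fun x => ?_
  rw [eval_V₂]
  have hb : dia p F z z ∈ B₂ p F := by simp [mem_B₂]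
  have : x * dia p F z z = (⟨dia p F z z, hb⟩ : B₂ p F).1 * x := by
    refine Units.ext ?_
    ext i j; fin_cases i <;> fin_cases j <;> simp [Matrix.mul_apply, mul_comm]
  rw [this, PS.eval_mul]
  rfl

theorem lam_mul_lam_inv {x : resField p F × resField p F} (hx : x.1 ≠ 0) :
    lam p F ϖ x * lam p F ϖ (x.1⁻¹, -x.2 * x.1⁻¹ ^ 2) = 1 := by
  have h : tau p F ϖ x.1 * tau p F ϖ x.1⁻¹ = 1 := by
    rw [← map_mul, mul_inv_cancel₀ hx, map_one]
  simp only [lam, map_mul, map_neg, map_pow]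
  linear_combination (1 - tau p F ϖ x.2 * eps p F ϖ * tau p F ϖ x.1⁻¹) * h -
    (tau p F ϖ x.2 ^ 2 * tau p F ϖ x.1⁻¹ ^ 2) * eps_mul_eps p F ϖ

theorem inv_xi (z : O₂ p F) : (xi p F z)⁻¹ = xi p F 0 * unip p F (-z) := by
  rw [inv_eq_iff_mul_eq_one]
  refine Units.ext ?_
  ext i j; fin_cases i <;> fin_cases j <;> simp [Matrix.mul_apply, Fin.sum_univ_two]

theorem one_add_nilp_ne_zero (z w : O₂ p F) (hw : reduction p F w = 0) : 1 + z * w ≠ 0 := by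
  intro h
  simpa [hw] using congrArg (reduction p F) h

variable [Fintype (resField p F)]

/-- The element of `V_{2,r}` supported on the big cell and attached to a function on `k × k`. -/
def bigCell : (resField p F × resField p F → E) →ₗ[E] PS p F E r :=
  ∑ x, (tensL p F E r (xi p F (lam p F ϖ x))).comp (LinearMap.proj x)

/-- The element of `V_{2,r}` supported on the small cell and attached to a function on `k`. -/
def smallCell : (resField p F → E) →ₗ[E] PS p F E r :=
  ∑ y, (tensL p F E r (xi p F 0 * xi p F (lam p F ϖ (0, y)))).comp (LinearMap.proj y)

theorem bigCell_apply (φ : resField p F × resField p F → E) : bigCell p F ϖ E r φ =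
    ∑ x, tensL p F E r (xi p F (lam p F ϖ x)) (φ x) := by
  simp [bigCell, LinearMap.sum_apply]

theorem smallCell_apply (φ : resField p F → E) : smallCell p F ϖ E r φ =
    ∑ y, tensL p F E r (xi p F 0 * xi p F (lam p F ϖ (0, y))) (φ y) := by
  simp [smallCell, LinearMap.sum_apply]

/-- This and the next results turn the generators into substitutions in `(x₀, x₁)`. Additivity of
the Teichmüller section is what makes the translation by `[a]` affect `x₀` alone, with no carry into
`x₁`. -/
theorem bigCell_unip_tau (a : resField p F) (φ : resField p F × resField p F → E) :
    V₂ p F E r (unip p F (tau p F ϖ a)) (bigCell p F ϖ E r φ) =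
      bigCell p F ϖ E r fun x => φ (x.1 - a, x.2) := by
  simp only [bigCell_apply, map_sum, V₂_unip_tens]
  refine Fintype.sum_equiv
    ⟨fun x => (x.1 + a, x.2), fun x => (x.1 - a, x.2), fun x => by simp, fun x => by simp⟩ _ _
    fun x => ?_
  simp only [Equiv.coe_fn_mk, add_sub_cancel_right, lam, map_add]
  congr 3
  ring

theorem bigCell_unip_eps (a : resField p F) (φ : resField p F × resField p F → E) :
    V₂ p F E r (unip p F (tau p F ϖ a * eps p F ϖ)) (bigCell p F ϖ E r φ) =
      bigCell p F ϖ E r fun x => φ (x.1, x.2 - a) := by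
  simp only [bigCell_apply, map_sum, V₂_unip_tens]
  refine Fintype.sum_equiv
    ⟨fun x => (x.1, x.2 + a), fun x => (x.1, x.2 - a), fun x => by simp, fun x => by simp⟩ _ _
    fun x => ?_
  simp only [Equiv.coe_fn_mk, add_sub_cancel_right, lam, map_add]
  congr 3
  ring

theorem bigCell_dia_tau (a : (resField p F)ˣ) (φ : resField p F × resField p F → E) :
    V₂ p F E r (dia p F (tauUnit p F ϖ a) 1) (bigCell p F ϖ E r φ) =
      bigCell p F ϖ E r fun x => algebraMap (resField p F) E a ^ r.val *
        φ ((a⁻¹ : (resField p F)ˣ) * x.1, (a⁻¹ : (resField p F)ˣ) * x.2) := by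
  simp only [bigCell_apply, map_sum, V₂_dia_tens]
  refine Fintype.sum_equiv
    (⟨fun x => (a * x.1, a * x.2), fun x => ((a⁻¹ : (resField p F)ˣ) * x.1,
      (a⁻¹ : (resField p F)ˣ) * x.2), fun x => by simp, fun x => by simp⟩ :
        resField p F × resField p F ≃ resField p F × resField p F) _ _ fun x => ?_
  simp only [Equiv.coe_fn_mk, lam, map_mul, Units.inv_mul_cancel_left, tauUnit_val, toE_tau]
  congr 3
  simp
  ring

/-- Since `(1 + aε)(x₀ + x₁ε) = x₀ + (x₁ + a x₀)ε`, the substitution is a shear. It trades powers of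
`x₁` for powers of `x₀`, which is the source of `Gen.shift`. -/
theorem bigCell_dia_eps (a : resField p F) (u : (O₂ p F)ˣ)
    (hu : (u : O₂ p F) = 1 + tau p F ϖ a * eps p F ϖ) (φ : resField p F × resField p F → E) :
    V₂ p F E r (dia p F u 1) (bigCell p F ϖ E r φ) =
      bigCell p F ϖ E r fun x => φ (x.1, x.2 - a * x.1) := by
  simp only [bigCell_apply, map_sum, V₂_dia_tens]
  refine Fintype.sum_equiv
    ⟨fun x => (x.1, x.2 + a * x.1), fun x => (x.1, x.2 - a * x.1), fun x => by simp,
      fun x => by simp⟩ _ _ fun x => ?_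
  have h1 : toE p F E u = 1 := by rw [hu]; simp [toE_apply]
  simp only [Equiv.coe_fn_mk, add_sub_cancel_right, h1, one_pow, one_mul]
  congr 3
  simp only [lam, map_add, map_mul, hu, inv_one, Units.val_one, mul_one]
  linear_combination (tau p F ϖ a * tau p F ϖ x.2) * eps_mul_eps p F ϖ

/-- The sum splits according to whether `λ` is a unit: unit parameters are inverted and stay in the
big cell, while those with `x₀ = 0` are exactly the ones moved to the small cell. -/
theorem bigCell_xi_zero [DecidableEq (resField p F)] (φ : resField p F × resField p F → E) :
    V₂ p F E r (xi p F 0) (bigCell p F ϖ E r φ) =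
      (bigCell p F ϖ E r fun x => if x.1 = 0 then 0 else
        (-algebraMap _ E x.1) ^ r.val * φ (x.1⁻¹, -x.2 * x.1⁻¹ ^ 2)) +
      smallCell p F ϖ E r fun y => φ (0, y) := by
  simp only [bigCell_apply, smallCell_apply, map_sum]
  rw [← Finset.sum_filter_add_sum_filter_not Finset.univ fun x => x.1 = 0, add_comm]
  congr 1
  · conv_rhs => rw [← Finset.sum_filter_add_sum_filter_not Finset.univ
      fun x : resField p F × resField p F => x.1 = 0]
    rw [Finset.sum_eq_zero (s := Finset.univ.filter fun x : resField p F × resField p F =>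
      x.1 = 0), zero_add]
    · refine Finset.sum_nbij' (fun x => (x.1⁻¹, -x.2 * x.1⁻¹ ^ 2))
        (fun x => (x.1⁻¹, -x.2 * x.1⁻¹ ^ 2)) (by simp) (by simp) ?_ ?_ ?_
      · rintro ⟨x, y⟩ hx
        simp only [Finset.mem_filter, Finset.mem_univ, true_and] at hx
        simp [hx]
      · rintro ⟨x, y⟩ hx
        simp only [Finset.mem_filter, Finset.mem_univ, true_and] at hx
        simp [hx]
      · rintro ⟨x, y⟩ hx
        simp only [Finset.mem_filter, Finset.mem_univ, true_and] at hx
        have h := lam_mul_lam_inv p F ϖ (x := (x, y)) hx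
        have hu := V₂_xi_zero_tens p F E r ⟨lam p F ϖ (x, y), _, h, by rw [mul_comm, h]⟩ (φ (x, y))
        simp only [Units.inv_mk] at hu
        rw [hu]
        simp [hx, toE_apply]
    · rintro x hx
      simp only [Finset.mem_filter, Finset.mem_univ, true_and] at hx
      simp [hx]
  · refine Finset.sum_nbij' (fun x => x.2) (fun y => (0, y)) (by simp) (by simp) ?_ (by simp) ?_
    · rintro ⟨x, y⟩ hx
      simp only [Finset.mem_filter, Finset.mem_univ, true_and] at hx
      simp [hx]
    · rintro ⟨x, y⟩ hx
      simp only [Finset.mem_filter, Finset.mem_univ, true_and] at hx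
      simp [hx, V₂_tens]

theorem smallCell_unip (a : O₂ p F) (φ : resField p F → E) :
    V₂ p F E r (unip p F a) (smallCell p F ϖ E r φ) = smallCell p F ϖ E r φ := by
  simp only [smallCell_apply, map_sum]
  refine Finset.sum_congr rfl fun y _ => ?_
  refine V₂_unip_tens_of_sq_eq_zero p F E r a _ ?_ (by simp) _
  simp only [lam, map_zero, zero_add]
  linear_combination (tau p F ϖ y ^ 2) * eps_mul_eps p F ϖ

omit [Fintype (resField p F)] in
theorem eval_tens_xi [DecidableEq (resField p F)] (x y : resField p F × resField p F) (v : E) :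
    (tensL p F E r (xi p F (lam p F ϖ y)) v).eval (xi p F (lam p F ϖ x))⁻¹ =
      if y = x then v else 0 := by
  rw [tensL_apply]
  split_ifs with h
  · subst h
    rw [eval_tens_of_mem p F E r _ _ (by simp)]
    simp [chi]
  · refine eval_tens_of_notMem p F E r _ _ fun hb => h (lam_injective p F ϖ ?_)
    rw [mem_B₂, inv_xi] at hb
    simpa [Matrix.mul_apply, Fin.sum_univ_two, ← sub_eq_add_neg, sub_eq_zero] using hb

theorem eval_bigCell (φ : resField p F × resField p F → E) (x : resField p F × resField p F) :
    (bigCell p F ϖ E r φ).eval (xi p F (lam p F ϖ x))⁻¹ = φ x := by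
  classical
  rw [bigCell_apply]
  change evalL p F E r _ _ = _
  rw [map_sum]
  change ∑ y, (tensL p F E r (xi p F (lam p F ϖ y)) (φ y)).eval _ = _
  simp only [eval_tens_xi]
  simp

theorem eval_smallCell_big (φ : resField p F → E) (x : resField p F × resField p F) :
    (smallCell p F ϖ E r φ).eval (xi p F (lam p F ϖ x))⁻¹ = 0 := by
  rw [smallCell_apply]
  change evalL p F E r _ _ = _
  rw [map_sum]
  refine Finset.sum_eq_zero fun y _ => ?_
  refine eval_tens_of_notMem p F E r _ _ fun hb => ?_
  rw [mem_B₂, inv_xi] at hb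
  refine one_add_nilp_ne_zero p F (-lam p F ϖ x) (lam p F ϖ (0, y)) (by simp) ?_
  simpa [Matrix.mul_apply, Fin.sum_univ_two] using hb

theorem eval_smallCell (φ : resField p F → E) (y : resField p F) :
    (smallCell p F ϖ E r φ).eval (xi p F 0 * xi p F (lam p F ϖ (0, y)))⁻¹ = φ y := by
  classical
  rw [smallCell_apply]
  change evalL p F E r _ _ = _
  rw [map_sum]
  have : ∀ y', evalL p F E r (xi p F 0 * xi p F (lam p F ϖ (0, y)))⁻¹
      (tensL p F E r (xi p F 0 * xi p F (lam p F ϖ (0, y'))) (φ y')) =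
      if y' = y then φ y' else 0 := fun y' => by
    have h := eval_tens_xi p F ϖ E r (0, y) (0, y') (φ y')
    simp only [Prod.mk.injEq, true_and] at h
    rw [← h, ← V₂_tens]
    change PS.eval (V₂ p F E r (xi p F 0)
      (tensL p F E r (xi p F (lam p F ϖ (0, y'))) (φ y'))) _ = _
    rw [eval_V₂, mul_inv_rev, mul_assoc, inv_mul_cancel, mul_one]
  simp only [this]
  simp

theorem eval_bigCell_small (φ : resField p F × resField p F → E) (y : resField p F) :
    (bigCell p F ϖ E r φ).eval (xi p F 0 * xi p F (lam p F ϖ (0, y)))⁻¹ = 0 := by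
  rw [bigCell_apply]
  change evalL p F E r _ _ = _
  rw [map_sum]
  refine Finset.sum_eq_zero fun x _ => ?_
  refine eval_tens_of_notMem p F E r _ _ fun hb => ?_
  rw [mem_B₂, mul_inv_rev, inv_xi, inv_xi] at hb
  refine one_add_nilp_ne_zero p F (-lam p F ϖ x) (lam p F ϖ (0, y)) (by simp) ?_
  simpa [Matrix.mul_apply, Fin.sum_univ_two, mul_comm, add_comm] using hb

/-- An element of the induction is determined by its values at inverses of coset representatives,
and each cell vanishes at the representatives of the other. -/
theorem eq_cells (v : PS p F E r) :
    v = bigCell p F ϖ E r (fun x => v.eval (xi p F (lam p F ϖ x))⁻¹) +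
      smallCell p F ϖ E r fun y => v.eval (xi p F 0 * xi p F (lam p F ϖ (0, y)))⁻¹ := by
  refine PS.ext p F E r fun h => ?_
  change _ = PS.eval (bigCell p F ϖ E r _) h + PS.eval (smallCell p F ϖ E r _) h
  rcases cell_decomposition p F ϖ h⁻¹ with ⟨x, b, hb, hg⟩ | ⟨y, b, hb, hg⟩
  · have hh : h = (⟨b⁻¹, (B₂ p F).inv_mem hb⟩ : B₂ p F).1 * (xi p F (lam p F ϖ x))⁻¹ := by
      rw [← inv_inv h, hg, mul_inv_rev]
    rw [hh, PS.eval_mul, PS.eval_mul, PS.eval_mul, eval_bigCell, eval_smallCell_big]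
    simp
  · have hh : h = (⟨b⁻¹, (B₂ p F).inv_mem hb⟩ : B₂ p F).1 *
        (xi p F 0 * xi p F (lam p F ϖ (0, y)))⁻¹ := by
      rw [← inv_inv h, hg, mul_inv_rev]
    rw [hh, PS.eval_mul, PS.eval_mul, PS.eval_mul, eval_bigCell_small, eval_smallCell]
    simp

/-- The decomposition of `V_{2,r}` according to the two cells. -/
def cellEquiv : ((resField p F × resField p F → E) × (resField p F → E)) ≃ₗ[E] PS p F E r :=
  { (bigCell p F ϖ E r).coprod (smallCell p F ϖ E r) with
    invFun := fun v => (fun x => v.eval (xi p F (lam p F ϖ x))⁻¹,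
      fun y => v.eval (xi p F 0 * xi p F (lam p F ϖ (0, y)))⁻¹)
    left_inv := fun v => by
      refine Prod.ext (funext fun x => ?_) (funext fun y => ?_)
      · change (bigCell p F ϖ E r v.1).eval _ + (smallCell p F ϖ E r v.2).eval _ = _
        rw [eval_bigCell, eval_smallCell_big, add_zero]
      · change (bigCell p F ϖ E r v.1).eval _ + (smallCell p F ϖ E r v.2).eval _ = _
        rw [eval_bigCell_small, eval_smallCell, zero_add]
    right_inv := fun v => (eq_cells p F ϖ E r v).symm }

theorem cellEquiv_apply (v : (resField p F × resField p F → E) × (resField p F → E)) :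
    cellEquiv p F ϖ E r v = bigCell p F ϖ E r v.1 + smallCell p F ϖ E r v.2 := rfl

end Cells

/-! ### Monomials on the cells and the basis `f_{(j₀, j₁)}` -/

section Monomials

variable (p : ℕ) [Fact p.Prime] (F : Type*) [Field F] [Algebra ℚ_[p] F]
  [FiniteDimensional ℚ_[p] F] (ϖ : integers p F) [hR : IsRamified p F ϖ]
  (E : Type*) [Field E] [Algebra (resField p F) E]
  (r : ZMod (p - 1)) [Fintype (resField p F)]

/-- The element of `V_{2,r}` attached to the function `x₀ ^ j₀ x₁ ^ j₁` on the big cell. -/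
def bigMono (j₀ j₁ : ℕ) : PS p F E r :=
  bigCell p F ϖ E r fun x => algebraMap _ E (x.1 ^ j₀ * x.2 ^ j₁)

/-- The element of `V_{2,r}` attached to the function `y ^ j` on the small cell. -/
def smallMono (j : ℕ) : PS p F E r := smallCell p F ϖ E r fun y => algebraMap _ E (y ^ j)

theorem basisElt_some (j₀ j₁ : Fin p) :
    basisElt p F ϖ E r (some j₀, j₁) = bigMono p F ϖ E r j₀ j₁ := by
  rw [bigMono, bigCell_apply]
  change basisFin p F ϖ E r j₀ j₁ = _
  rw [basisFin, finsum_eq_sum_of_fintype]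
  rfl

omit hR [Fintype (resField p F)] in
theorem basisElt_none (j₁ : Fin p) : basisElt p F ϖ E r (none, j₁) =
    V₂ p F E r (xi p F 0) (basisElt p F ϖ E r (some 0, j₁)) := rfl

/-- Both exponents must be nonzero so that the functions also agree at `x₀ = 0`, where `0^0 = 1`. -/
theorem bigMono_congr {a b : ℕ} (ha : a ≠ 0) (hb : b ≠ 0) (h : (a : ZMod (p - 1)) = b) (j : ℕ) :
    bigMono p F ϖ E r a j = bigMono p F ϖ E r b j := by
  rw [bigMono, bigMono]
  congr 1
  funext x
  by_cases hx : x.1 = 0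
  · simp [hx, ha, hb]
  · rw [pow_resField_eq_of_cast_eq p F ϖ hx h]

theorem bigMono_unip_tau (a : resField p F) (j₀ j₁ : ℕ) :
    V₂ p F E r (unip p F (tau p F ϖ a)) (bigMono p F ϖ E r j₀ j₁) =
      ∑ i ∈ Finset.range (j₀ + 1), ((-algebraMap _ E a) ^ (j₀ - i) * (j₀.choose i : E)) •
        bigMono p F ϖ E r i j₁ := by
  rw [bigMono, bigCell_unip_tau]
  simp only [bigMono, ← map_smul, ← map_sum]
  congr 1
  funext x
  rw [Finset.sum_apply, sub_eq_add_neg, add_pow, Finset.sum_mul, map_sum]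
  refine Finset.sum_congr rfl fun i _ => ?_
  simp only [Pi.smul_apply, smul_eq_mul, map_mul, map_pow, map_neg, map_natCast]
  ring

theorem bigMono_unip_eps (a : resField p F) (j₀ j₁ : ℕ) :
    V₂ p F E r (unip p F (tau p F ϖ a * eps p F ϖ)) (bigMono p F ϖ E r j₀ j₁) =
      ∑ i ∈ Finset.range (j₁ + 1), ((-algebraMap _ E a) ^ (j₁ - i) * (j₁.choose i : E)) •
        bigMono p F ϖ E r j₀ i := by
  rw [bigMono, bigCell_unip_eps]
  simp only [bigMono, ← map_smul, ← map_sum]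
  congr 1
  funext x
  rw [Finset.sum_apply, sub_eq_add_neg, add_pow, Finset.mul_sum, map_sum]
  refine Finset.sum_congr rfl fun i _ => ?_
  simp only [Pi.smul_apply, smul_eq_mul, map_mul, map_pow, map_neg, map_natCast]
  ring

theorem bigMono_dia_tau (a : (resField p F)ˣ) (j₀ j₁ : ℕ) :
    V₂ p F E r (dia p F (tauUnit p F ϖ a) 1) (bigMono p F ϖ E r j₀ j₁) =
      (algebraMap (resField p F) E a ^ r.val *
        algebraMap (resField p F) E (a⁻¹ : (resField p F)ˣ) ^ (j₀ + j₁)) •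
        bigMono p F ϖ E r j₀ j₁ := by
  rw [bigMono, bigCell_dia_tau, ← map_smul]
  congr 1
  funext x
  simp only [Pi.smul_apply, smul_eq_mul, map_mul, map_pow, mul_pow]
  ring

theorem bigMono_dia_eps (a : resField p F) (u : (O₂ p F)ˣ)
    (hu : (u : O₂ p F) = 1 + tau p F ϖ a * eps p F ϖ) (j₀ j₁ : ℕ) :
    V₂ p F E r (dia p F u 1) (bigMono p F ϖ E r j₀ j₁) =
      ∑ i ∈ Finset.range (j₁ + 1), ((-algebraMap _ E a) ^ (j₁ - i) * (j₁.choose i : E)) •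
        bigMono p F ϖ E r (j₀ + (j₁ - i)) i := by
  rw [bigMono, bigCell_dia_eps p F ϖ E r a u hu]
  simp only [bigMono, ← map_smul, ← map_sum]
  congr 1
  funext x
  rw [Finset.sum_apply, sub_eq_add_neg, add_pow, Finset.mul_sum, map_sum]
  refine Finset.sum_congr rfl fun i _ => ?_
  simp only [Pi.smul_apply, smul_eq_mul, map_mul, map_pow, map_neg, map_natCast, neg_pow (_ * _),
    neg_pow (algebraMap _ E a), mul_pow, pow_add, map_one]
  ring

theorem natCast_val_zmod (x : ZMod (p - 1)) : ((x.val : ℕ) : ZMod (p - 1)) = x := by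
  have hp := (Fact.out : p.Prime).two_le
  have : NeZero (p - 1) := ⟨by omega⟩
  exact ZMod.natCast_zmod_val x

/-- For `x₀ ≠ 0` the factor `(-x₀)^r x₀^(-j₀) (-x₁ x₀^(-2))^(j₁)` collects into a sign and `x₀^(r -
2 j₁ - j₀) x₁^(j₁)`. A representative in `{1, …, p - 1}` gives the correct value `0` at `x₀ = 0`.
The small-cell term survives only for `j₀ = 0`. -/
theorem bigMono_xi_zero_aux (j₀ j₁ : ℕ) :
    V₂ p F E r (xi p F 0) (bigMono p F ϖ E r j₀ j₁) =
      (-1 : E) ^ (r.val + j₁) • bigMono p F ϖ E r (rep p (r - 2 * j₁ - j₀)).val j₁ +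
      smallCell p F ϖ E r fun y => algebraMap _ E (0 ^ j₀ * y ^ j₁) := by
  classical
  rw [bigMono, bigCell_xi_zero, bigMono, ← map_smul]
  congr 2
  funext x
  have hs : (rep p (r - 2 * j₁ - j₀)).val ≠ 0 := by
    have := rep_pos p (r - 2 * j₁ - j₀)
    omega
  simp only [Pi.smul_apply, smul_eq_mul]
  split_ifs with hx
  · simp [hx, hs]
  · have h : x.1 ^ ((rep p (r - 2 * j₁ - j₀)).val + j₀ + 2 * j₁) = x.1 ^ r.val :=
      pow_resField_eq_of_cast_eq p F ϖ hx (by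
        push_cast
        rw [natCast_rep, natCast_val_zmod]
        ring)
    rw [← map_neg, ← map_pow, ← map_mul, ← map_one (algebraMap (resField p F) E), ← map_neg,
      ← map_pow, ← map_mul]
    congr 1
    have h3 : x.1 * x.1⁻¹ = 1 := mul_inv_cancel₀ hx
    have h4 : x.1 ^ j₀ * x.1⁻¹ ^ j₀ = 1 := by rw [← mul_pow, h3, one_pow]
    have h5 : x.1 ^ (2 * j₁) * x.1⁻¹ ^ (2 * j₁) = 1 := by rw [← mul_pow, h3, one_pow]
    rw [neg_pow, ← h, mul_pow, neg_pow x.2, ← pow_mul, pow_add, pow_add, pow_add]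
    linear_combination ((-1) ^ r.val * (-1) ^ j₁ * x.2 ^ j₁ *
      x.1 ^ (rep p (r - 2 * j₁ - j₀)).val) * (h4 * x.1 ^ (2 * j₁) * x.1⁻¹ ^ (2 * j₁) + h5)

theorem bigMono_xi_zero {j₀ : ℕ} (h : j₀ ≠ 0) (j₁ : ℕ) :
    V₂ p F E r (xi p F 0) (bigMono p F ϖ E r j₀ j₁) =
      (-1 : E) ^ (r.val + j₁) • bigMono p F ϖ E r (rep p (r - 2 * j₁ - j₀)).val j₁ := by
  rw [bigMono_xi_zero_aux]
  have : (fun y : resField p F => algebraMap _ E (0 ^ j₀ * y ^ j₁)) = 0 := by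
    funext y; simp [h]
  rw [this, map_zero, add_zero]

theorem basisElt_none_eq (j₁ : Fin p) : basisElt p F ϖ E r (none, j₁) =
    (-1 : E) ^ (r.val + j₁.val) • bigMono p F ϖ E r (rep p (r - 2 * cl p j₁)).val j₁ +
      smallMono p F ϖ E r j₁ := by
  rw [basisElt_none, basisElt_some]
  change V₂ p F E r (xi p F 0) (bigMono p F ϖ E r 0 _) = _
  rw [bigMono_xi_zero_aux, smallMono]
  simp [cl]

/-- Up to sign, `f_{(∞, j₁)}` is `f_{(r - 2 j₁, j₁)}` plus a small-cell function fixed by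
unipotents, so the difference with its translate consists of lower monomials of the big cell. This
explains `Gen.infty_lower₀` and, for translations of `x₁`, `Gen.infty_lower₁`. -/
theorem basisElt_none_unip_tau (a : resField p F) (j₁ : Fin p) :
    V₂ p F E r (unip p F (tau p F ϖ a)) (basisElt p F ϖ E r (none, j₁)) =
      basisElt p F ϖ E r (none, j₁) + (-1 : E) ^ (r.val + j₁.val) •
        ∑ i ∈ Finset.range (rep p (r - 2 * cl p j₁)).val,
          ((-algebraMap _ E a) ^ ((rep p (r - 2 * cl p j₁)).val - i) *
            ((rep p (r - 2 * cl p j₁)).val.choose i : E)) • bigMono p F ϖ E r i j₁ := by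
  rw [basisElt_none_eq, map_add, map_smul, bigMono_unip_tau, smallMono, smallCell_unip,
    Finset.sum_range_succ, smul_add]
  simp
  abel

theorem basisElt_none_unip_eps (a : resField p F) (j₁ : Fin p) :
    V₂ p F E r (unip p F (tau p F ϖ a * eps p F ϖ)) (basisElt p F ϖ E r (none, j₁)) =
      basisElt p F ϖ E r (none, j₁) + (-1 : E) ^ (r.val + j₁.val) •
        ∑ i ∈ Finset.range j₁.val, ((-algebraMap _ E a) ^ (j₁.val - i) *
            (j₁.val.choose i : E)) • bigMono p F ϖ E r (rep p (r - 2 * cl p j₁)).val i := by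
  rw [basisElt_none_eq, map_add, map_smul, bigMono_unip_eps, smallMono, smallCell_unip,
    Finset.sum_range_succ, smul_add]
  simp
  abel

omit [Fintype (resField p F)] in
include ϖ hR in
theorem eq_zero_of_sum_pow {V : Type*} [AddCommGroup V] [Module E V] (v : Fin p → V)
    (h : ∀ x : resField p F, ∑ j, algebraMap _ E x ^ j.val • v j = 0) (j : Fin p) : v j = 0 := by
  have := finite_resField p F ϖ
  have h2 := mem_of_sum_pow_smul_mem (k := resField p F) (⊥ : Submodule E V) (n := p)
    (by rw [hR.card_resField]) (fun l => if h : l < p then v ⟨l, h⟩ else 0) (fun x => by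
      rw [Submodule.mem_bot, Finset.sum_range, ← h x]
      simp) j.1 j.2
  simpa using h2

/-- Only the `f_{(∞, j₁)}` have a small-cell component, and these components are distinct monomials.
Once their coefficients vanish, the Vandermonde argument applies to `x₀` and then to `x₁`. -/
theorem linearIndependent_basisElt : LinearIndependent E (basisElt p F ϖ E r) := by
  rw [Fintype.linearIndependent_iff]
  intro c hc
  have hsome : ∀ j₀ j₁, basisElt p F ϖ E r (some j₀, j₁) = cellEquiv p F ϖ E r
      ((fun x => algebraMap _ E (x.1 ^ j₀.val * x.2 ^ j₁.val)), 0) := fun j₀ j₁ => by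
    rw [basisElt_some, cellEquiv_apply, map_zero, add_zero]
    rfl
  have hnone : ∀ j₁ : Fin p, ∃ φ, basisElt p F ϖ E r (none, j₁) = cellEquiv p F ϖ E r
      (φ, fun y => algebraMap _ E (y ^ j₁.val)) := fun j₁ => by
    refine ⟨(-1 : E) ^ (r.val + j₁.val) • fun x =>
      algebraMap _ E (x.1 ^ (rep p (r - 2 * cl p j₁)).val * x.2 ^ j₁.val), ?_⟩
    rw [basisElt_none_eq, cellEquiv_apply, map_smul]
    rfl
  choose φ hφ using hnone
  rw [Fintype.sum_prod_type, Fintype.sum_option] at hc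
  simp only [hsome, hφ, ← map_smul, ← map_sum, ← map_add] at hc
  rw [LinearEquiv.map_eq_zero_iff, Prod.ext_iff] at hc
  obtain ⟨hc1, hc2⟩ := hc
  have hn : ∀ j₁, c (none, j₁) = 0 := by
    refine eq_zero_of_sum_pow p F ϖ E (fun j₁ => c (none, j₁)) fun x => ?_
    have h := congrFun hc2 x
    simp only [Prod.snd_add, Prod.snd_sum, Prod.smul_snd, smul_zero, Finset.sum_const_zero,
      add_zero, Finset.sum_apply, Pi.smul_apply, Prod.snd_zero, Pi.zero_apply, map_pow,
      smul_eq_mul] at h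
    rw [← h]
    exact Finset.sum_congr rfl fun j _ => mul_comm _ _
  have hs : ∀ j₀, (fun j₁ => c (some j₀, j₁)) = 0 := by
    intro j₀
    funext j₁
    have h1 : ∀ y : resField p F, ∑ j₁, algebraMap _ E y ^ j₁.val • c (some j₀, j₁) = 0 := by
      intro y
      refine eq_zero_of_sum_pow p F ϖ E
        (fun j₀ => ∑ j₁, algebraMap _ E y ^ j₁.val • c (some j₀, j₁)) (fun x => ?_) j₀
      have h := congrFun hc1 (x, y)
      simp only [hn, zero_smul, Finset.sum_const_zero, zero_add, Prod.fst_sum, Prod.smul_fst,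
        Finset.sum_apply, Pi.smul_apply, Prod.fst_zero, Pi.zero_apply, map_pow, map_mul,
        smul_eq_mul] at h
      rw [← h]
      refine Finset.sum_congr rfl fun j _ => ?_
      rw [smul_eq_mul, Finset.mul_sum]
      refine Finset.sum_congr rfl fun j' _ => ?_
      rw [smul_eq_mul]
      ring
    exact eq_zero_of_sum_pow p F ϖ E (fun j₁ => c (some j₀, j₁)) h1 j₁
  rintro ⟨_ | j₀, j₁⟩
  · exact hn j₁
  · exact congrFun (hs j₀) j₁

include ϖ hR in
theorem finrank_PS : Module.finrank E (PS p F E r) = Fintype.card (Theta p) := by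
  rw [← (cellEquiv p F ϖ E r).finrank_eq, Module.finrank_prod, Module.finrank_fintype_fun_eq_card,
    Module.finrank_fintype_fun_eq_card, Fintype.card_prod, Fintype.card_prod, Fintype.card_option,
    Fintype.card_fin, Fintype.card_eq_nat_card, hR.card_resField]
  ring

/-- The `f_{(j₀, j₁)}` form a basis of `V_{2,r}`. -/
def thetaBasis : Module.Basis (Theta p) E (PS p F E r) :=
  have : Nonempty (Theta p) := ⟨(none, top p)⟩
  basisOfLinearIndependentOfCardEqFinrank (linearIndependent_basisElt p F ϖ E r)
    (finrank_PS p F ϖ E r).symm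

theorem thetaBasis_apply (x : Theta p) : thetaBasis p F ϖ E r x = basisElt p F ϖ E r x := by
  simp [thetaBasis]

end Monomials

/-! ### Types: the carry condition and the linear order on pairs -/

section Types

variable (p : ℕ) [Fact p.Prime] (r : ZMod (p - 1))

/-- The element `r - 2 γ` of `{1, …, p - 1}`. -/
def wt (c : Fin p) : Fin p := rep p (r - 2 * cl p c)

/-- The sum of `j` and its flip is congruent to `s = r - 2c` modulo `p - 1` and lies between `1` and
`2(p - 1)`, hence equals `s` or `s + (p - 1)`. The second case is the one with a carry, and it
occurs when `s ≤ j`. -/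
theorem rep_wt_sub (c j : Fin p) :
    (j.val < (wt p r c).val ∧
      (rep p (r - 2 * cl p c - cl p j)).val + j.val = (wt p r c).val) ∨
    ((wt p r c).val ≤ j.val ∧
      (rep p (r - 2 * cl p c - cl p j)).val + j.val = (wt p r c).val + (p - 1)) := by
  have hp := (Fact.out : p.Prime).two_le
  set d := rep p (r - 2 * cl p c - cl p j) with hd
  set s := wt p r c with hs
  have hd1 : 1 ≤ d.val := rep_pos p _
  have hs1 : 1 ≤ s.val := rep_pos p _
  have hmod : ((d.val + j.val : ℕ) : ZMod (p - 1)) = (s.val : ℕ) := by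
    push_cast
    rw [hd, hs, wt, natCast_rep, natCast_rep, cl, cl]
    ring
  rw [ZMod.natCast_eq_natCast_iff] at hmod
  have hdp := d.2
  have hsp := s.2
  have hjp := j.2
  rcases le_or_gt (d.val + j.val) (p - 1) with h | h
  · left
    have h3 : (d.val + j.val - 1) + 1 ≡ (s.val - 1) + 1 [MOD p - 1] := by
      rwa [Nat.sub_add_cancel (by omega), Nat.sub_add_cancel (by omega)]
    have h4 := Nat.ModEq.eq_of_lt_of_lt (Nat.ModEq.add_right_cancel' 1 h3) (by omega) (by omega)
    omega
  · right
    have h3 : (d.val + j.val - p) + p ≡ (s.val - 1) + p [MOD p - 1] := by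
      rw [Nat.sub_add_cancel (by omega), show s.val - 1 + p = s.val + (p - 1) by omega]
      exact hmod.trans (by simp [Nat.ModEq])
    have h4 := Nat.ModEq.eq_of_lt_of_lt (Nat.ModEq.add_right_cancel' p h3) (by omega) (by omega)
    omega

theorem pairOf_some (j c : Fin p) :
    pairOf p r (some j, c) = (if (wt p r c).val ≤ j.val then {0} else ∅, c) := by
  have hp := (Fact.out : p.Prime).two_le
  have hj := j.2
  have hs := (wt p r c).2
  have hs1 : 1 ≤ (wt p r c).val := rep_pos p _
  change (carry p j _, c) = _
  rw [carry]
  rcases rep_wt_sub p r c j with ⟨h1, h2⟩ | ⟨h1, h2⟩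
  · rw [if_neg (by omega), if_neg (by omega)]
  · rw [if_pos (by omega), if_pos (by omega)]

theorem pairOf_none (c : Fin p) : pairOf p r (none, c) = (∅, c) := rfl

/-- The position of a pair in a linear order refining `<_r`. -/
def idx (t : Pair p) : ℕ := 2 * t.2.val + t.1.card

theorem card_fin_one_le (I : Finset (Fin 1)) : I.card ≤ 1 := by
  simpa using Finset.card_le_univ I

omit [Fact p.Prime] in
theorem idx_injective : Function.Injective (idx p) := by
  rintro ⟨I, c⟩ ⟨I', c'⟩ h
  simp only [idx] at h
  have h1 := card_fin_one_le I
  have h2 := card_fin_one_le I'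
  have hc : c = c' := Fin.ext (by omega)
  have hI : I.card = I'.card := by omega
  subst hc
  have : I = I' := by
    clear h h1 h2
    revert I I'
    decide
  rw [this]

omit [Fact p.Prime] in
theorem idx_lt (t : Pair p) : idx p t < 2 * p := by
  have h1 := card_fin_one_le t.1
  have := t.2.2
  simp only [idx]
  omega

/-- Pairs are numbered from `0` to `2 p - 1` by `idx`. -/
def idxEquiv : Pair p ≃ Fin (2 * p) :=
  Equiv.ofBijective (fun t => ⟨idx p t, idx_lt p t⟩)
    ((Fintype.bijective_iff_injective_and_card _).2
      ⟨fun _ _ h => idx_injective p (congrArg Fin.val h), by simp [Fintype.card_prod]⟩)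

omit [Fact p.Prime] in
theorem idxEquiv_val (t : Pair p) : (idxEquiv p t).val = idx p t := rfl

/-- A relation that changes the level lowers it by one, which outweighs `|I| ≤ 1`. Inside a level,
the flip preserves each side of the threshold `s`, lowering `j₀` cannot create a carry, and `∞` sits
with the indices below `s`. -/
theorem idx_le_of_gen {x y : Theta p} (h : Gen p r x y) :
    idx p (pairOf p r x) ≤ idx p (pairOf p r y) := by
  have hcard : ∀ j c q : Fin p, (if (wt p r c).val ≤ j.val then ({0} : Finset (Fin 1)) else ∅,
      q).1.card = if (wt p r c).val ≤ j.val then 1 else 0 := fun j c q => by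
    split_ifs <;> rfl
  have hlow : ∀ x : Theta p, ∀ t : Pair p, x.2.val + 1 = t.2.val → idx p (pairOf p r x) ≤ idx p t := by
    rintro ⟨x, c⟩ t h
    have h2 : (pairOf p r (x, c)).2 = c := by cases x <;> rfl
    have h3 := card_fin_one_le (pairOf p r (x, c)).1
    simp only [idx, h2]
    simp only at h
    omega
  have hs := fun c => rep_pos p (r - 2 * cl p c)
  cases h with
  | lower₀ i₀ j₀ j₁ h =>
    rw [pairOf_some, pairOf_some, idx, idx, hcard, hcard]
    split_ifs <;> dsimp only <;> omega
  | lower₁ j₀ i₁ j₁ h => exact hlow _ _ h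
  | shift j₀ i₁ j₁ h => exact hlow _ _ h
  | flip j₀ j₁ h =>
    rw [pairOf_some, pairOf_some, idx, idx, hcard, hcard]
    have := rep_wt_sub p r j₁ j₀
    have := j₀.2
    split_ifs <;> dsimp only <;> omega
  | infty_lower₁ i₁ j₁ h => exact hlow _ _ h
  | infty_lower₀ i₀ j₁ h =>
    rw [pairOf_some, pairOf_none, if_neg]
    rw [← wt] at h
    omega
  | zero_infty j₀ j₁ h =>
    rw [pairOf_some, pairOf_none, if_neg]
    have := hs j₁
    rw [← wt] at this
    omega
  | infty_zero j₀ j₁ h =>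
    rw [pairOf_some, pairOf_none, if_neg]
    have := hs j₁
    rw [← wt] at this
    omega

theorem idx_le_of_typeLE {x y : Theta p} (h : TypeLE p r x y) :
    idx p (pairOf p r x) ≤ idx p (pairOf p r y) := by
  induction h with
  | refl => exact le_rfl
  | tail _ h ih => exact ih.trans (idx_le_of_gen p r h)

theorem typeLE_some_of_le {i j : Fin p} (h : i.val ≤ j.val) (c : Fin p) :
    TypeLE p r (some i, c) (some j, c) := by
  obtain ⟨j, hj⟩ := j
  induction j with
  | zero =>
    have : i = ⟨0, hj⟩ := Fin.ext (by simpa using h)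
    rw [this]
    exact .refl
  | succ n ih =>
    rcases Nat.lt_or_ge n i.val with h2 | h2
    · have : i = ⟨n + 1, hj⟩ := Fin.ext (show i.val = n + 1 from le_antisymm h h2)
      rw [this]
      exact .refl
    · exact .tail (ih (by omega) h2) (.lower₀ _ _ _ rfl)

/-- Each fibre is a cycle for the relations: `∞ ≤ 0 ≤ 1 ≤ … ≤ s - 1 ≤ ∞` below the threshold, and `s
≤ s + 1 ≤ … ≤ p - 1 ≤ s` above it, the last step being the flip of `s`. -/
theorem typeLE_of_pairOf_eq {x y : Theta p} (h : pairOf p r x = pairOf p r y) :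
    TypeLE p r x y := by
  obtain ⟨x, c⟩ := x
  obtain ⟨y, c'⟩ := y
  have hp := (Fact.out : p.Prime).two_le
  have hc : c = c' := by
    have h2 := congrArg Prod.snd h
    cases x <;> cases y <;> exact h2
  subst hc
  have hs1 : 1 ≤ (wt p r c).val := rep_pos p _
  have hs := (wt p r c).2
  set z : Fin p := ⟨0, by omega⟩ with hz
  have hnz : TypeLE p r (none, c) (some z, c) := .single (.infty_zero _ _ rfl)
  have hjn : ∀ j : Fin p, j.val < (wt p r c).val → TypeLE p r (some j, c) (none, c) :=
    fun j hj => .tail (typeLE_some_of_le p r (j := ⟨(wt p r c).val - 1, by omega⟩)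
      (by simp; omega) c) (.infty_lower₀ _ _ (by simp only; rw [← wt]; omega))
  have hsome : ∀ j : Fin p, pairOf p r (some j, c) = (∅, c) → j.val < (wt p r c).val := by
    intro j hj
    rw [pairOf_some] at hj
    by_contra hlt
    rw [if_pos (by omega)] at hj
    simp at hj
  rcases x with _ | i <;> rcases y with _ | j
  · exact .refl
  · exact hnz.trans (typeLE_some_of_le p r (Nat.zero_le _) c)
  · exact hjn i (hsome i h)
  · by_cases hi : i.val < (wt p r c).val
    · exact (hjn i hi).trans (hnz.trans (typeLE_some_of_le p r (Nat.zero_le _) c))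
    · have hj : ¬ j.val < (wt p r c).val := by
        intro hj
        rw [pairOf_some, pairOf_some, if_pos (by omega), if_neg (by omega)] at h
        simp at h
      have h1 : TypeLE p r (some i, c) (some (top p), c) :=
        typeLE_some_of_le p r (by have := i.2; simp [top]; omega) c
      have h2 : Gen p r (some (top p), c) (some (wt p r c), c) := by
        have h3 := Gen.flip (r := r) (wt p r c) c (by omega)
        have h4 : rep p (r - 2 * cl p c - cl p (wt p r c)) = top p := by
          have := rep_wt_sub p r c (wt p r c)
          refine Fin.ext ?_
          simp only [top]
          omega
        rwa [h4] at h3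
      exact (h1.tail h2).trans (typeLE_some_of_le p r (by omega) c)

/-- A set of elements of `Θ` closed under going down for `≤_r`. -/
def IsLower (S : Set (Theta p)) : Prop := ∀ x y, Gen p r x y → y ∈ S → x ∈ S

variable {p r}

theorem IsLower.typeLE {S : Set (Theta p)} (hS : IsLower p r S) {x y : Theta p}
    (h : TypeLE p r x y) (hy : y ∈ S) : x ∈ S := by
  induction h with
  | refl => exact hy
  | tail _ h ih => exact ih (hS _ _ h hy)

theorem isLower_below (t : Pair p) : IsLower p r (below p r t) := fun _ _ h ⟨z, hz, hy⟩ =>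
  ⟨z, hz, .head h hy⟩

theorem isLower_idx_lt (n : ℕ) : IsLower p r {x | idx p (pairOf p r x) < n} :=
  fun _ _ h hy => (idx_le_of_gen p r h).trans_lt hy

/-- As `idx` is monotone and injective on pairs, nothing of type `t` can lie below an element of
another type in `S` when `t` is the largest type allowed. -/
theorem IsLower.diff_fiber {S : Set (Theta p)} (hS : IsLower p r S) {t : Pair p}
    (ht : ∀ x ∈ S, idx p (pairOf p r x) ≤ idx p t) :
    IsLower p r {x ∈ S | pairOf p r x ≠ t} := fun x y h hy => by
  refine ⟨hS x y h hy.1, fun hx => hy.2 (idx_injective p (le_antisymm (ht y hy.1) ?_))⟩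
  rw [← hx]
  exact idx_le_of_gen p r h

theorem idx_le_of_mem_below {t : Pair p} {x : Theta p} (hx : x ∈ below p r t) :
    idx p (pairOf p r x) ≤ idx p t := by
  obtain ⟨z, rfl, h⟩ := hx
  exact idx_le_of_typeLE p r h

theorem mem_below_of_pairOf_eq {t : Pair p} {x : Theta p} (hx : pairOf p r x = t) :
    x ∈ below p r t := ⟨x, hx, .refl⟩

theorem pairLT_of_mem_below {t : Pair p} {x : Theta p} (hx : x ∈ below p r t)
    (hne : pairOf p r x ≠ t) : PairLT p r (pairOf p r x) t := by
  obtain ⟨z, rfl, h⟩ := hx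
  exact ⟨x, z, rfl, rfl, h, fun h2 => hne (idx_injective p
    (le_antisymm (idx_le_of_typeLE p r h) (idx_le_of_typeLE p r h2)))⟩

theorem below_subset_of_pairLT {t' t : Pair p} (h : PairLT p r t' t) :
    below p r t' ⊆ {x ∈ below p r t | pairOf p r x ≠ t} := by
  obtain ⟨x', x, rfl, rfl, hle, hnle⟩ := h
  rintro z ⟨u, hu, hz⟩
  have hzx' : TypeLE p r z x' := hz.trans (typeLE_of_pairOf_eq p r hu)
  exact ⟨⟨x, rfl, hzx'.trans hle⟩,
    fun hzx => hnle ((typeLE_of_pairOf_eq p r hzx.symm).trans hzx')⟩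

end Types

/-! ### Stability of lower sets and equivariance of symbols -/

section Stability

variable (p : ℕ) [Fact p.Prime] (r : ZMod (p - 1))

theorem typeLE_lower₁ (j : Fin p) {i c : Fin p} (h : i.val ≤ c.val) :
    TypeLE p r (some j, i) (some j, c) := by
  obtain ⟨c, hc⟩ := c
  induction c with
  | zero =>
    have : i = ⟨0, hc⟩ := Fin.ext (by simpa using h)
    rw [this]
    exact .refl
  | succ n ih =>
    rcases Nat.lt_or_ge n i.val with h2 | h2
    · have : i = ⟨n + 1, hc⟩ := Fin.ext (show i.val = n + 1 from le_antisymm h h2)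
      rw [this]
      exact .refl
    · exact .tail (ih (by omega) h2) (.lower₁ _ _ _ rfl)

/-- The shear produces `x₀^(j + l) x₁^(c - l)`, with `j + l` possibly beyond `p - 1`. Iterating
`Gen.shift` reaches its representative in `Ñ`; the clause on `0` keeps the exponent `0` apart from
`p - 1`, to which it is congruent. -/
theorem typeLE_shift (j : Fin p) {i c l : ℕ} (hc : c < p) (hl : i + l = c) :
    ∃ j' : Fin p, (j'.val = 0 ↔ j.val + l = 0) ∧ ((j'.val : ZMod (p - 1)) = (j.val + l : ℕ)) ∧
      TypeLE p r (some j', ⟨i, by omega⟩) (some j, ⟨c, hc⟩) := by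
  induction l generalizing i with
  | zero =>
    subst hl
    exact ⟨j, by simp, by simp, .refl⟩
  | succ l ih =>
    obtain ⟨j', -, h2, h3⟩ := ih (i := i + 1) (by omega)
    refine ⟨rep p (cl p j' + 1), ?_, ?_, .head (.shift j' ⟨i, by omega⟩ ⟨i + 1, by omega⟩ rfl) h3⟩
    · have := rep_pos p (cl p j' + 1)
      omega
    · rw [natCast_rep, cl, h2]
      push_cast
      ring

variable (F : Type*) [Field F] [Algebra ℚ_[p] F]
  [FiniteDimensional ℚ_[p] F] (ϖ : integers p F) [hR : IsRamified p F ϖ]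
  (E : Type*) [Field E] [Algebra (resField p F) E] [Fintype (resField p F)]

omit hR [Fintype (resField p F)] in
/-- The span of the basis elements indexed by `S`. -/
def spanOf (S : Set (Theta p)) : Submodule E (PS p F E r) :=
  Submodule.span E (basisElt p F ϖ E r '' S)

variable {p r F ϖ E}

omit hR [Fintype (resField p F)] in
theorem basisElt_mem_spanOf {S : Set (Theta p)} {x : Theta p} (hx : x ∈ S) :
    basisElt p F ϖ E r x ∈ spanOf p r F ϖ E S :=
  Submodule.subset_span ⟨x, hx, rfl⟩

theorem bigMono_mem_spanOf {S : Set (Theta p)} {i c : ℕ} (hi : i < p) (hc : c < p)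
    (hx : ((some ⟨i, hi⟩, ⟨c, hc⟩) : Theta p) ∈ S) :
    bigMono p F ϖ E r i c ∈ spanOf p r F ϖ E S := by
  have := basisElt_mem_spanOf (F := F) (ϖ := ϖ) (E := E) (r := r) hx
  rwa [basisElt_some] at this

variable {W : Type*} [AddCommGroup W] [Module E W] (σ : Representation E (G₂ p F) W)

/-- Data ensuring that a linear map `Ψ` on `V_{2,r}` intertwines the actions of `G₂` on the span of
the `f_{(j₀, j₁)}`, `(j₀, j₁) ∈ S`, where `Ψ` kills those with `j₁ < c`. -/
structure IntertwinesOn (S : Set (Theta p)) (c : Fin p) (Ψ : PS p F E r →ₗ[E] W) : Prop where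
  level_le : ∀ x ∈ S, x.2.val ≤ c.val
  eq_zero : ∀ x ∈ S, x.2.val < c.val → Ψ (basisElt p F ϖ E r x) = 0
  unip_eps : ∀ a v, σ (unip p F (tau p F ϖ a * eps p F ϖ)) (Ψ v) = Ψ v
  dia_eps : ∀ a (u : (O₂ p F)ˣ), (u : O₂ p F) = 1 + tau p F ϖ a * eps p F ϖ →
    ∀ v, σ (dia p F u 1) (Ψ v) = Ψ v
  scalar : ∀ z v, σ (dia p F z z) (Ψ v) = toE p F E z ^ r.val • Ψ v
  dia_tau : ∀ j : Fin p, (some j, c) ∈ S → ∀ a : (resField p F)ˣ,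
    σ (dia p F (tauUnit p F ϖ a) 1) (Ψ (bigMono p F ϖ E r j c)) =
      (algebraMap (resField p F) E a ^ r.val *
        algebraMap (resField p F) E (a⁻¹ : (resField p F)ˣ) ^ (j.val + c.val)) •
        Ψ (bigMono p F ϖ E r j c)
  unip_tau : ∀ j : Fin p, (some j, c) ∈ S → ∀ a,
    σ (unip p F (tau p F ϖ a)) (Ψ (bigMono p F ϖ E r j c)) =
      ∑ i ∈ Finset.range (j.val + 1), ((-algebraMap _ E a) ^ (j.val - i) * (j.val.choose i : E)) •
        Ψ (bigMono p F ϖ E r i c)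
  unip_tau_infty : (none, c) ∈ S → ∀ a,
    σ (unip p F (tau p F ϖ a)) (Ψ (basisElt p F ϖ E r (none, c))) =
      Ψ (basisElt p F ϖ E r (none, c)) + (-1 : E) ^ (r.val + c.val) •
        ∑ i ∈ Finset.range (wt p r c).val, ((-algebraMap _ E a) ^ ((wt p r c).val - i) *
            ((wt p r c).val.choose i : E)) • Ψ (bigMono p F ϖ E r i c)
  swap : ∀ j : Fin p, (some j, c) ∈ S → j.val ≠ 0 →
    σ (xi p F 0) (Ψ (bigMono p F ϖ E r j c)) = (-1 : E) ^ (r.val + c.val) •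
      Ψ (bigMono p F ϖ E r (rep p (r - 2 * cl p c - cl p j)).val c)
  swap_zero : (some 0, c) ∈ S →
    σ (xi p F 0) (Ψ (basisElt p F ϖ E r (some 0, c))) = Ψ (basisElt p F ϖ E r (none, c))

variable {σ} {S : Set (Theta p)} {c : Fin p} {Ψ : PS p F E r →ₗ[E] W}

theorem IntertwinesOn.lt_or_eq (h : IntertwinesOn (ϖ := ϖ) σ S c Ψ) {x : Option (Fin p)} {d : Fin p}
    (hx : (x, d) ∈ S) : d.val < c.val ∨ d = c := by
  have := h.level_le _ hx
  rcases Nat.lt_or_ge d.val c.val with h2 | h2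
  · exact Or.inl h2
  · exact Or.inr (Fin.ext (le_antisymm this h2))

theorem IntertwinesOn.bigMono_eq_zero (h : IntertwinesOn (ϖ := ϖ) σ S c Ψ) {j d : ℕ}
    (hj : j < p) (hd : d < p) (hx : ((some ⟨j, hj⟩, ⟨d, hd⟩) : Theta p) ∈ S) (hlt : d < c.val) :
    Ψ (bigMono p F ϖ E r j d) = 0 := by
  have := h.eq_zero _ hx hlt
  rwa [basisElt_some] at this

/-- `g` preserves the span of `S` at `v`, and `Ψ` intertwines its action on `v`. -/
def GoodAt (ϖ : integers p F) (σ : Representation E (G₂ p F) W) (S : Set (Theta p))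
    (Ψ : PS p F E r →ₗ[E] W) (g : G₂ p F) (v : PS p F E r) : Prop :=
  V₂ p F E r g v ∈ spanOf p r F ϖ E S ∧ Ψ (V₂ p F E r g v) = σ g (Ψ v)

omit hR [Fintype (resField p F)] in
theorem GoodAt.of_basis {g : G₂ p F}
    (h : ∀ x ∈ S, GoodAt ϖ σ S Ψ g (basisElt p F ϖ E r x)) {v : PS p F E r}
    (hv : v ∈ spanOf p r F ϖ E S) : GoodAt ϖ σ S Ψ g v := by
  induction hv using Submodule.span_induction with
  | mem x hx =>
    obtain ⟨x, hx, rfl⟩ := hx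
    exact h x hx
  | zero => exact ⟨by simp, by simp⟩
  | add x y _ _ hx hy =>
    refine ⟨?_, ?_⟩
    · rw [map_add]
      exact Submodule.add_mem _ hx.1 hy.1
    · rw [map_add, map_add, map_add, map_add, hx.2, hy.2]
  | smul a x _ hx =>
    refine ⟨?_, ?_⟩
    · rw [map_smul]
      exact Submodule.smul_mem _ _ hx.1
    · rw [map_smul, map_smul, map_smul, map_smul, hx.2]

omit hR [Fintype (resField p F)] in
-- Stability and equivariance are carried together because equivariance under `g` is known only on
-- the span, so `g' v` must already be there.
theorem GoodAt.mul {g g' : G₂ p F} {v : PS p F E r}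
    (hg : ∀ v ∈ spanOf p r F ϖ E S, GoodAt ϖ σ S Ψ g v) (hg' : GoodAt ϖ σ S Ψ g' v) :
    GoodAt ϖ σ S Ψ (g * g') v := by
  have := hg _ hg'.1
  refine ⟨?_, ?_⟩
  · rw [map_mul]
    exact this.1
  · rw [map_mul, map_mul]
    change Ψ (V₂ p F E r g (V₂ p F E r g' v)) = σ g (σ g' (Ψ v))
    rw [this.2, hg'.2]

theorem IntertwinesOn.good_unip_tau (h : IntertwinesOn (ϖ := ϖ) σ S c Ψ) (hS : IsLower p r S)
    (a : resField p F) {x : Theta p} (hx : x ∈ S) :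
    GoodAt ϖ σ S Ψ (unip p F (tau p F ϖ a)) (basisElt p F ϖ E r x) := by
  rcases x with ⟨_ | j, d⟩
  -- The monomials produced from `f_{(∞, d)}` have `x₀`-degree at most `s - 1`, and `(s - 1, d)` is
  -- below `(∞, d)` by `Gen.infty_lower₀`.
  · have hmem : ∀ i ∈ Finset.range (wt p r d).val,
        ∃ hi : i < p, ((some ⟨i, hi⟩, d) : Theta p) ∈ S := fun i hi => by
      have hi' := Finset.mem_range.1 hi
      have := (wt p r d).2
      refine ⟨by omega, hS.typeLE (.tail (typeLE_some_of_le p r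
        (j := ⟨(wt p r d).val - 1, by omega⟩) (by simp only; omega) d)
        (.infty_lower₀ _ _ ?_)) hx⟩
      rw [← wt]
      simp only
      omega
    refine ⟨?_, ?_⟩
    · rw [basisElt_none_unip_tau]
      refine Submodule.add_mem _ (basisElt_mem_spanOf hx) (Submodule.smul_mem _ _
        (Submodule.sum_mem _ fun i hi => Submodule.smul_mem _ _ ?_))
      obtain ⟨hi', hm⟩ := hmem i hi
      exact bigMono_mem_spanOf hi' d.2 hm
    · rcases h.lt_or_eq hx with hd | rfl
      · rw [basisElt_none_unip_tau, map_add, map_smul, map_sum, h.eq_zero _ hx hd, map_zero,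
          zero_add, Finset.sum_eq_zero, smul_zero]
        intro i hi
        obtain ⟨hi', hm⟩ := hmem i hi
        rw [map_smul, h.bigMono_eq_zero hi' d.2 hm hd, smul_zero]
      · rw [h.unip_tau_infty hx, basisElt_none_unip_tau, map_add, map_smul, map_sum]
        simp only [map_smul]
        rfl
  · have hmem : ∀ i ∈ Finset.range (j.val + 1),
        ∃ hi : i < p, ((some ⟨i, hi⟩, d) : Theta p) ∈ S := fun i hi => by
      have hi' := Finset.mem_range.1 hi
      have := j.2
      exact ⟨by omega, hS.typeLE (typeLE_some_of_le p r (by simp only; omega) d) hx⟩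
    refine ⟨?_, ?_⟩
    · rw [basisElt_some, bigMono_unip_tau]
      refine Submodule.sum_mem _ fun i hi => Submodule.smul_mem _ _ ?_
      obtain ⟨hi', hm⟩ := hmem i hi
      exact bigMono_mem_spanOf hi' d.2 hm
    · rcases h.lt_or_eq hx with hd | rfl
      · rw [h.eq_zero _ hx hd, basisElt_some, bigMono_unip_tau, map_sum, map_zero]
        refine Finset.sum_eq_zero fun i hi => ?_
        obtain ⟨hi', hm⟩ := hmem i hi
        rw [map_smul, h.bigMono_eq_zero hi' d.2 hm hd, smul_zero]
      · rw [basisElt_some, h.unip_tau j hx, bigMono_unip_tau, map_sum]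
        simp only [map_smul]

theorem IntertwinesOn.good_unip_eps (h : IntertwinesOn (ϖ := ϖ) σ S c Ψ) (hS : IsLower p r S)
    (a : resField p F) {x : Theta p} (hx : x ∈ S) :
    GoodAt ϖ σ S Ψ (unip p F (tau p F ϖ a * eps p F ϖ)) (basisElt p F ϖ E r x) := by
  have hle := h.level_le _ hx
  rcases x with ⟨_ | j, d⟩
  · have hmem : ∀ i ∈ Finset.range d.val,
        ∃ hi : i < p, ((some (wt p r d), ⟨i, hi⟩) : Theta p) ∈ S := fun i hi => by
      have hi' := Finset.mem_range.1 hi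
      have := d.2
      refine ⟨by omega, hS.typeLE (.tail (typeLE_lower₁ p r _ (c := ⟨d.val - 1, by omega⟩)
        (by simp only; omega)) (.infty_lower₁ _ _ (by simp only; omega))) hx⟩
    refine ⟨?_, ?_⟩
    · rw [basisElt_none_unip_eps]
      refine Submodule.add_mem _ (basisElt_mem_spanOf hx) (Submodule.smul_mem _ _
        (Submodule.sum_mem _ fun i hi => Submodule.smul_mem _ _ ?_))
      obtain ⟨hi', hm⟩ := hmem i hi
      exact bigMono_mem_spanOf _ hi' hm
    · rw [h.unip_eps, basisElt_none_unip_eps, map_add, map_smul, map_sum, Finset.sum_eq_zero,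
        smul_zero, add_zero]
      intro i hi
      obtain ⟨hi', hm⟩ := hmem i hi
      have hz : Ψ (bigMono p F ϖ E r (wt p r d).val i) = 0 :=
        h.bigMono_eq_zero _ hi' hm ((Finset.mem_range.1 hi).trans_le hle)
      rw [map_smul, ← wt, hz, smul_zero]
  · have hmem : ∀ i ∈ Finset.range (d.val + 1),
        ∃ hi : i < p, ((some j, ⟨i, hi⟩) : Theta p) ∈ S := fun i hi => by
      have hi' := Finset.mem_range.1 hi
      have := d.2
      exact ⟨by omega, hS.typeLE (typeLE_lower₁ p r _ (by simp only; omega)) hx⟩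
    rw [basisElt_some]
    refine ⟨?_, ?_⟩
    · rw [bigMono_unip_eps]
      refine Submodule.sum_mem _ fun i hi => Submodule.smul_mem _ _ ?_
      obtain ⟨hi', hm⟩ := hmem i hi
      exact bigMono_mem_spanOf _ hi' hm
    · rw [h.unip_eps, bigMono_unip_eps, map_sum, Finset.sum_range_succ, Finset.sum_eq_zero]
      · simp
      · intro i hi
        obtain ⟨hi', hm⟩ := hmem i (Finset.mem_range.2 ((Finset.mem_range.1 hi).trans
          (Nat.lt_succ_self _)))
        rw [map_smul, h.bigMono_eq_zero _ hi' hm ((Finset.mem_range.1 hi).trans_le hle), smul_zero]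

theorem IntertwinesOn.good_scalar (h : IntertwinesOn (ϖ := ϖ) σ S c Ψ) (z : (O₂ p F)ˣ)
    {v : PS p F E r} (hv : v ∈ spanOf p r F ϖ E S) : GoodAt ϖ σ S Ψ (dia p F z z) v := by
  refine ⟨?_, ?_⟩
  · rw [V₂_scalar]
    exact Submodule.smul_mem _ _ hv
  · rw [V₂_scalar, h.scalar, map_smul]

theorem zero_mem_of_infty_mem (hS : IsLower p r S) {d : Fin p} (hx : (none, d) ∈ S) :
    (some 0, d) ∈ S := hS _ _ (.zero_infty _ _ rfl) hx

theorem IntertwinesOn.good_swap (h : IntertwinesOn (ϖ := ϖ) σ S c Ψ) (hS : IsLower p r S)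
    {x : Theta p} (hx : x ∈ S) : GoodAt ϖ σ S Ψ (xi p F 0) (basisElt p F ϖ E r x) := by
  -- As `w² = 1` on both sides, the behaviour at `∞` is that at `0` read backwards.
  have hsq : ∀ v, V₂ p F E r (xi p F 0) (V₂ p F E r (xi p F 0) v) = v := fun v => by
    have : V₂ p F E r (xi p F 0 * xi p F 0) v = v := by rw [xi_zero_mul_self, map_one]; rfl
    rwa [map_mul] at this
  have hsq' : ∀ v, σ (xi p F 0) (σ (xi p F 0) v) = v := fun v => by
    have : σ (xi p F 0 * xi p F 0) v = v := by rw [xi_zero_mul_self, map_one]; rfl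
    rwa [map_mul] at this
  rcases x with ⟨_ | j, d⟩
  · have h0 := zero_mem_of_infty_mem hS hx
    refine ⟨?_, ?_⟩
    · rw [basisElt_none, hsq]
      exact basisElt_mem_spanOf h0
    · rcases h.lt_or_eq hx with hd | rfl
      · rw [h.eq_zero _ hx hd, basisElt_none, hsq, h.eq_zero _ h0 hd, map_zero]
      · rw [← h.swap_zero h0, hsq', basisElt_none, hsq]
  · by_cases hj : j = 0
    · subst hj
      have hn : (none, d) ∈ S := hS _ _ (.infty_zero _ _ rfl) hx
      refine ⟨?_, ?_⟩
      · rw [← basisElt_none]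
        exact basisElt_mem_spanOf hn
      · rw [← basisElt_none]
        rcases h.lt_or_eq hx with hd | rfl
        · rw [h.eq_zero _ hx hd, h.eq_zero _ hn hd, map_zero]
        · rw [h.swap_zero hx]
    · have hj' : j.val ≠ 0 := fun h0 => hj (Fin.ext h0)
      have hf : (some (rep p (r - 2 * cl p d - cl p j)), d) ∈ S := hS _ _ (.flip _ _ hj') hx
      rw [basisElt_some]
      have hw := bigMono_xi_zero p F ϖ E r hj' d.val
      refine ⟨?_, ?_⟩
      · rw [hw]
        exact Submodule.smul_mem _ _ (bigMono_mem_spanOf _ d.2 hf)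
      · rcases h.lt_or_eq hx with hd | rfl
        · have hz : Ψ (bigMono p F ϖ E r (rep p (r - 2 * cl p d - cl p j)).val d.val) = 0 :=
            h.bigMono_eq_zero _ _ hf hd
          rw [h.bigMono_eq_zero _ _ hx hd, hw, map_smul, map_zero]
          exact (congrArg _ hz).trans (smul_zero _)
        · rw [h.swap j hx hj', hw, map_smul]
          rfl

/-- Good behaviour of `diag(u, 1)` at `f_{(∞, j₁)}` follows from that of `diag(u⁻¹, 1)` at
`f_{(0, j₁)}`. -/
theorem IntertwinesOn.good_dia_infty (h : IntertwinesOn (ϖ := ϖ) σ S c Ψ) (hS : IsLower p r S)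
    (u : (O₂ p F)ˣ) {d : Fin p} (hx : (none, d) ∈ S)
    (hu : GoodAt ϖ σ S Ψ (dia p F u⁻¹ 1) (basisElt p F ϖ E r (some 0, d))) :
    GoodAt ϖ σ S Ψ (dia p F u 1) (basisElt p F ϖ E r (none, d)) := by
  have h0 := zero_mem_of_infty_mem hS hx
  -- Here `w · (u · diag(u⁻¹, 1)) = w · diag(1, u) = diag(u, 1) · w`, applied to `f_{(0, d)}`, where
  -- `w f_{(0, d)} = f_{(∞, d)}`.
  have h1 := GoodAt.mul (fun v hv => GoodAt.of_basis (fun x hx => h.good_swap hS hx) hv)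
    (GoodAt.mul (fun v hv => h.good_scalar u hv) hu)
  rw [dia_mul_dia, mul_inv_cancel, mul_one, ← dia_mul_xi_zero] at h1
  have h2 := h.good_swap hS h0
  refine ⟨?_, ?_⟩
  · have := h1.1
    rw [map_mul] at this
    exact this
  · have := h1.2
    rw [map_mul, map_mul] at this
    change Ψ (V₂ p F E r _ (V₂ p F E r _ _)) = σ _ (σ _ _) at this
    rw [← h2.2] at this
    exact this

theorem IntertwinesOn.good_dia_tau (h : IntertwinesOn (ϖ := ϖ) σ S c Ψ) (hS : IsLower p r S)
    (a : (resField p F)ˣ) {x : Theta p} (hx : x ∈ S) :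
    GoodAt ϖ σ S Ψ (dia p F (tauUnit p F ϖ a) 1) (basisElt p F ϖ E r x) := by
  have key : ∀ (a : (resField p F)ˣ) (j d : Fin p), (some j, d) ∈ S →
      GoodAt ϖ σ S Ψ (dia p F (tauUnit p F ϖ a) 1) (basisElt p F ϖ E r (some j, d)) := by
    intro a j d hx
    refine ⟨?_, ?_⟩
    · rw [basisElt_some, bigMono_dia_tau, ← basisElt_some]
      exact Submodule.smul_mem _ _ (basisElt_mem_spanOf hx)
    · rcases h.lt_or_eq hx with hd | rfl
      · rw [h.eq_zero _ hx hd, basisElt_some, bigMono_dia_tau, ← basisElt_some, map_smul,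
          h.eq_zero _ hx hd, map_zero, smul_zero]
      · rw [basisElt_some, bigMono_dia_tau, map_smul, h.dia_tau j hx]
  rcases x with ⟨_ | j, d⟩
  · refine h.good_dia_infty hS _ hx ?_
    have : (tauUnit p F ϖ a)⁻¹ = tauUnit p F ϖ a⁻¹ := (map_inv _ a).symm
    rw [this]
    exact key _ _ _ (zero_mem_of_infty_mem hS hx)
  · exact key _ _ _ hx

theorem IntertwinesOn.good_dia_eps (h : IntertwinesOn (ϖ := ϖ) σ S c Ψ) (hS : IsLower p r S)
    (a : resField p F) (u : (O₂ p F)ˣ) (hu : (u : O₂ p F) = 1 + tau p F ϖ a * eps p F ϖ)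
    {x : Theta p} (hx : x ∈ S) :
    GoodAt ϖ σ S Ψ (dia p F u 1) (basisElt p F ϖ E r x) := by
  have key : ∀ (a : resField p F) (u : (O₂ p F)ˣ),
      (u : O₂ p F) = 1 + tau p F ϖ a * eps p F ϖ → ∀ j d : Fin p, (some j, d) ∈ S →
      GoodAt ϖ σ S Ψ (dia p F u 1) (basisElt p F ϖ E r (some j, d)) := by
    intro a u hu j d hx
    have hle := h.level_le _ hx
    -- The unreduced exponent `j + (d - i)` is replaced by its representative in `Ñ`, which gives
    -- the same function and an index of `S`.
    have hmem : ∀ i ∈ Finset.range (d.val + 1), ∃ j' : Fin p, ∃ hi : i < p,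
        ((some j', ⟨i, hi⟩) : Theta p) ∈ S ∧
        bigMono p F ϖ E r (j.val + (d.val - i)) i = bigMono p F ϖ E r j' i := fun i hi => by
      have hi' := Finset.mem_range.1 hi
      obtain ⟨j', h1, h2, h3⟩ := typeLE_shift p r j d.2 (show i + (d.val - i) = d.val by omega)
      refine ⟨j', by omega, hS.typeLE h3 hx, ?_⟩
      by_cases hj : j'.val = 0
      · rw [hj, h1.1 hj]
      · exact bigMono_congr p F ϖ E r (fun h4 => hj (h1.2 h4)) hj h2.symm i
    rw [basisElt_some]
    refine ⟨?_, ?_⟩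
    · rw [bigMono_dia_eps p F ϖ E r a u hu]
      refine Submodule.sum_mem _ fun i hi => Submodule.smul_mem _ _ ?_
      obtain ⟨j', hi', hm, he⟩ := hmem i hi
      rw [he]
      exact bigMono_mem_spanOf _ hi' hm
    · rw [h.dia_eps a u hu, bigMono_dia_eps p F ϖ E r a u hu, map_sum, Finset.sum_range_succ,
        Finset.sum_eq_zero]
      · simp
      · intro i hi
        obtain ⟨j', hi', hm, he⟩ := hmem i (Finset.mem_range.2 ((Finset.mem_range.1 hi).trans
          (Nat.lt_succ_self _)))
        rw [map_smul, he, h.bigMono_eq_zero _ hi' hm ((Finset.mem_range.1 hi).trans_le hle),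
          smul_zero]
  rcases x with ⟨_ | j, d⟩
  · refine h.good_dia_infty hS _ hx (key (-a) _ ?_ _ _ (zero_mem_of_infty_mem hS hx))
    refine Units.inv_eq_of_mul_eq_one_right ?_
    rw [hu, map_neg]
    linear_combination (-tau p F ϖ a ^ 2) * eps_mul_eps p F ϖ
  · exact key a u hu _ _ hx

theorem IntertwinesOn.good (h : IntertwinesOn (ϖ := ϖ) σ S c Ψ) (hS : IsLower p r S)
    (g : G₂ p F) {v : PS p F E r} (hv : v ∈ spanOf p r F ϖ E S) : GoodAt ϖ σ S Ψ g v := by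
  let M : Submonoid (G₂ p F) :=
    { carrier := {g | ∀ v ∈ spanOf p r F ϖ E S, GoodAt ϖ σ S Ψ g v}
      one_mem' := fun v hv => ⟨by simpa using hv, by simp⟩
      mul_mem' := fun hg hg' v hv => GoodAt.mul hg (hg' v hv) }
  have hM : M = ⊤ := submonoid_eq_top p F ϖ M
    (fun a v hv => GoodAt.of_basis (fun x hx => h.good_unip_tau hS a hx) hv)
    (fun a v hv => GoodAt.of_basis (fun x hx => h.good_unip_eps hS a hx) hv)
    (fun a v hv => GoodAt.of_basis (fun x hx => h.good_dia_tau hS a hx) hv)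
    (fun a u hu v hv => GoodAt.of_basis (fun x hx => h.good_dia_eps hS a u hu hx) hv)
    (fun z v hv => h.good_scalar z hv)
    (fun v hv => GoodAt.of_basis (fun x hx => h.good_swap hS hx) hv)
  exact (hM ▸ Submonoid.mem_top g : g ∈ M) v hv

variable (ϖ E) in
-- Stability is the case `Ψ = 0` at the top level `p - 1`, where every equivariance condition is
-- trivial.
theorem V₂_mem_spanOf (hS : IsLower p r S) (g : G₂ p F) {v : PS p F E r}
    (hv : v ∈ spanOf p r F ϖ E S) : V₂ p F E r g v ∈ spanOf p r F ϖ E S := by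
  have h : IntertwinesOn (ϖ := ϖ) (V₂ p F E r) S (top p) (0 : PS p F E r →ₗ[E] PS p F E r) :=
    { level_le := fun x _ => by have := x.2.2; simp [top]; omega
      eq_zero := fun _ _ _ => rfl
      unip_eps := by simp
      dia_eps := by simp
      scalar := by simp
      dia_tau := by simp
      unip_tau := by simp
      unip_tau_infty := by simp
      swap := by simp
      swap_zero := by simp }
  exact (h.good hS g hv).1

end Stability

/-! ### From symbols to isomorphisms of subquotients -/

section Subquotients

open scoped MonoidAlgebra in
-- This is the first isomorphism theorem for a map defined linearly on all of `V` but required to be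
-- equivariant only on `N'`, as symbols are.
theorem nonempty_subquotient_equiv {k G V W : Type*} [Field k] [Group G] [AddCommGroup V]
    [Module k V] [AddCommGroup W] [Module k W] (ρ : Representation k G V)
    (σ : Representation k G W) (N N' : Submodule k[G] ρ.asModule) (Ψ : V →ₗ[k] W)
    (hΨ : ∀ g, ∀ v : V, ρ.asModuleEquiv.symm v ∈ N' → Ψ (ρ g v) = σ g (Ψ v))
    (hker : ∀ v : V, ρ.asModuleEquiv.symm v ∈ N' → (Ψ v = 0 ↔ ρ.asModuleEquiv.symm v ∈ N))
    (hsurj : ∀ w, ∃ v : V, ρ.asModuleEquiv.symm v ∈ N' ∧ Ψ v = w) :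
    Nonempty (Subquotient N N' ≃ₗ[k[G]] σ.asModule) := by
  let f : N' →ₗ[k[G]] σ.asModule :=
    { toFun := fun v => σ.asModuleEquiv.symm (Ψ (ρ.asModuleEquiv v.1))
      map_add' := fun v w => by simp
      map_smul' := fun a v => by
        obtain ⟨v, hv⟩ := v
        change σ.asModuleEquiv.symm (Ψ (ρ.asModuleEquiv (a • v))) =
          a • σ.asModuleEquiv.symm (Ψ (ρ.asModuleEquiv v))
        induction a using MonoidAlgebra.induction_linear with
        | zero => simp
        | add a b ha hb => rw [add_smul, add_smul, map_add, map_add, map_add, ha, hb]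
        | single g c =>
          rw [Representation.single_smul, Representation.single_smul]
          change Ψ (c • ρ g (ρ.asModuleEquiv v)) = c • σ g (Ψ (ρ.asModuleEquiv v))
          rw [map_smul]
          exact congrArg _ (hΨ g _ hv) }
  have hf : LinearMap.ker f = N.submoduleOf N' := by
    ext v
    rw [LinearMap.mem_ker]
    exact hker _ v.2
  have hs : Function.Surjective f := fun w => by
    obtain ⟨v, hv, h⟩ := hsurj (σ.asModuleEquiv w)
    exact ⟨⟨ρ.asModuleEquiv.symm v, hv⟩, h⟩
  exact ⟨(Submodule.quotEquivOfEq _ _ hf.symm).trans (f.quotKerEquivOfSurjective hs)⟩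

open scoped MonoidAlgebra in
/-- A subspace stable under `G`, as a submodule over the group algebra. -/
def submoduleOfStable {k G V : Type*} [Field k] [Group G] [AddCommGroup V] [Module k V]
    (ρ : Representation k G V) (N : Submodule k V) (h : ∀ g, ∀ v ∈ N, ρ g v ∈ N) :
    Submodule k[G] ρ.asModule where
  carrier := {v | ρ.asModuleEquiv v ∈ N}
  add_mem' hv hw := N.add_mem hv hw
  zero_mem' := N.zero_mem
  smul_mem' a v hv := by
    change ρ.asModuleEquiv (a • v) ∈ N
    induction a using MonoidAlgebra.induction_linear with
    | zero => simp
    | add a b ha hb => rw [add_smul, map_add]; exact N.add_mem ha hb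
    | single g c =>
      rw [Representation.single_smul]
      exact N.smul_mem c (h g _ hv)

open scoped MonoidAlgebra in
theorem le_of_submoduleOfStable {k G V : Type*} [Field k] [Group G] [AddCommGroup V] [Module k V]
    (ρ : Representation k G V) (N : Submodule k V) (h : ∀ g, ∀ v ∈ N, ρ g v ∈ N) {T : Set V}
    (hN : N = Submodule.span k T) {N' : Submodule k[G] ρ.asModule}
    (hT : ∀ v ∈ T, ρ.asModuleEquiv.symm v ∈ N') : submoduleOfStable ρ N h ≤ N' := fun v hv => by
  have h2 : N ≤ (Subrepresentation.ofSubmodule' N').toSubmodule := by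
    rw [hN, Submodule.span_le]
    exact hT
  exact h2 hv

variable {p : ℕ} [Fact p.Prime] {r : ZMod (p - 1)} {F : Type*} [Field F] [Algebra ℚ_[p] F]
  [FiniteDimensional ℚ_[p] F] (ϖ : integers p F) [hR : IsRamified p F ϖ]
  (E : Type*) [Field E] [Algebra (resField p F) E] [Fintype (resField p F)]

/-- The span of the basis elements indexed by a lower set, as a submodule. -/
def stableSub (S : Set (Theta p)) (hS : IsLower p r S) :
    Submodule (MonoidAlgebra E (G₂ p F)) (V₂Mod p F E r) :=
  submoduleOfStable (V₂ p F E r) (spanOf p r F ϖ E S) fun g _ hv => V₂_mem_spanOf ϖ E hS g hv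

variable {E ϖ}

theorem mem_stableSub {S : Set (Theta p)} {hS : IsLower p r S} {v : V₂Mod p F E r} :
    v ∈ stableSub ϖ E S hS ↔ (V₂ p F E r).asModuleEquiv v ∈ spanOf p r F ϖ E S := Iff.rfl

theorem stableSub_mono {S T : Set (Theta p)} {hS : IsLower p r S} {hT : IsLower p r T}
    (h : S ⊆ T) : stableSub ϖ E S hS ≤ stableSub ϖ E T hT := fun v hv => by
  have h2 : spanOf p r F ϖ E S ≤ spanOf p r F ϖ E T := Submodule.span_mono (Set.image_mono h)
  exact mem_stableSub.2 (h2 (mem_stableSub.1 hv))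

theorem stableSub_le {S : Set (Theta p)} {hS : IsLower p r S}
    {N : Submodule (MonoidAlgebra E (G₂ p F)) (V₂Mod p F E r)}
    (h : ∀ x ∈ S, (V₂ p F E r).asModuleEquiv.symm (basisElt p F ϖ E r x) ∈ N) :
    stableSub ϖ E S hS ≤ N :=
  le_of_submoduleOfStable (V₂ p F E r) _ _ rfl fun _ ⟨x, hx, hv⟩ => hv ▸ h x hx

/-- The subspace is already stable, so the submodule it generates is no larger. -/
theorem VSub_eq (t : Pair p) : VSub p F ϖ E r t = stableSub ϖ E (below p r t) (isLower_below t) :=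
  Submodule.span_eq (stableSub ϖ E (below p r t) (isLower_below t))

/-- An element of `below p r t` of another type has a type strictly smaller than `t`; conversely a
strictly smaller type brings in nothing of type `t`. -/
theorem iSup_VSub_eq (t : Pair p)
    (hS : IsLower p r {x ∈ below p r t | pairOf p r x ≠ t}) :
    (⨆ (t' : Pair p) (_ : PairLT p r t' t), VSub p F ϖ E r t') =
      stableSub ϖ E {x ∈ below p r t | pairOf p r x ≠ t} hS := by
  have h1 : ∀ t' : Pair p, PairLT p r t' t →
      VSub p F ϖ E r t' ≤ stableSub ϖ E {x ∈ below p r t | pairOf p r x ≠ t} hS := fun t' h => by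
    rw [VSub_eq]
    exact stableSub_mono (below_subset_of_pairLT h)
  have h2 : ∀ x ∈ {x ∈ below p r t | pairOf p r x ≠ t},
      (V₂ p F E r).asModuleEquiv.symm (basisElt p F ϖ E r x) ∈ VSub p F ϖ E r (pairOf p r x) :=
    fun x hx => by
    rw [VSub_eq, mem_stableSub, LinearEquiv.apply_symm_apply]
    exact basisElt_mem_spanOf (mem_below_of_pairOf_eq rfl)
  refine le_antisymm (iSup₂_le h1) (stableSub_le fun x hx => ?_)
  exact Submodule.mem_iSup_of_mem (pairOf p r x)
    (Submodule.mem_iSup_of_mem (pairLT_of_mem_below hx.1 hx.2) (h2 x hx))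

variable (r) in
/-- A linear map on `V_{2,r}` inducing an isomorphism between the constituent attached to the pair
`t` and the weight `det ^ i ⊗ Sym ^ m`. -/
structure IsSymbol (t : Pair p) (i m : ℕ) (Ψ : PS p F E r →ₗ[E] SymPow E m)
    (x : Fin (m + 1) → Theta p) (a : Fin (m + 1) → E) : Prop where
  fiber : ∀ y, pairOf p r y = t ↔ y ∈ Set.range x
  apply : ∀ j, Ψ (basisElt p F ϖ E r (x j)) = a j • symMono E m j
  ne_zero : ∀ j, a j ≠ 0
  eq_zero : ∀ y, idx p (pairOf p r y) < idx p t → Ψ (basisElt p F ϖ E r y) = 0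
  intertwines : ∀ S : Set (Theta p), (∀ y ∈ S, idx p (pairOf p r y) ≤ idx p t) →
    IntertwinesOn (ϖ := ϖ) (serreWeight p F E i m) S t.2 Ψ

/-- The symbol kills all types before `t` and matches the fibre of `t` with nonzero multiples of the
monomial basis, so its kernel on the span of `S` is the span of the other types. Only the maximality
of `t` in `S` is involved, so one symbol serves several filtrations. -/
theorem IsSymbol.nonempty_equiv {t : Pair p} {i m : ℕ} {Ψ : PS p F E r →ₗ[E] SymPow E m}
    {x : Fin (m + 1) → Theta p} {a : Fin (m + 1) → E} (h : IsSymbol (ϖ := ϖ) r t i m Ψ x a)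
    {S : Set (Theta p)} (hS : IsLower p r S) (hle : ∀ y ∈ S, idx p (pairOf p r y) ≤ idx p t)
    (hfib : ∀ y, pairOf p r y = t → y ∈ S)
    (hS' : IsLower p r {y ∈ S | pairOf p r y ≠ t}) :
    Nonempty (Subquotient (stableSub ϖ E {y ∈ S | pairOf p r y ≠ t} hS') (stableSub ϖ E S hS)
      ≃ₗ[MonoidAlgebra E (G₂ p F)] (serreWeight p F E i m).asModule) := by
  refine nonempty_subquotient_equiv _ _ _ _ Ψ
    (fun g v hv => ((h.intertwines S hle).good hS g hv).2) (fun v hv => ?_) (fun w => ?_)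
  · have h0 : ∀ v ∈ spanOf p r F ϖ E {y ∈ S | pairOf p r y ≠ t}, Ψ v = 0 := by
      have : spanOf p r F ϖ E {y ∈ S | pairOf p r y ≠ t} ≤ LinearMap.ker Ψ := by
        rw [spanOf, Submodule.span_le]
        rintro _ ⟨y, hy, rfl⟩
        exact h.eq_zero y (lt_of_le_of_ne (hle y hy.1) fun he => hy.2 (idx_injective p he))
      exact this
    refine ⟨fun hv0 => ?_, fun hv0 => h0 v hv0⟩
    have hsub : spanOf p r F ϖ E S ≤
        Submodule.span E (Set.range fun j => basisElt p F ϖ E r (x j)) ⊔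
          spanOf p r F ϖ E {y ∈ S | pairOf p r y ≠ t} := by
      rw [spanOf, Submodule.span_le]
      rintro _ ⟨y, hy, rfl⟩
      by_cases hyt : pairOf p r y = t
      · obtain ⟨j, rfl⟩ := (h.fiber y).1 hyt
        exact Submodule.mem_sup_left (Submodule.subset_span ⟨j, rfl⟩)
      · exact Submodule.mem_sup_right (basisElt_mem_spanOf ⟨hy, hyt⟩)
    obtain ⟨v₁, hv₁, v₂, hv₂, rfl⟩ := Submodule.mem_sup.1 (hsub hv)
    rw [map_add, h0 v₂ hv₂, add_zero] at hv0
    obtain ⟨b, rfl⟩ := (Submodule.mem_span_range_iff_exists_fun E).1 hv₁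
    have hb : ∀ j, b j * a j = 0 := by
      refine Fintype.linearIndependent_iff.1 (linearIndependent_symMono E m) _ ?_
      rw [← hv0, map_sum]
      refine Finset.sum_congr rfl fun j _ => ?_
      rw [map_smul, h.apply, smul_smul]
    have hb' : ∀ j, b j = 0 := fun j => (mul_eq_zero.1 (hb j)).resolve_right (h.ne_zero j)
    change _ + v₂ ∈ spanOf p r F ϖ E {y ∈ S | pairOf p r y ≠ t}
    simpa [hb'] using hv₂
  · have hw : w ∈ Submodule.map Ψ (spanOf p r F ϖ E S) := by
      have : (⊤ : Submodule E (SymPow E m)) ≤ Submodule.map Ψ (spanOf p r F ϖ E S) := by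
        rw [← span_symMono, Submodule.span_le]
        rintro _ ⟨j, rfl⟩
        refine ⟨(a j)⁻¹ • basisElt p F ϖ E r (x j), Submodule.smul_mem _ _
          (basisElt_mem_spanOf (hfib _ ((h.fiber _).2 ⟨j, rfl⟩))), ?_⟩
        rw [map_smul, h.apply, smul_smul, inv_mul_cancel₀ (h.ne_zero j), one_smul]
      exact this trivial
    exact hw

end Subquotients

/-! ### Scalars, signs and binomial coefficients modulo `p` -/

section Symbols

variable {p : ℕ} [Fact p.Prime] {r : ZMod (p - 1)} {F : Type*} [Field F] [Algebra ℚ_[p] F]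
  [FiniteDimensional ℚ_[p] F] (ϖ : integers p F) [hR : IsRamified p F ϖ]
  (E : Type*) [Field E] [Algebra (resField p F) E]

theorem serreWeight_of_redMat_eq_one {g : G₂ p F} (h : redMat p F E g = 1) (i m : ℕ)
    (v : SymPow E m) : serreWeight p F E i m g v = v := by
  rw [serreWeight_apply, h, symAct_one]
  simp

theorem serreWeight_scalar (z : (O₂ p F)ˣ) (i m : ℕ) (v : SymPow E m) :
    serreWeight p F E i m (dia p F z z) v = toE p F E z ^ (2 * i + m) • v := by
  have : serreWeight p F E i m (dia p F z z) =
      toE p F E z ^ (2 * i + m) • (LinearMap.id : SymPow E m →ₗ[E] SymPow E m) := by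
    refine (symBasis E m).ext fun j => ?_
    rw [symBasis_apply, serreWeight_dia p F E i j.is_le, LinearMap.smul_apply, LinearMap.id_apply,
      ← pow_add, Nat.sub_add_cancel j.is_le, ← sq, ← pow_mul, ← pow_add]
  rw [this]
  rfl

include ϖ hR in
theorem neg_one_pow_eq_of_cast_eq {a b : ℕ} (h : (a : ZMod (p - 1)) = b) :
    (-1 : E) ^ a = (-1) ^ b := by
  have := congrArg (algebraMap (resField p F) E)
    (pow_resField_eq_of_cast_eq p F ϖ (x := -1) (by simp) h)
  simpa using this

include ϖ hR in
-- In characteristic `p` one has `p - 1 - i - s = -(i + s + 1)`, so successive binomial coefficients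
-- on the two sides have ratios differing by `-1`. The identity yields the `w`-equivariance of the
-- symbol of `({0}, c)`.
theorem choose_symm_mod {i s : ℕ} (h : i + s < p) :
    (((p - 1 - i).choose s : ℕ) : E) = (-1) ^ s * (((i + s).choose s : ℕ) : E) := by
  have hchar := charP_E p F E ϖ
  induction s with
  | zero => simp
  | succ s ih =>
    have hs : ((s + 1 : ℕ) : E) ≠ 0 :=
      natCast_E_ne_zero p F E ϖ (Nat.not_dvd_of_pos_of_lt (by omega) (by omega))
    have h1 := congrArg (Nat.cast : ℕ → E) (Nat.choose_succ_right_eq (p - 1 - i) s)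
    have h2 := congrArg (Nat.cast : ℕ → E) (Nat.add_one_mul_choose_eq (i + s) s)
    have h3 : ((p - 1 - i - s : ℕ) : E) = -((i + s + 1 : ℕ) : E) := by
      rw [eq_neg_iff_add_eq_zero, ← Nat.cast_add,
        show p - 1 - i - s + (i + s + 1) = p by omega, CharP.cast_eq_zero]
    rw [Nat.cast_mul, Nat.cast_mul, h3, ih (by omega)] at h1
    rw [Nat.cast_mul, Nat.cast_mul] at h2
    apply mul_right_cancel₀ hs
    rw [h1, ← add_assoc, pow_succ]
    linear_combination (-(-1) ^ s) * h2

include ϖ hR in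
theorem pow_mul_inv_pow {a : (resField p F)ˣ} {u v w : ℕ}
    (h : ((u + v : ℕ) : ZMod (p - 1)) = w) :
    algebraMap (resField p F) E a ^ w *
      algebraMap (resField p F) E (a⁻¹ : (resField p F)ˣ) ^ v =
      algebraMap (resField p F) E a ^ u := by
  have h1 := congrArg (algebraMap (resField p F) E)
    (pow_resField_eq_of_cast_eq p F ϖ a.ne_zero h)
  rw [map_pow, map_pow] at h1
  rw [← h1, pow_add, mul_assoc, ← mul_pow, ← map_mul, Units.mul_inv, map_one, one_pow, mul_one]

end Symbols

/-! ### The explicit symbols of `(∅, c)` and `({0}, c)` -/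

section Symbols

variable {p : ℕ} [Fact p.Prime] {r : ZMod (p - 1)} {F : Type*} [Field F] [Algebra ℚ_[p] F]
  [FiniteDimensional ℚ_[p] F] (ϖ : integers p F) [hR : IsRamified p F ϖ]
  (E : Type*) [Field E] [Algebra (resField p F) E]

theorem pairOf_snd (y : Theta p) : (pairOf p r y).2 = y.2 := by
  obtain ⟨_ | j, d⟩ := y <;> rfl

theorem snd_le_of_idx_le {y : Theta p} {t : Pair p} (h : idx p (pairOf p r y) ≤ idx p t) :
    y.2.val ≤ t.2.val := by
  have h1 := card_fin_one_le t.1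
  simp only [idx, pairOf_snd] at h
  omega

theorem lt_wt_of_idx_le {j c : Fin p}
    (h : idx p (pairOf p r (some j, c)) ≤ idx p ((∅, c) : Pair p)) : j.val < (wt p r c).val := by
  by_contra hlt
  rw [pairOf_some, if_pos (by omega)] at h
  simp [idx] at h

include ϖ hR in
theorem neg_one_pow_eq_of_cast_eq_add {a b : ℕ} (x : ZMod (p - 1))
    (h : (a : ZMod (p - 1)) = b + 2 * x) : (-1 : E) ^ a = (-1) ^ b := by
  have : NeZero (p - 1) := ⟨by have := (Fact.out : p.Prime).two_le; omega⟩
  have h2 : (a : ZMod (p - 1)) = (b + 2 * x.val : ℕ) := by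
    push_cast
    rw [ZMod.natCast_val, ZMod.cast_id', id, h]
  rw [neg_one_pow_eq_of_cast_eq ϖ E h2, pow_add, pow_mul]
  simp

theorem redMat_eq_one_of_unip {a : O₂ p F} (h : toE p F E a = 0) :
    redMat p F E (unip p F a) = 1 := by
  rw [redMat_unip, h, Matrix.one_fin_two]

theorem redMat_eq_one_of_dia {u : (O₂ p F)ˣ} (h : toE p F E u = 1) :
    redMat p F E (dia p F u 1) = 1 := by
  rw [redMat_dia, h, Units.val_one, map_one, Matrix.one_fin_two]

theorem toE_tau_mul_eps (a : resField p F) : toE p F E (tau p F ϖ a * eps p F ϖ) = 0 := by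
  rw [toE_apply, map_mul, reduction_eps, mul_zero, map_zero]

variable [Fintype (resField p F)]

variable (r) in
/-- The linear map on `V_{2,r}` with the given values on the `f_{(j₀, j₁)}`. -/
def symbolMap {m : ℕ} (v : Theta p → SymPow E m) : PS p F E r →ₗ[E] SymPow E m :=
  (thetaBasis p F ϖ E r).constr E v

theorem symbolMap_basisElt {m : ℕ} (v : Theta p → SymPow E m) (y : Theta p) :
    symbolMap r ϖ E v (basisElt p F ϖ E r y) = v y := by
  rw [symbolMap, ← thetaBasis_apply, Module.Basis.constr_basis]

theorem symbolMap_bigMono {m : ℕ} (v : Theta p → SymPow E m) {j : ℕ} (hj : j < p) (d : Fin p) :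
    symbolMap r ϖ E v (bigMono p F ϖ E r j d) = v (some ⟨j, hj⟩, d) := by
  rw [← symbolMap_basisElt ϖ E v, basisElt_some]

include ϖ hR in
omit [Fintype (resField p F)] in
theorem serreWeight_scalar_eq {i m : ℕ} (h : ((2 * i + m : ℕ) : ZMod (p - 1)) = r)
    (z : (O₂ p F)ˣ) (v : SymPow E m) :
    serreWeight p F E i m (dia p F z z) v = toE p F E z ^ r.val • v := by
  rw [serreWeight_scalar, pow_toE_eq_of_cast_eq p F E ϖ z.isUnit (b := r.val)]
  rw [h, natCast_val_zmod]

theorem wt_cast (c : Fin p) : ((wt p r c).val : ZMod (p - 1)) = r - 2 * cl p c :=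
  natCast_rep p _

/-- The values on the `f_{(j₀, j₁)}` of the symbol of `(∅, c)`. -/
def botVec (c : Fin p) (m : ℕ) : Theta p → SymPow E m
  | (some j, d) => if d = c ∧ j.val < m then (-1 : E) ^ j.val • symMono E m j else 0
  | (none, d) => if d = c then (-1 : E) ^ c.val • symMono E m m else 0

omit [Fact p.Prime] in
theorem botVec_some {c : Fin p} {m : ℕ} {j : Fin p} (h : j.val < m) :
    botVec E c m (some j, c) = (-1 : E) ^ j.val • symMono E m j := if_pos ⟨rfl, h⟩

omit [Fact p.Prime] in
theorem botVec_none {c : Fin p} {m : ℕ} :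
    botVec E c m (none, c) = (-1 : E) ^ c.val • symMono E m m := if_pos rfl

/-- A translation by `a` expands in powers of `-a` on functions and of `a` on polynomials; the sign
`(-1)^j` reconciles them. The value at `∞` is forced by `f_{(∞, c)} = w f_{(0, c)}` and `w X^s =
(-1)^c Y^s`. Finite indices `j ≥ s` do not occur in `S` at level `c`, so their value is immaterial.
-/
theorem botVec_intertwinesOn (c : Fin p) {S : Set (Theta p)}
    (hS : ∀ y ∈ S, idx p (pairOf p r y) ≤ idx p ((∅, c) : Pair p)) :
    IntertwinesOn (ϖ := ϖ) (serreWeight p F E c (wt p r c)) S c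
      (symbolMap r ϖ E (botVec E c (wt p r c))) where
  level_le y hy := snd_le_of_idx_le (hS y hy)
  eq_zero y _ hlt := by
    rw [symbolMap_basisElt]
    obtain ⟨_ | j, d⟩ := y
    · exact if_neg fun h => by simp [h] at hlt
    · exact if_neg fun h => by simp [h.1] at hlt
  unip_eps a v := serreWeight_of_redMat_eq_one E
    (redMat_eq_one_of_unip E (toE_tau_mul_eps ϖ E a)) _ _ _
  dia_eps a u hu v := serreWeight_of_redMat_eq_one E
    (redMat_eq_one_of_dia E (by rw [hu, map_add, map_one, toE_tau_mul_eps, add_zero])) _ _ _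
  scalar z v := serreWeight_scalar_eq ϖ E (by push_cast; rw [wt_cast, cl]; ring) z _
  dia_tau j hj a := by
    have hlt := lt_wt_of_idx_le (hS _ hj)
    rw [symbolMap_bigMono ϖ E _ j.2, botVec_some E hlt, map_smul,
      serreWeight_dia p F E c hlt.le, smul_comm, tauUnit_val, toE_tau, Units.val_one, map_one,
      mul_one, one_pow, mul_one, ← pow_add]
    rw [pow_mul_inv_pow ϖ E (u := c.val + ((wt p r c).val - j.val))]
    rw [natCast_val_zmod]
    push_cast [Nat.cast_sub hlt.le]
    rw [wt_cast, cl]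
    ring
  unip_tau j hj a := by
    have hlt := lt_wt_of_idx_le (hS _ hj)
    rw [symbolMap_bigMono ϖ E _ j.2, botVec_some E hlt, map_smul,
      serreWeight_unip p F E c hlt.le, Finset.smul_sum, toE_tau]
    refine Finset.sum_congr rfl fun l hl => ?_
    have hl' := Finset.mem_range.1 hl
    rw [symbolMap_bigMono ϖ E _ (by omega : l < p), botVec_some E (by simp only; omega), smul_smul,
      smul_smul, neg_pow]
    congr 1
    have : (-1 : E) ^ j.val = (-1) ^ (j.val - l) * (-1) ^ l := by
      rw [← pow_add, Nat.sub_add_cancel (by omega)]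
    rw [this]
    ring
  unip_tau_infty _ a := by
    rw [symbolMap_basisElt, botVec_none, map_smul, serreWeight_unip p F E c le_rfl,
      Finset.sum_range_succ, smul_add, toE_tau, add_comm]
    congr 1
    · simp
    · rw [Finset.smul_sum, Finset.smul_sum]
      refine Finset.sum_congr rfl fun l hl => ?_
      have hl' := Finset.mem_range.1 hl
      rw [symbolMap_bigMono ϖ E _ (hl'.trans (wt p r c).2), botVec_some E hl', smul_smul,
        smul_smul, smul_smul, neg_pow]
      congr 1
      -- The exponents differ by `2c` modulo `p - 1`, so the signs agree.
      have h1 : (-1 : E) ^ r.val = (-1) ^ (wt p r c).val :=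
        neg_one_pow_eq_of_cast_eq_add ϖ E (cl p c) (by
          rw [natCast_val_zmod, wt_cast]; ring)
      have h2 : (-1 : E) ^ (wt p r c).val = (-1) ^ ((wt p r c).val - l) * (-1) ^ l := by
        rw [← pow_add, Nat.sub_add_cancel hl'.le]
      have h3 : (-1 : E) ^ (wt p r c).val * (-1) ^ (wt p r c).val = 1 := by
        rw [← mul_pow]; simp
      rw [pow_add, h1]
      rw [h2] at h3 ⊢
      linear_combination (-(-1) ^ c.val * algebraMap (resField p F) E a ^ ((wt p r c).val - l) *
        ((wt p r c).val.choose l : E)) * h3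
  swap j hj hj0 := by
    have hlt := lt_wt_of_idx_le (hS _ hj)
    have h1 := rep_wt_sub p r c j
    set j' := rep p (r - 2 * cl p c - cl p j) with hj'
    have h2 : j'.val + j.val = (wt p r c).val := by omega
    rw [symbolMap_bigMono ϖ E _ j.2, symbolMap_bigMono ϖ E _ j'.2, botVec_some E hlt,
      botVec_some E (by simp only; omega), map_smul, serreWeight_xi_zero p F E c hlt.le,
      smul_smul, smul_smul, show (wt p r c).val - j.val = j'.val by omega, ← pow_add, ← pow_add,
      neg_one_pow_eq_of_cast_eq_add ϖ E (a := j.val + c.val) (b := r.val + c.val + j'.val)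
        (cl p j + cl p c - r)]
    push_cast
    rw [natCast_val_zmod, hj', natCast_rep, cl, cl]
    ring
  swap_zero h0 := by
    have hlt := lt_wt_of_idx_le (hS _ h0)
    rw [symbolMap_basisElt, symbolMap_basisElt, botVec_some E hlt, map_smul,
      serreWeight_xi_zero p F E c hlt.le, botVec_none]
    simp

variable (r) in
-- The fibre is listed as `0, 1, …, s - 1, ∞`, with `∞` playing the role of the degree `s` in `Y`.
theorem isSymbol_bot (c : Fin p) :
    IsSymbol (ϖ := ϖ) r (∅, c) c (wt p r c) (symbolMap r ϖ E (botVec E c (wt p r c)))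
      (fun i => (if h : i.val < (wt p r c).val then some ⟨i, h.trans (wt p r c).2⟩ else none, c))
      (fun i => if i.val < (wt p r c).val then (-1 : E) ^ i.val else (-1) ^ c.val) where
  fiber y := by
    constructor
    · intro h
      have hy : y.2 = c := by rw [← pairOf_snd (r := r), h]
      obtain ⟨_ | j, d⟩ := y
      · obtain rfl : d = c := hy
        exact ⟨Fin.last _, by simp⟩
      · obtain rfl : d = c := hy
        have hlt := lt_wt_of_idx_le (congrArg (idx p) h).le
        exact ⟨⟨j, by omega⟩, by simp [hlt]⟩
    · rintro ⟨i, rfl⟩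
      dsimp only
      split_ifs with h
      · rw [pairOf_some, if_neg (by simp only; omega)]
      · rfl
  apply i := by
    rw [symbolMap_basisElt]
    split_ifs with h
    · exact botVec_some E (j := ⟨i.val, _⟩) h
    · rw [botVec_none, show i.val = (wt p r c).val by omega]
  ne_zero i := by
    split_ifs <;> exact pow_ne_zero _ (neg_ne_zero.2 one_ne_zero)
  eq_zero y hy := by
    rw [symbolMap_basisElt]
    obtain ⟨_ | j, d⟩ := y
    · refine if_neg ?_
      rintro rfl
      exact lt_irrefl _ hy
    · refine if_neg ?_
      rintro ⟨rfl, h⟩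
      rw [pairOf_some, if_neg (by omega)] at hy
      exact lt_irrefl _ hy
  intertwines S hS := botVec_intertwinesOn ϖ E c hS

/-- The values on the `f_{(j₀, j₁)}` of the symbol of `({0}, c)`. -/
def topVec (c : Fin p) (s : ℕ) : Theta p → SymPow E (p - 1 - s)
  | (some j, d) => if d = c then
      ((-1 : E) ^ (j.val - s) * (j.val.choose s : E)) • symMono E (p - 1 - s) (j - s) else 0
  | (none, _) => 0

omit [Fact p.Prime] in
theorem topVec_some (c : Fin p) (s : ℕ) (j : Fin p) : topVec E c s (some j, c) =
    ((-1 : E) ^ (j.val - s) * (j.val.choose s : E)) • symMono E (p - 1 - s) (j - s) := if_pos rfl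

omit [Fact p.Prime] in
theorem topVec_of_lt {c : Fin p} {s : ℕ} {j : Fin p} (h : j.val < s) :
    topVec E c s (some j, c) = 0 := by
  rw [topVec_some, Nat.choose_eq_zero_of_lt h]
  simp

/-- The factor `(j choose s)` is that of an `s`-th divided derivative. It vanishes for `j < s`,
which kills the type `(∅, c)`; the identity `(j choose l)(l choose s) = (j choose s)(j - s choose l
- s)` gives compatibility with translations; its symmetry modulo `p` gives compatibility with `w`.
The twist `det^(r-c)` is read off from the torus, through `r - j - c ≡ (r - c) + (p - 1 - j)`. -/
theorem topVec_intertwinesOn (c : Fin p) {S : Set (Theta p)}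
    (hS : ∀ y ∈ S, idx p (pairOf p r y) ≤ idx p (({0}, c) : Pair p)) :
    IntertwinesOn (ϖ := ϖ) (serreWeight p F E (rep p (r - cl p c)) (p - 1 - (wt p r c).val)) S c
      (symbolMap r ϖ E (topVec E c (wt p r c))) where
  level_le y hy := snd_le_of_idx_le (hS y hy)
  eq_zero y _ hlt := by
    rw [symbolMap_basisElt]
    obtain ⟨_ | j, d⟩ := y
    · rfl
    · exact if_neg fun h => by simp [h] at hlt
  unip_eps a v := serreWeight_of_redMat_eq_one E
    (redMat_eq_one_of_unip E (toE_tau_mul_eps ϖ E a)) _ _ _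
  dia_eps a u hu v := serreWeight_of_redMat_eq_one E
    (redMat_eq_one_of_dia E (by rw [hu, map_add, map_one, toE_tau_mul_eps, add_zero])) _ _ _
  scalar z v := serreWeight_scalar_eq ϖ E (by
    have := (wt p r c).2
    push_cast [Nat.cast_sub (show (wt p r c).val ≤ p - 1 by omega)]
    rw [wt_cast, natCast_rep, ZMod.natCast_self]
    ring) z _
  dia_tau j hj a := by
    rw [symbolMap_bigMono ϖ E _ j.2]
    rcases Nat.lt_or_ge j.val (wt p r c).val with hlt | hge
    · rw [topVec_of_lt E hlt, map_zero, smul_zero]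
    have := j.2
    rw [topVec_some, map_smul,
      serreWeight_dia p F E _ (by simp only; omega), smul_comm, tauUnit_val, toE_tau,
      Units.val_one, map_one, mul_one, one_pow, mul_one, ← pow_add]
    rw [pow_mul_inv_pow ϖ E (u := (rep p (r - cl p c)).val +
      (p - 1 - (wt p r c).val - (j.val - (wt p r c).val)))]
    rw [natCast_val_zmod, show p - 1 - (wt p r c).val - (j.val - (wt p r c).val) = p - 1 - j.val by
      omega]
    push_cast [Nat.cast_sub (show j.val ≤ p - 1 by omega)]
    rw [natCast_rep, ZMod.natCast_self, cl]
    ring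
  unip_tau j hj a := by
    rw [symbolMap_bigMono ϖ E _ j.2]
    set s := (wt p r c).val with hs
    rcases Nat.lt_or_ge j.val s with hlt | hge
    · rw [topVec_of_lt E hlt, map_zero, Finset.sum_eq_zero]
      intro l hl
      have hl' := Finset.mem_range.1 hl
      rw [symbolMap_bigMono ϖ E _ (by omega : l < p), topVec_of_lt E (by simp only; omega),
        smul_zero]
    have hjp := j.2
    -- The terms of degree below `s` map to zero, so the sum is reindexed from `s` on.
    rw [topVec_some, map_smul, serreWeight_unip p F E _ (by simp only; omega), toE_tau,
      show Finset.range (j.val + 1) = Finset.range (s + (j.val - s + 1)) by congr 1; omega,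
      Finset.sum_range_add _ s, Finset.sum_eq_zero (s := Finset.range s), zero_add, Finset.smul_sum]
    · refine Finset.sum_congr rfl fun l hl => ?_
      have hl' := Finset.mem_range.1 hl
      rw [symbolMap_bigMono ϖ E _ (by omega : s + l < p), topVec_some]
      simp only [Nat.add_sub_cancel_left]
      rw [smul_smul, smul_smul, neg_pow, Nat.sub_add_eq]
      congr 1
      have h1 : (-1 : E) ^ (j.val - s) = (-1) ^ (j.val - s - l) * (-1) ^ l := by
        rw [← pow_add, Nat.sub_add_cancel (by omega)]
      have h2 := congrArg (Nat.cast : ℕ → E)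
        (Nat.choose_mul (n := j.val) (k := s + l) (s := s) (by omega))
      rw [Nat.add_sub_cancel_left, Nat.cast_mul, Nat.cast_mul] at h2
      rw [h1]
      linear_combination (-(-1) ^ (j.val - s - l) * (-1) ^ l *
        algebraMap (resField p F) E a ^ (j.val - s - l)) * h2
    · intro l hl
      have hl' := Finset.mem_range.1 hl
      rw [symbolMap_bigMono ϖ E _ (by omega : l < p), topVec_of_lt E hl', smul_zero]
  unip_tau_infty _ a := by
    rw [symbolMap_basisElt, Finset.sum_eq_zero, smul_zero, add_zero]
    · exact map_zero _
    · intro l hl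
      have hl' := Finset.mem_range.1 hl
      rw [symbolMap_bigMono ϖ E _ (hl'.trans (wt p r c).2), topVec_of_lt E hl', smul_zero]
  swap j hj hj0 := by
    have h1 := rep_wt_sub p r c j
    set j' := rep p (r - 2 * cl p c - cl p j) with hj'
    rw [symbolMap_bigMono ϖ E _ j.2, symbolMap_bigMono ϖ E _ j'.2]
    rcases Nat.lt_or_ge j.val (wt p r c).val with hlt | hge
    · rw [topVec_of_lt E hlt, topVec_of_lt E (by simp only; omega), map_zero, smul_zero]
    have hjp := j.2
    -- Above the threshold the flip is the reflection of `{s, …, p - 1}`, so `choose_symm_mod` with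
    -- `i = j - s` compares the two binomial coefficients.
    have h2 : j'.val = p - 1 - (j.val - (wt p r c).val) := by omega
    have h3 : j'.val - (wt p r c).val = p - 1 - j.val := by omega
    have h4 := choose_symm_mod ϖ E (i := j.val - (wt p r c).val) (s := (wt p r c).val) (by omega)
    rw [← h2, Nat.sub_add_cancel hge] at h4
    rw [topVec_some, topVec_some, map_smul, serreWeight_xi_zero p F E _ (by simp only; omega),
      smul_smul, smul_smul]
    simp only
    rw [h4, h3, show p - 1 - (wt p r c).val - (j.val - (wt p r c).val) = p - 1 - j.val by omega]
    congr 1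
    have h5 : (-1 : E) ^ (j.val - (wt p r c).val + (rep p (r - cl p c)).val) =
        (-1) ^ (r.val + c.val + (p - 1 - j.val) + (wt p r c).val) := by
      refine neg_one_pow_eq_of_cast_eq_add ϖ E (cl p j + cl p c - r) ?_
      push_cast [Nat.cast_sub hge, Nat.cast_sub (show j.val ≤ p - 1 by omega)]
      rw [natCast_val_zmod, natCast_rep, wt_cast, ZMod.natCast_self, cl, cl]
      ring
    rw [pow_add, pow_add, pow_add _ (r.val + c.val)] at h5
    linear_combination (j.val.choose (wt p r c).val : E) * h5
  swap_zero h0 := by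
    rw [symbolMap_basisElt, symbolMap_basisElt, topVec_of_lt E (rep_pos p _), map_zero]
    rfl

variable (r) in
theorem isSymbol_top (c : Fin p) :
    IsSymbol (ϖ := ϖ) r ({0}, c) (rep p (r - cl p c)) (p - 1 - (wt p r c).val)
      (symbolMap r ϖ E (topVec E c (wt p r c)))
      (fun i => (some ⟨(wt p r c).val + i.val, by have := i.2; have := (wt p r c).2; omega⟩, c))
      (fun i => (-1 : E) ^ i.val * (((wt p r c).val + i.val).choose (wt p r c).val : E)) where
  fiber y := by
    constructor
    · intro h
      have hy : y.2 = c := by rw [← pairOf_snd (r := r), h]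
      obtain ⟨_ | j, d⟩ := y
      · simp [pairOf_none] at h
      · obtain rfl : d = c := hy
        rw [pairOf_some] at h
        have hge : (wt p r d).val ≤ j.val := by
          by_contra hlt
          rw [if_neg hlt] at h
          simp at h
        have := j.2
        exact ⟨⟨j.val - (wt p r d).val, by omega⟩, by simp [Nat.add_sub_cancel' hge]⟩
    · rintro ⟨i, rfl⟩
      dsimp only
      rw [pairOf_some, if_pos (by simp)]
  apply i := by
    rw [symbolMap_basisElt, topVec_some]
    simp only [Nat.add_sub_cancel_left]
  ne_zero i := mul_ne_zero (pow_ne_zero _ (neg_ne_zero.2 one_ne_zero))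
    (choose_ne_zero p F E ϖ (by have := i.2; have := (wt p r c).2; omega) (by omega))
  eq_zero y hy := by
    rw [symbolMap_basisElt]
    obtain ⟨_ | j, d⟩ := y
    · rfl
    · by_cases hd : d = c
      · subst hd
        refine topVec_of_lt E ?_
        by_contra hge
        rw [pairOf_some, if_pos (by omega)] at hy
        exact lt_irrefl _ hy
      · exact if_neg hd
  intertwines S hS := topVec_intertwinesOn ϖ E c hS

end Symbols

/-! ### Multiplicities from one composition series -/

section JordanHolder

variable {R : Type*} [Ring R] {M : Type*} [AddCommGroup M] [Module R M]

/-- Jordan–Hölder matches the factors of any series with those of the given one, so the count of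
factors isomorphic to `S` becomes a count of labels. -/
theorem hasMultiplicity_of_series {ι : Type*} (L : ι → Type*) [∀ t, AddCommGroup (L t)]
    [∀ t, Module R (L t)] (s : CompositionSeries (Submodule R M)) (hs : IsFullSeries s)
    (b : Fin s.length ≃ ι)
    (hb : ∀ i, Nonempty (Subquotient (s i.castSucc) (s i.succ) ≃ₗ[R] L (b i)))
    (S : Type*) [AddCommGroup S] [Module R S] :
    HasMultiplicity R M S {t | Nonempty (L t ≃ₗ[R] S)}.ncard := by
  refine ⟨⟨s, hs⟩, fun s' hs' => ?_⟩
  obtain ⟨f, hf⟩ := CompositionSeries.jordan_holder s s' (hs.1.trans hs'.1.symm)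
    (hs.2.trans hs'.2.symm)
  rw [← Nat.card_coe_set_eq]
  refine (Nat.card_congr ((b.symm.trans f).subtypeEquiv fun t => ?_)).symm
  have hbt := hb (b.symm t)
  rw [Equiv.apply_symm_apply] at hbt
  obtain ⟨e⟩ := hbt
  have e' := JordanHolderLattice.Iso.linearEquiv (hf (b.symm t))
  exact ⟨fun ⟨g⟩ => ⟨e'.symm.trans (e.trans g)⟩, fun ⟨g⟩ => ⟨e.symm.trans (e'.trans g)⟩⟩

end JordanHolder

/-! ### The composition series and the constituents `L(I, γ)` -/

section Constituents

variable {p : ℕ} [Fact p.Prime] (r : ZMod (p - 1)) {F : Type*} [Field F] [Algebra ℚ_[p] F]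
  [FiniteDimensional ℚ_[p] F] (ϖ : integers p F) [hR : IsRamified p F ϖ]
  (E : Type*) [Field E] [Algebra (resField p F) E] [Fintype (resField p F)]

omit [Fact p.Prime] in
theorem pair_cases (t : Pair p) : (∃ c, t = (∅, c)) ∨ ∃ c, t = ({0}, c) := by
  obtain ⟨I, c⟩ := t
  have : I = ∅ ∨ I = {0} := by
    revert I
    decide
  rcases this with rfl | rfl
  · exact .inl ⟨c, rfl⟩
  · exact .inr ⟨c, rfl⟩

/-- The exponent `i` of the weight `det ^ i ⊗ Sym ^ m` attached to a pair. -/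
def detExp (t : Pair p) : ℕ := if t.1 = ∅ then t.2.val else (rep p (r - cl p t.2)).val

/-- The exponent `m` of the weight `det ^ i ⊗ Sym ^ m` attached to a pair. -/
def symExp (t : Pair p) : ℕ := if t.1 = ∅ then (wt p r t.2).val else p - 1 - (wt p r t.2).val

theorem symExp_lt (t : Pair p) : symExp r t < p := by
  have := (wt p r t.2).2
  rw [symExp]
  split_ifs <;> omega

theorem exists_isSymbol (t : Pair p) : ∃ Ψ x a,
    IsSymbol (F := F) (ϖ := ϖ) (E := E) r t (detExp r t) (symExp r t) Ψ x a := by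
  rcases pair_cases t with ⟨c, rfl⟩ | ⟨c, rfl⟩
  · exact ⟨_, _, _, isSymbol_bot r ϖ E c⟩
  · exact ⟨_, _, _, isSymbol_top r ϖ E c⟩

variable {r ϖ E} in
-- It is used for `S = below p r t`, which yields `L(t)`, and for an initial segment of the
-- numbering, which yields a factor of the chain. Both are thereby the same weight, hence isomorphic
-- to each other.
theorem subquotient_equiv {t : Pair p} {S S' : Set (Theta p)} (hS : IsLower p r S)
    (hS' : IsLower p r S') (hle : ∀ y ∈ S, idx p (pairOf p r y) ≤ idx p t)
    (hfib : ∀ y, pairOf p r y = t → y ∈ S) (heq : S' = {y ∈ S | pairOf p r y ≠ t}) :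
    Nonempty (Subquotient (stableSub ϖ E S' hS') (stableSub ϖ E S hS)
      ≃ₗ[MonoidAlgebra E (G₂ p F)]
        (serreWeight p F E (detExp r t) (symExp r t)).asModule) := by
  subst heq
  obtain ⟨Ψ, x, a, h⟩ := exists_isSymbol r ϖ E t
  exact h.nonempty_equiv hS hle hfib hS'

theorem L_equiv (t : Pair p) : Nonempty (L p F ϖ E r t ≃ₗ[MonoidAlgebra E (G₂ p F)]
    (serreWeight p F E (detExp r t) (symExp r t)).asModule) := by
  have hle : ∀ y ∈ below p r t, idx p (pairOf p r y) ≤ idx p t :=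
    fun y hy => idx_le_of_mem_below hy
  have h1 : (⨆ (t' : Pair p) (_ : PairLT p r t' t), VSub p F ϖ E r t') =
    stableSub ϖ E {x ∈ below p r t | pairOf p r x ≠ t} ((isLower_below t).diff_fiber hle) :=
      iSup_VSub_eq t _
  have h2 : ∀ N N' : Submodule (MonoidAlgebra E (G₂ p F)) (V₂Mod p F E r),
      N = stableSub ϖ E {x ∈ below p r t | pairOf p r x ≠ t} ((isLower_below t).diff_fiber hle) →
      N' = stableSub ϖ E (below p r t) (isLower_below t) →
      Nonempty (Subquotient N N' ≃ₗ[MonoidAlgebra E (G₂ p F)]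
        (serreWeight p F E (detExp r t) (symExp r t)).asModule) := by
    rintro _ _ rfl rfl
    exact subquotient_equiv (isLower_below t) _ hle (fun y hy => mem_below_of_pairOf_eq hy) rfl
  exact h2 _ _ h1 (VSub_eq t)

/-- The span of the basis elements whose pair is among the `n` first ones, as a submodule. -/
def chain (n : ℕ) : Submodule (MonoidAlgebra E (G₂ p F)) (V₂Mod p F E r) :=
  stableSub ϖ E {x | idx p (pairOf p r x) < n} (isLower_idx_lt n)

theorem chain_equiv (t : Pair p) : Nonempty (Subquotient (chain r ϖ E (idx p t))
    (chain r ϖ E (idx p t + 1)) ≃ₗ[MonoidAlgebra E (G₂ p F)]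
      (serreWeight p F E (detExp r t) (symExp r t)).asModule) := by
  refine subquotient_equiv _ _ (fun y hy => Nat.lt_succ_iff.1 hy)
    (fun y hy => by rw [Set.mem_ofPred_eq, hy]; exact Nat.lt_succ_self _) ?_
  ext y
  simp only [Set.mem_ofPred_eq]
  exact ⟨fun h => ⟨h.trans (Nat.lt_succ_self _), fun hy => by rw [hy] at h; exact h.false⟩,
    fun h => lt_of_le_of_ne (Nat.lt_succ_iff.1 h.1) fun hy => h.2 (idx_injective p hy)⟩

theorem chain_equiv_symm (n : Fin (2 * p)) : Nonempty (Subquotient (chain r ϖ E n)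
    (chain r ϖ E (n + 1)) ≃ₗ[MonoidAlgebra E (G₂ p F)] (serreWeight p F E
      (detExp r ((idxEquiv p).symm n)) (symExp r ((idxEquiv p).symm n))).asModule) := by
  have h := chain_equiv r ϖ E ((idxEquiv p).symm n)
  rwa [← idxEquiv_val, Equiv.apply_symm_apply] at h

theorem chain_covBy (n : Fin (2 * p)) : chain r ϖ E n ⋖ chain r ϖ E (n + 1) := by
  have hle : chain r ϖ E n ≤ chain r ϖ E (n + 1) :=
    stableSub_mono fun x hx => Nat.lt_succ_of_lt hx
  rw [covBy_iff_quot_is_simple hle]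
  obtain ⟨e⟩ := chain_equiv_symm r ϖ E n
  have := isSimpleModule_serreWeight p F E ϖ (symExp_lt r ((idxEquiv p).symm n))
    (detExp r ((idxEquiv p).symm n))
  exact IsSimpleModule.congr e

/-- The composition series of `V_{2,r}` given by a numbering of the pairs. -/
def chainSeries : CompositionSeries (Submodule (MonoidAlgebra E (G₂ p F)) (V₂Mod p F E r)) where
  length := 2 * p
  toFun n := chain r ϖ E n
  step n := chain_covBy r ϖ E n

theorem chainSeries_isFull : IsFullSeries (chainSeries r ϖ E) := by
  constructor
  · change chain r ϖ E 0 = ⊥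
    refine eq_bot_iff.2 (stableSub_le fun x hx => ?_)
    exact absurd hx (Nat.not_lt_zero _)
  · change chain r ϖ E (2 * p) = ⊤
    refine eq_top_iff.2 fun v _ => ?_
    have h : spanOf p r F ϖ E {x | idx p (pairOf p r x) < 2 * p} = ⊤ := by
      rw [eq_top_iff, ← (thetaBasis p F ϖ E r).span_eq, Submodule.span_le]
      rintro _ ⟨x, rfl⟩
      rw [thetaBasis_apply]
      exact basisElt_mem_spanOf (idx_lt p _)
    rw [chain, mem_stableSub, h]
    trivial

theorem chainSeries_factor (i : Fin (chainSeries r ϖ E).length) :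
    Nonempty (Subquotient (chainSeries r ϖ E i.castSucc) (chainSeries r ϖ E i.succ)
      ≃ₗ[MonoidAlgebra E (G₂ p F)] L p F ϖ E r ((idxEquiv p).symm i)) := by
  obtain ⟨e⟩ := chain_equiv_symm r ϖ E i
  obtain ⟨e'⟩ := L_equiv r ϖ E ((idxEquiv p).symm i)
  exact ⟨e.trans e'.symm⟩

theorem constituentsAre : ConstituentsAre p F ϖ E r := by
  refine ⟨fun t v => ?_, fun t => ?_, chainSeries r ϖ E, chainSeries_isFull r ϖ E, rfl,
    (idxEquiv p).symm, chainSeries_factor r ϖ E⟩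
  · rw [VSub_eq]
    exact mem_stableSub
  · obtain ⟨e⟩ := L_equiv r ϖ E t
    have := isSimpleModule_serreWeight p F E ϖ (symExp_lt r t) (detExp r t)
    exact IsSimpleModule.congr e

variable {r ϖ E}

theorem appearsAs_iff {W : Type*} [AddCommGroup W] [Module E W]
    {σ : Representation E (G₂ p F) W} {m : ℕ} {S : Set (Pair p)}
    (hS : {t : Pair p | Nonempty (L p F ϖ E r t ≃ₗ[MonoidAlgebra E (G₂ p F)] σ.asModule)} = S)
    (hm : S.ncard = m) : AppearsAs p F ϖ E r σ m S := by
  refine ⟨?_, hS⟩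
  rw [← hm, ← hS]
  exact hasMultiplicity_of_series (L p F ϖ E r) (chainSeries r ϖ E) (chainSeries_isFull r ϖ E)
    (idxEquiv p).symm (chainSeries_factor r ϖ E) σ.asModule

theorem appearsAs_of_equiv {W W' : Type*} [AddCommGroup W] [Module E W] [AddCommGroup W']
    [Module E W'] {σ : Representation E (G₂ p F) W} {σ' : Representation E (G₂ p F) W'}
    (e : σ.asModule ≃ₗ[MonoidAlgebra E (G₂ p F)] σ'.asModule) {m : ℕ} {S : Set (Pair p)}
    (h : AppearsAs p F ϖ E r σ m S) (hm : S.ncard = m) : AppearsAs p F ϖ E r σ' m S := by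
  refine appearsAs_iff ?_ hm
  rw [← h.2]
  ext t
  exact ⟨fun ⟨f⟩ => ⟨f.trans e.symm⟩, fun ⟨f⟩ => ⟨f.trans e⟩⟩

/-- The isomorphism class of a weight is the pair formed by `m` and `i` modulo `p - 1`, so all
multiplicity questions become arithmetic in `ℤ/(p-1)`. -/
theorem nonempty_L_equiv_iff {i m : ℕ} (hm : m < p) (t : Pair p) :
    Nonempty (L p F ϖ E r t ≃ₗ[MonoidAlgebra E (G₂ p F)] (serreWeight p F E i m).asModule) ↔
      symExp r t = m ∧ (detExp r t : ZMod (p - 1)) = i := by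
  obtain ⟨e⟩ := L_equiv r ϖ E t
  constructor
  · rintro ⟨f⟩
    exact eq_of_serreWeight_equiv p F E ϖ hm (e.symm.trans f)
  · rintro ⟨rfl, h⟩
    rw [← serreWeight_congr p F E ϖ h]
    exact ⟨e⟩

theorem appearsAs_serreWeight {i m n : ℕ} (hm : m < p) {S : Set (Pair p)}
    (hS : ∀ t, t ∈ S ↔ symExp r t = m ∧ (detExp r t : ZMod (p - 1)) = i) (hn : S.ncard = n) :
    AppearsAs p F ϖ E r (serreWeight p F E i m) n S :=
  appearsAs_iff (Set.ext fun t => (nonempty_L_equiv_iff hm t).trans (hS t).symm) hn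

end Constituents

/-! ### The trivial representation as a Serre weight -/

section Trivial

open scoped MonoidAlgebra in
/-- An equivariant linear equivalence, as an equivalence of modules over the group algebra. -/
def asModuleCongr {k G V W : Type*} [Field k] [Group G] [AddCommGroup V] [Module k V]
    [AddCommGroup W] [Module k W] (ρ : Representation k G V) (σ : Representation k G W)
    (e : V ≃ₗ[k] W) (he : ∀ g v, e (ρ g v) = σ g (e v)) : ρ.asModule ≃ₗ[k[G]] σ.asModule :=
  { (ρ.asModuleEquiv.trans (e.trans σ.asModuleEquiv.symm)).toAddEquiv with
    map_smul' := fun a v => by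
      change σ.asModuleEquiv.symm (e (ρ.asModuleEquiv (a • v))) =
        a • σ.asModuleEquiv.symm (e (ρ.asModuleEquiv v))
      induction a using MonoidAlgebra.induction_linear with
      | zero => simp
      | add a b ha hb => rw [add_smul, add_smul, map_add, map_add, map_add, ha, hb]
      | single g c =>
        rw [Representation.single_smul, Representation.single_smul]
        change e (c • ρ g (ρ.asModuleEquiv v)) = c • σ g (e (ρ.asModuleEquiv v))
        rw [map_smul]
        exact congrArg _ (he g _) }

variable (p : ℕ) [Fact p.Prime] (F : Type*) [Field F] [Algebra ℚ_[p] F]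
  [FiniteDimensional ℚ_[p] F] (E : Type*) [Field E] [Algebra (resField p F) E]

theorem serreWeight_zero_zero (g : G₂ p F) (v : SymPow E 0) : serreWeight p F E 0 0 g v = v := by
  have h : serreWeight p F E 0 0 g = LinearMap.id := by
    refine (symBasis E 0).ext fun j => ?_
    rw [symBasis_apply, serreWeight_apply, pow_zero, one_smul, LinearMap.id_apply,
      show j.val = 0 by omega]
    refine Subtype.ext ?_
    change substMat E _ (symMono E 0 0).1 = (symMono E 0 0).1
    rw [symMono_val le_rfl]
    simp
  rw [h]
  rfl

/-- The weight `det ^ 0 ⊗ Sym ^ 0` is the trivial representation. -/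
def serreWeightEquivTrivial : (serreWeight p F E 0 0).asModule ≃ₗ[MonoidAlgebra E (G₂ p F)]
    (Representation.trivial E (G₂ p F) E).asModule :=
  asModuleCongr _ _ ((symBasis E 0).equivFun.trans (LinearEquiv.funUnique (Fin 1) E E))
    fun g v => by rw [serreWeight_zero_zero]; rfl

end Trivial

/-! ### Arithmetic of exponents in `ℤ/(p-1)` -/

section Exponents

variable (p : ℕ) [Fact p.Prime]

theorem isRamified_of_ramificationIdx (F : Type*) [Field F] [Algebra ℚ_[p] F]
    [FiniteDimensional ℚ_[p] F] (hk : Nat.card (resField p F) = p) (e : ℕ)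
    (he : Ideal.span {(p : integers p F)} = maximalIdeal (integers p F) ^ e) (he2 : 2 ≤ e)
    (ϖ : integers p F) (hϖ : maximalIdeal (integers p F) = Ideal.span {ϖ}) :
    IsRamified p F ϖ where
  card_resField := hk
  natCast_mem := Ideal.pow_le_pow_right he2 (he ▸ Ideal.mem_span_singleton_self _)
  max_eq := hϖ

theorem top_val : (top p).val = p - 1 := rfl

theorem cl_zero : cl p 0 = 0 := by simp [cl]

theorem cl_top : cl p (top p) = 0 := by simp [cl, top_val]

theorem top_ne_zero : top p ≠ 0 := fun h => by
  have h1 := congrArg Fin.val h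
  have := (Fact.out : p.Prime).two_le
  rw [top_val, Fin.val_zero] at h1
  omega

theorem rep_ne_zero (x : ZMod (p - 1)) : rep p x ≠ 0 := fun h => by
  have h1 := rep_pos p x
  rw [h] at h1
  simp at h1

theorem rep_eq_top_iff {x : ZMod (p - 1)} : rep p x = top p ↔ x = 0 := by
  refine ⟨fun h => by rw [← cl_rep p x, h, cl_top], fun h => Fin.ext ?_⟩
  rw [h]
  simp [rep, top_val]

theorem cl_eq_zero_iff {c : Fin p} : cl p c = 0 ↔ c = 0 ∨ c = top p := by
  refine ⟨fun h => ?_, ?_⟩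
  · by_cases hc : c = 0
    · exact .inl hc
    · refine .inr (eq_of_cl_eq p (Fin.val_ne_zero_iff.2 hc)
        (Fin.val_ne_zero_iff.2 (top_ne_zero p)) ?_)
      rw [h, cl_top]
  · rintro (rfl | rfl)
    · exact cl_zero p
    · exact cl_top p

theorem cl_eq_iff {c : Fin p} {x : ZMod (p - 1)} (hx : x ≠ 0) : cl p c = x ↔ c = rep p x := by
  refine ⟨fun h => ?_, fun h => h ▸ cl_rep p x⟩
  have hc : c.val ≠ 0 := fun h0 => hx (by rw [← h, cl, h0, Nat.cast_zero])
  rw [← h, rep_cl p hc]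

theorem rep_cl_of_ne_zero {c : Fin p} (hc : c ≠ 0) : rep p (cl p c) = c :=
  rep_cl p (Fin.val_ne_zero_iff.2 hc)

/-- Equality means that the two representatives add up to `p - 1`. Since both are at least `1`,
neither is `p - 1`, which excludes the zero class. -/
theorem sub_rep_eq_rep_iff {x y : ZMod (p - 1)} :
    p - 1 - (rep p x).val = (rep p y).val ↔ x = -y ∧ y ≠ 0 := by
  have hx := (rep p x).2
  have hy := rep_pos p y
  constructor
  · intro h
    have h1 := congrArg (Nat.cast : ℕ → ZMod (p - 1))
      (show (rep p x).val + (rep p y).val = p - 1 by omega)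
    rw [Nat.cast_add, natCast_rep, natCast_rep, ZMod.natCast_self] at h1
    refine ⟨eq_neg_of_add_eq_zero_left h1, ?_⟩
    rintro rfl
    rw [(rep_eq_top_iff p).2 rfl, top_val] at h
    have := rep_pos p x
    omega
  · rintro ⟨rfl, h0⟩
    have h1 : (rep p y).val ≠ p - 1 := fun h => h0 ((rep_eq_top_iff p).1 (Fin.ext h))
    have h2 := (rep p y).2
    have h3 : rep p (-y) = ⟨p - 1 - (rep p y).val, by omega⟩ := by
      refine (cl_eq_iff p (neg_ne_zero.2 h0)).1 ?_ |>.symm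
      rw [cl, Nat.cast_sub (by omega), natCast_rep, ZMod.natCast_self, zero_sub]
    rw [h3]
    simp only
    omega

theorem wt_eq_top_iff {r : ZMod (p - 1)} {c : Fin p} : wt p r c = top p ↔ r - 2 * cl p c = 0 :=
  rep_eq_top_iff p

variable {p} (hp : 5 ≤ p)
include hp

theorem odd_of_five_le : Odd p := (Fact.out : p.Prime).odd_of_ne_two (by omega)

theorem two_mul_half : 2 * (half p).val = p - 1 := by
  obtain ⟨k, hk⟩ := odd_of_five_le hp
  simp only [half]
  omega

theorem two_mul_cl_half : 2 * cl p (half p) = 0 := by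
  rw [cl, ← Nat.cast_two, ← Nat.cast_mul, two_mul_half hp, ZMod.natCast_self]

theorem half_ne_zero : half p ≠ 0 := fun h => by
  have h1 := two_mul_half hp
  rw [h, Fin.val_zero] at h1
  omega

theorem half_ne_top : half p ≠ top p := fun h => by
  have h1 := two_mul_half hp
  rw [h, top_val] at h1
  omega

theorem cl_half_ne_zero : cl p (half p) ≠ 0 := fun h =>
  ((cl_eq_zero_iff p).1 h).elim (half_ne_zero hp) (half_ne_top hp)

/-- With `x` represented in `[0, p - 1)`, `2x` is a multiple of `p - 1` smaller than `2(p - 1)`,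
hence `0` or `p - 1`. -/
theorem two_mul_eq_zero_iff {x : ZMod (p - 1)} : 2 * x = 0 ↔ x = 0 ∨ x = cl p (half p) := by
  refine ⟨fun h => ?_, ?_⟩
  · have : NeZero (p - 1) := ⟨by omega⟩
    have h1 : ((2 * x.val : ℕ) : ZMod (p - 1)) = 0 := by
      rw [Nat.cast_mul, ZMod.natCast_val, ZMod.cast_id', id, Nat.cast_two, h]
    rw [ZMod.natCast_eq_zero_iff] at h1
    obtain ⟨k, hk⟩ := h1
    have h2 := ZMod.val_lt x
    have h3 : k < 2 := by
      by_contra hk2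
      have := Nat.mul_le_mul_left (p - 1) (show 2 ≤ k by omega)
      omega
    have h4 := two_mul_half hp
    rcases (show k = 0 ∨ k = 1 by omega) with rfl | rfl
    · left
      exact (ZMod.val_eq_zero x).1 (by omega)
    · right
      rw [cl, ← show x.val = (half p).val by omega, ZMod.natCast_val, ZMod.cast_id', id]
  · rintro (rfl | rfl)
    · simp
    · exact two_mul_cl_half hp

/-- As `p - 1` is even, parity is well defined on `ℤ/(p-1)` through reduction to `ℤ/2`. -/
theorem ne_two_mul_of_odd {r : ZMod (p - 1)} (hr : Odd r) (x : ZMod (p - 1)) : r ≠ 2 * x := by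
  obtain ⟨k, rfl⟩ := hr
  intro h
  have hd : 2 ∣ p - 1 := ⟨_, (two_mul_half hp).symm⟩
  have h1 := congrArg (ZMod.castHom hd (ZMod 2)) h
  have h2 : (2 : ZMod 2) = 0 := rfl
  simp only [map_add, map_mul, map_ofNat, map_one, h2, zero_mul, zero_add] at h1
  exact one_ne_zero h1

end Exponents

/-! ### Multiplicities of the individual weights -/

section Multiplicities

variable {p : ℕ} [Fact p.Prime] {r : ZMod (p - 1)} {F : Type*} [Field F] [Algebra ℚ_[p] F]
  [FiniteDimensional ℚ_[p] F] {ϖ : integers p F} [hR : IsRamified p F ϖ]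
  {E : Type*} [Field E] [Algebra (resField p F) E] [Fintype (resField p F)]

/-- The weight `det ^ i ⊗ Sym ^ m` with `m = r - 2 i` not divisible by `p - 1`. -/
theorem appearsAs_generic {i m n : ℕ} (hm : m = (rep p (r - 2 * i)).val)
    (h0 : r - 2 * (i : ZMod (p - 1)) ≠ 0)
    {S : Set (Pair p)} (h1 : ∀ c, (∅, c) ∈ S ↔ cl p c = i)
    (h2 : ∀ c, ({0}, c) ∈ S ↔ cl p c = r - i) (hn : S.ncard = n) :
    AppearsAs p F ϖ E r (serreWeight p F E i m) n S := by
  refine appearsAs_serreWeight (hm ▸ (rep p _).2) (fun t => ?_) hn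
  subst hm
  rcases pair_cases t with ⟨c, rfl⟩ | ⟨c, rfl⟩
  · rw [h1, symExp, detExp, if_pos rfl, if_pos rfl, ← cl]
    refine ⟨fun h => ⟨by rw [wt, h], h⟩, fun h => h.2⟩
  -- The determinant condition reads `r - c = i`, and then `r - 2c = -(r - 2i)`, so the condition on
  -- `m` holds automatically because `r - 2i ≠ 0`.
  · rw [h2, symExp, detExp, if_neg (Finset.singleton_ne_empty _),
      if_neg (Finset.singleton_ne_empty _), wt, sub_rep_eq_rep_iff, natCast_rep]
    simp only
    refine ⟨fun h => ⟨⟨by rw [h]; ring, h0⟩, by rw [h]; ring⟩, fun h => ?_⟩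
    rw [← h.2]
    ring

/-- The weight `det ^ i ⊗ Sym ^ (p - 1)` with `r - 2 i` divisible by `p - 1`. -/
theorem appearsAs_steinberg {i n : ℕ} (h0 : r - 2 * (i : ZMod (p - 1)) = 0)
    {S : Set (Pair p)} (h1 : ∀ c, (∅, c) ∈ S ↔ cl p c = i)
    (h2 : ∀ c, ({0}, c) ∉ S) (hn : S.ncard = n) :
    AppearsAs p F ϖ E r (serreWeight p F E i (p - 1)) n S := by
  have hp := (Fact.out : p.Prime).two_le
  refine appearsAs_serreWeight (by omega) (fun t => ?_) hn
  rcases pair_cases t with ⟨c, rfl⟩ | ⟨c, rfl⟩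
  · rw [h1, symExp, detExp, if_pos rfl, if_pos rfl, ← cl]
    refine ⟨fun h => ⟨?_, h⟩, fun h => h.2⟩
    simp only
    rw [(wt_eq_top_iff p).2 (by rw [h, h0]), top_val]
  · rw [symExp, if_neg (Finset.singleton_ne_empty _)]
    have h3 := rep_pos p (r - 2 * cl p c)
    -- Since `s ≥ 1`, the pairs `({0}, c)` only give `Sym^m` with `m ≤ p - 2`.
    have h4 : p - 1 - (wt p r c).val ≠ p - 1 := by
      rw [wt]
      omega
    exact ⟨fun h => absurd h (h2 c), fun h => absurd h.1 h4⟩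

/-- The weight `det ^ i` with `r - 2 i` divisible by `p - 1`. -/
theorem appearsAs_det {i n : ℕ} (h0 : r - 2 * (i : ZMod (p - 1)) = 0)
    {S : Set (Pair p)} (h1 : ∀ c, (∅, c) ∉ S)
    (h2 : ∀ c, ({0}, c) ∈ S ↔ cl p c = i) (hn : S.ncard = n) :
    AppearsAs p F ϖ E r (serreWeight p F E i 0) n S := by
  have hp := (Fact.out : p.Prime).pos
  refine appearsAs_serreWeight hp (fun t => ?_) hn
  rcases pair_cases t with ⟨c, rfl⟩ | ⟨c, rfl⟩
  · rw [symExp, if_pos rfl]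
    have h3 := rep_pos p (r - 2 * cl p c)
    have h4 : (wt p r c).val ≠ 0 := by
      rw [wt]
      omega
    exact ⟨fun h => absurd h (h1 c), fun h => absurd h.1 h4⟩
  · rw [h2, symExp, detExp, if_neg (Finset.singleton_ne_empty _),
      if_neg (Finset.singleton_ne_empty _), natCast_rep]
    simp only
    constructor
    · intro h
      refine ⟨?_, ?_⟩
      · rw [(wt_eq_top_iff p).2 (by rw [h, h0]), top_val, Nat.sub_self]
      · rw [h]
        linear_combination h0
    · rintro ⟨-, h⟩
      linear_combination h0 - h

/-- The weights occurring three times. -/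
theorem appearsAs_three (hr : r ≠ 0) :
    AppearsAs p F ϖ E r (serreWeight p F E 0 (rep p r)) 3
        {(∅, 0), ({0}, rep p r), (∅, top p)} ∧
      AppearsAs p F ϖ E r (serreWeight p F E (rep p r) (p - 1 - (rep p r).val)) 3
        {({0}, 0), (∅, rep p r), ({0}, top p)} := by
  have ht := top_ne_zero p
  constructor
  -- Here `i = 0`: the class of `i` has the two representatives `0` and `p - 1`, and that of `r - i
  -- = r` has one.
  · refine appearsAs_generic (by simp) (by simpa using hr) (fun c => ?_) (fun c => ?_) ?_
    · simp [cl_eq_zero_iff, Prod.ext_iff, (Finset.singleton_ne_empty _).symm]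
    · simp [cl_eq_iff p hr, Prod.ext_iff]
    · rw [Set.ncard_eq_three]
      exact ⟨_, _, _, by simp, by simp [ht.symm], by simp, rfl⟩
  -- Here `i = r`: now it is `r - i = 0` that has two representatives.
  · refine appearsAs_generic ?_ ?_ (fun c => ?_) (fun c => ?_) ?_
    · rw [sub_rep_eq_rep_iff, natCast_rep]
      refine ⟨by ring, fun h => hr ?_⟩
      linear_combination -h
    · rw [natCast_rep]
      refine fun h => hr ?_
      linear_combination -h
    · rw [natCast_rep, cl_eq_iff p hr]
      simp [Prod.ext_iff, (Finset.singleton_ne_empty _).symm]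
    · rw [natCast_rep, sub_self, cl_eq_zero_iff]
      simp [Prod.ext_iff]
    · rw [Set.ncard_eq_three]
      exact ⟨_, _, _, by simp, by simp [ht.symm], by simp, rfl⟩

/-- The weights occurring twice. -/
theorem appearsAs_two {i : Fin p} (h0 : i ≠ 0) (ht : i ≠ top p) (hr : i ≠ rep p r)
    (hw : r - 2 * cl p i ≠ 0) :
    AppearsAs p F ϖ E r (serreWeight p F E i (rep p (r - 2 * cl p i))) 2
      {(∅, i), ({0}, rep p (r - cl p i))} := by
  have hi : cl p i ≠ 0 := fun h => ((cl_eq_zero_iff p).1 h).elim h0 ht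
  have hri : r - cl p i ≠ 0 := fun h => hr (by rw [sub_eq_zero.1 h, rep_cl_of_ne_zero p h0])
  refine appearsAs_generic rfl hw (fun c => ?_) (fun c => ?_) ?_
  · rw [← cl, cl_eq_iff p hi, rep_cl_of_ne_zero p h0]
    simp [Prod.ext_iff, (Finset.singleton_ne_empty _).symm]
  · rw [← cl, cl_eq_iff p hri]
    simp [Prod.ext_iff]
  · exact Set.ncard_pair (by simp)

theorem appearsAs_steinberg_one {c : Fin p} (h0 : c ≠ 0) (ht : c ≠ top p)
    (hw : r - 2 * cl p c = 0) :
    AppearsAs p F ϖ E r (serreWeight p F E c (p - 1)) 1 {(∅, c)} := by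
  have hc : cl p c ≠ 0 := fun h => ((cl_eq_zero_iff p).1 h).elim h0 ht
  refine appearsAs_steinberg hw (fun d => ?_) (fun d => by simp) (Set.ncard_singleton _)
  rw [← cl, cl_eq_iff p hc, rep_cl_of_ne_zero p h0]
  simp

theorem appearsAs_det_one {c : Fin p} (h0 : c ≠ 0) (ht : c ≠ top p)
    (hw : r - 2 * cl p c = 0) :
    AppearsAs p F ϖ E r (serreWeight p F E c 0) 1 {({0}, c)} := by
  have hc : cl p c ≠ 0 := fun h => ((cl_eq_zero_iff p).1 h).elim h0 ht
  refine appearsAs_det hw (fun d => by simp [(Finset.singleton_ne_empty _).symm]) (fun d => ?_)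
    (Set.ncard_singleton _)
  rw [← cl, cl_eq_iff p hc, rep_cl_of_ne_zero p h0]
  simp

theorem appearsAs_steinberg_zero :
    AppearsAs p F ϖ E 0 (serreWeight p F E 0 (p - 1)) 2 {(∅, 0), (∅, top p)} := by
  refine appearsAs_steinberg (by simp) (fun d => ?_) (fun d => by simp)
    (Set.ncard_pair (by simp [(top_ne_zero p).symm]))
  simp [cl_eq_zero_iff]

theorem appearsAs_trivial_zero :
    AppearsAs p F ϖ E 0 (Representation.trivial E (G₂ p F) E) 2 {({0}, 0), ({0}, top p)} := by
  have hn : ({({0}, 0), ({0}, top p)} : Set (Pair p)).ncard = 2 :=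
    Set.ncard_pair (by simp [(top_ne_zero p).symm])
  refine appearsAs_of_equiv (serreWeightEquivTrivial p F E) (appearsAs_det (by simp)
    (fun d => by simp [(Finset.singleton_ne_empty _).symm]) (fun d => ?_) hn) hn
  simp [cl_eq_zero_iff]

omit [Fact p.Prime] in
theorem ncard_compl_eq {s : Finset (Fin p)} {n : ℕ} (hs : s.card = n) {P : Fin p → Prop}
    (hP : ∀ i, P i ↔ i ∉ s) : {i | P i}.ncard = p - n := by
  have : {i | P i} = ((sᶜ : Finset (Fin p)) : Set (Fin p)) := by
    ext i
    simp [hP]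
  rw [this, Set.ncard_coe_finset, Finset.card_compl, hs, Fintype.card_fin]

/-- Writing `r = 2y`, the solutions of `2c = r` are `y` and `y + (p - 1)/2`. Neither is the zero
class because `r ≠ 0`, so each has a single representative in `Ñ`. -/
theorem exists_pair_of_even (hp : 5 ≤ p) (hr : Even r) (h0 : r ≠ 0) :
    ∃ a b : Fin p, a ≠ b ∧ ∀ c : Fin p, rep p (r - 2 * cl p c) = top p ↔ c = a ∨ c = b := by
  obtain ⟨y, rfl⟩ := hr
  have hy : y ≠ 0 := fun h => h0 (by simp [h])
  have hh := two_mul_cl_half hp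
  have hy' : y + cl p (half p) ≠ 0 := fun h => h0 (by linear_combination 2 * h - hh)
  refine ⟨rep p y, rep p (y + cl p (half p)), fun h => ?_, fun c => ?_⟩
  · have h1 := congrArg (cl p) h
    rw [cl_rep, cl_rep] at h1
    exact cl_half_ne_zero hp (by linear_combination -h1)
  · rw [rep_eq_top_iff, ← cl_eq_iff p hy, ← cl_eq_iff p hy']
    have h1 := two_mul_eq_zero_iff hp (x := cl p c - y)
    rw [sub_eq_zero, sub_eq_iff_eq_add, add_comm (cl p (half p))] at h1
    rw [← h1]
    constructor
    · intro h
      linear_combination -h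
    · intro h
      linear_combination -h

end Multiplicities

end PrincipalSeries

end

theorem mainTheorem11 (p : ℕ) [Fact p.Prime] (hp : 5 ≤ p)
    (F : Type*) [Field F] [Algebra ℚ_[p] F] [FiniteDimensional ℚ_[p] F]
    -- `F / ℚ_p` is totally ramified (`k = 𝔽_p`) and non-trivial (`e ≥ 2`)
    (hk : Nat.card (resField p F) = p) (e : ℕ)
    (he : Ideal.span {(p : integers p F)} = IsLocalRing.maximalIdeal (integers p F) ^ e)
    (he2 : 2 ≤ e)
    (ϖ : integers p F) (hϖ : IsLocalRing.maximalIdeal (integers p F) = Ideal.span {ϖ})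
    (E : Type*) [Field E] [Algebra (resField p F) E] (r : ZMod (p - 1)) :
    -- the case of odd `r`
    (Odd r →
      ConstituentsAre p F ϖ E r ∧
      AppearsAs p F ϖ E r (serreWeight p F E 0 (rep p r)) 3
        {(∅, 0), ({0}, rep p r), (∅, top p)} ∧
      AppearsAs p F ϖ E r (serreWeight p F E (rep p r) (p - 1 - (rep p r).val)) 3
        {({0}, 0), (∅, rep p r), ({0}, top p)} ∧
      {i : Fin p | i ≠ 0 ∧ i ≠ rep p r ∧ i ≠ top p}.ncard = p - 3 ∧
      ∀ i : Fin p, i ≠ 0 → i ≠ rep p r → i ≠ top p →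
        AppearsAs p F ϖ E r (serreWeight p F E i (rep p (r - 2 * cl p i))) 2
          {(∅, i), ({0}, rep p (r - cl p i))}) ∧
    -- the case of even `r`
    (Even r →
      ConstituentsAre p F ϖ E r ∧
      (rep p r ≠ top p →
        AppearsAs p F ϖ E r (serreWeight p F E 0 (rep p r)) 3
          {(∅, 0), ({0}, rep p r), (∅, top p)} ∧
        AppearsAs p F ϖ E r (serreWeight p F E (rep p r) (p - 1 - (rep p r).val)) 3
          {({0}, 0), (∅, rep p r), ({0}, top p)} ∧
        {c : Fin p | rep p (r - 2 * cl p c) = top p}.ncard = 2 ∧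
        (∀ c : Fin p, rep p (r - 2 * cl p c) = top p →
          AppearsAs p F ϖ E r (serreWeight p F E c (p - 1)) 1 {(∅, c)} ∧
          serreWeight p F E c 0 = serreWeight p F E (rep p (r - cl p c)) 0 ∧
          AppearsAs p F ϖ E r (serreWeight p F E c 0) 1 {({0}, c)}) ∧
        {i : Fin p | i ≠ 0 ∧ i ≠ rep p r ∧ i ≠ top p ∧
          rep p (r - 2 * cl p i) ≠ top p}.ncard = p - 5 ∧
        ∀ i : Fin p, i ≠ 0 → i ≠ rep p r → i ≠ top p → rep p (r - 2 * cl p i) ≠ top p →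
          AppearsAs p F ϖ E r (serreWeight p F E i (rep p (r - 2 * cl p i))) 2
            {(∅, i), ({0}, rep p (r - cl p i))}) ∧
      (rep p r = top p →
        AppearsAs p F ϖ E r (serreWeight p F E 0 (p - 1)) 2 {(∅, 0), (∅, top p)} ∧
        AppearsAs p F ϖ E r (Representation.trivial E (G₂ p F) E) 2 {({0}, 0), ({0}, top p)} ∧
        AppearsAs p F ϖ E r (serreWeight p F E (half p) (p - 1)) 1 {(∅, half p)} ∧
        AppearsAs p F ϖ E r (serreWeight p F E (half p) 0) 1 {({0}, half p)} ∧
        {i : Fin p | i ≠ 0 ∧ i ≠ half p ∧ i ≠ top p}.ncard = p - 3 ∧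
        ∀ i : Fin p, i ≠ 0 → i ≠ half p → i ≠ top p →
          AppearsAs p F ϖ E r (serreWeight p F E i (rep p (r - 2 * cl p i))) 2
            {(∅, i), ({0}, rep p (r - cl p i))})) := by
  have hR : IsRamified p F ϖ := isRamified_of_ramificationIdx p F hk e he he2 ϖ hϖ
  have := finite_resField p F ϖ
  let _ := Fintype.ofFinite (resField p F)
  have ht := top_ne_zero p
  refine ⟨fun hodd => ?_, fun heven => ⟨constituentsAre r ϖ E, fun hrt => ?_, fun hrt => ?_⟩⟩
  · have hr : r ≠ 0 := fun h => ne_two_mul_of_odd hp hodd 0 (by rw [h, mul_zero])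
    have hrt : rep p r ≠ top p := fun h => hr ((rep_eq_top_iff p).1 h)
    refine ⟨constituentsAre r ϖ E, (appearsAs_three hr).1, (appearsAs_three hr).2, ?_,
      fun i h0 h1 h2 => appearsAs_two h0 h2 h1 (sub_ne_zero.2 (ne_two_mul_of_odd hp hodd _))⟩
    exact ncard_compl_eq (s := {0, rep p r, top p})
      (Finset.card_eq_three.2 ⟨_, _, _, (rep_ne_zero p r).symm, ht.symm, hrt, rfl⟩)
      fun i => by simp
  · have hr : r ≠ 0 := fun h => hrt ((rep_eq_top_iff p).2 h)
    -- A solution of `2c = r` with `r ≠ 0` is neither the zero class nor `r` itself, so the five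
    -- excluded exponents counted below are distinct.
    have hne : ∀ c : Fin p, rep p (r - 2 * cl p c) = top p → c ≠ 0 ∧ c ≠ top p ∧ c ≠ rep p r := by
      intro c hc
      rw [rep_eq_top_iff] at hc
      refine ⟨?_, ?_, ?_⟩
      · rintro rfl
        exact hr (by simpa [cl_zero] using hc)
      · rintro rfl
        exact hr (by simpa [cl_top] using hc)
      · rintro rfl
        rw [cl_rep] at hc
        exact hr (by linear_combination -hc)
    obtain ⟨a, b, hab, hc⟩ := exists_pair_of_even hp heven hr
    obtain ⟨ha0, hat, har⟩ := hne a ((hc a).2 (.inl rfl))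
    obtain ⟨hb0, hbt, hbr⟩ := hne b ((hc b).2 (.inr rfl))
    refine ⟨(appearsAs_three hr).1, (appearsAs_three hr).2, ?_, fun c hcw => ?_, ?_,
      fun i h0 h1 h2 h3 => appearsAs_two h0 h2 h1 fun h => h3 ((rep_eq_top_iff p).2 h)⟩
    · rw [Set.ncard_eq_two]
      exact ⟨a, b, hab, Set.ext hc⟩
    · obtain ⟨hc0, hct, -⟩ := hne c hcw
      have hw := (rep_eq_top_iff p).1 hcw
      refine ⟨appearsAs_steinberg_one hc0 hct hw, serreWeight_congr p F E ϖ ?_ 0,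
        appearsAs_det_one hc0 hct hw⟩
      rw [natCast_rep, ← cl]
      -- The relation `r = 2c` gives `r - c = c`, hence equal powers of the determinant.
      linear_combination -hw
    · refine ncard_compl_eq (s := {0, rep p r, top p, a, b}) ?_ fun i => ?_
      · rw [Finset.card_insert_of_notMem, Finset.card_insert_of_notMem,
          Finset.card_insert_of_notMem, Finset.card_pair hab]
        · simp [hat.symm, hbt.symm]
        · simp [hrt, har.symm, hbr.symm]
        · simp [(rep_ne_zero p r).symm, ht.symm, ha0.symm, hb0.symm]
      · rw [ne_eq (rep p _), hc]
        simp
  · obtain rfl := (rep_eq_top_iff p).1 hrt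
    have hh : (0 : ZMod (p - 1)) - 2 * cl p (half p) = 0 := by rw [two_mul_cl_half hp, sub_zero]
    refine ⟨appearsAs_steinberg_zero, appearsAs_trivial_zero,
      appearsAs_steinberg_one (half_ne_zero hp) (half_ne_top hp) hh,
      appearsAs_det_one (half_ne_zero hp) (half_ne_top hp) hh, ?_, fun i h0 h1 h2 =>
      appearsAs_two h0 h2 (hrt ▸ h2) ?_⟩
    · exact ncard_compl_eq (s := {0, half p, top p})
        (Finset.card_eq_three.2 ⟨_, _, _, (half_ne_zero hp).symm, ht.symm, half_ne_top hp, rfl⟩)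
        fun i => by simp
    · intro h
      rw [zero_sub, neg_eq_zero, two_mul_eq_zero_iff hp, cl_eq_zero_iff,
        cl_eq_iff p (cl_half_ne_zero hp), rep_cl_of_ne_zero p (half_ne_zero hp)] at h
      tauto
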